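/- **Corollary.** For a finite graph $H$ let $\mu(H)$ be the maximum size of a matching of $H$. For a graph $G=(V,E)$ and $p\in(0,1]$ let $G_p$ be the random subgraph of $G$ that contains each edge independently with probability $p$; for $Q\subseteq E$ let $Q_p$ be the set of edges of $Q$ that are realized in $G_p$. Note that $0.731<\frac{e}{e+1}$. For every constant $\alpha<\frac{e}{e+1}$ (in particular for $\alpha=0.731$) there are a constant $K$, numbers $R(p)\in\mathbb N$ for $p\in(0,1]$ with $$R(p)\le K\cdot\frac{1+\log(1/p)}{p},$$ a deterministic maximum matching algorithm $\mathsf{MM}$ for bipartite graphs, and a single randomized non-adaptive query algorithm, with access to $p$ (through comparisons with rational numbers) and to independent $p$-biased random bits, such that for every finite bipartite graph $G$ on $n$ vertices and every $p\in(0,1]$ the following holds. 1. On input $G$ and $p$ the algorithm always halts after a number of steps that is polynomial in $n$ and $1/p$. 2. Without knowing anything about the realization, it chooses a set $Q\subseteq E$ of edges to query, and at every vertex at most $R(p)$ edges are queried. The set $Q$ is distributed as $\mathsf{MM}(G_1)\cup\dots\cup\mathsf{MM}(G_{R(p)})$, where $G_1,\dots,G_{R(p)}$ are independent copies of $G_p$,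 and it is independent of $G_p$. 3. After it has learned $Q_p$, the algorithm returns a maximum matching $M$ of $Q_p$. In particular, $M$ is always a matching of $G_p$, and $$\mathbb E\,|M|\;\ge\;\alpha\cdot\mathbb E[\mu(G_p)],$$ where the expectation on the left is over both the random bits of the algorithm and $G_p$. -/

import Mathlib

open MeasureTheory ProbabilityTheory

/-! ### Matchings of finite graphs, given by their edge sets -/

/-- `M` is a matching of the graph with edge set `H`: a set of edges of `H`, no two of which share
a vertex. -/
def IsMatchingOf {V : Type*} (H M : Finset (Sym2 V)) : Prop :=
  M ⊆ H ∧ ∀ e ∈ M, ∀ f ∈ M, ∀ v : V, v ∈ e → v ∈ f → e = f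

open Classical in
/-- The maximum size `μ(H)` of a matching of the graph with edge set `H`. -/
noncomputable def matchingNumber {V : Type*} (H : Finset (Sym2 V)) : ℕ :=
  (H.powerset.filter (IsMatchingOf H)).sup Finset.card

/-- `M` is a maximum matching of the graph with edge set `H`. -/
def IsMaximumMatchingOf {V : Type*} (H M : Finset (Sym2 V)) : Prop :=
  IsMatchingOf H M ∧ M.card = matchingNumber H

/-- `MM` is a deterministic algorithm, in the extensional sense, which returns a maximum matching of
every bipartite graph on a vertex set `{0, …, n - 1}`. -/
def IsMaximumMatchingRule (MM : ∀ n : ℕ, Finset (Sym2 (Fin n)) → Finset (Sym2 (Fin n))) : Prop :=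
  ∀ (n : ℕ) (G : SimpleGraph (Fin n)) [DecidableRel G.Adj], G.IsBipartite →
    IsMaximumMatchingOf G.edgeFinset (MM n G.edgeFinset)

/-! ### Random realizations -/

/-- The law of independent `p`-biased bits, one for each pair of vertices; the bit of a pair says
whether this pair, if it is an edge, is realized. -/
noncomputable def realizationLaw (n : ℕ) (p : unitInterval) : Measure (Sym2 (Fin n) → Bool) :=
  Measure.pi fun _ => bernoulliMeasure true false p

/-- The law of an infinite sequence of independent `p`-biased bits. -/
noncomputable def tapeLaw (p : unitInterval) : Measure (ℕ → Bool) :=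
  Measure.infinitePi fun _ => bernoulliMeasure true false p

/-- The realized edges among the edges in `E`. -/
def realized {n : ℕ} (E : Finset (Sym2 (Fin n))) (r : Sym2 (Fin n) → Bool) :
    Finset (Sym2 (Fin n)) :=
  E.filter fun e => r e = true

/-- The union of the matchings `MM(G_1), …, MM(G_R)`, where `G_i` is the realization of the graph
with edge set `E` that is given by `x i`. -/
def unionOfMatchings (MM : ∀ n : ℕ, Finset (Sym2 (Fin n)) → Finset (Sym2 (Fin n)))
    {n : ℕ} (E : Finset (Sym2 (Fin n))) {R : ℕ} (x : Fin R → Sym2 (Fin n) → Bool) :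
    Finset (Sym2 (Fin n)) :=
  Finset.univ.biUnion fun i => MM n (realized E (x i))

/-! ### A randomized random access machine

Programs are finite pieces of syntax. The memory consists of arrays of natural numbers; a cell is
addressed by the name of its array and two indices. The arithmetic operations are addition and
(truncated) subtraction only, so that numbers have at most linearly many bits in the running time
and the unit-cost measure is polynomially related to Turing machine time. The real parameter `p` is
accessible in two ways: by comparing it with a quotient of two natural numbers, and by drawing
independent `p`-biased bits. -/

/-- A memory: the value of the cell `(i, j)` of the array `a` is `m a i j`. -/
abbrev Memory := ℕ → ℕ → ℕ → ℕ

/-- Writing one cell. -/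
def Memory.write (m : Memory) (a i j x : ℕ) : Memory :=
  fun a' i' j' => if a' = a ∧ i' = i ∧ j' = j then x else m a' i' j'

/-- Replacing a whole array. -/
def Memory.setArray (m : Memory) (a : ℕ) (f : ℕ → ℕ → ℕ) : Memory :=
  fun a' => if a' = a then f else m a'

/-- Arithmetic expressions. -/
inductive Expr where
  | const (k : ℕ)
  | cell (a : ℕ) (i j : Expr)
  | add (x y : Expr)
  | sub (x y : Expr)

def Expr.eval (m : Memory) : Expr → ℕ
  | const k => k
  | cell a i j => m a (i.eval m) (j.eval m)
  | add x y => x.eval m + y.eval m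
  | sub x y => x.eval m - y.eval m

/-- Tests. The test `leMulParam x y` compares `x` with `p * y`. -/
inductive Test where
  | le (x y : Expr)
  | eq (x y : Expr)
  | leMulParam (x y : Expr)
  | not (b : Test)
  | and (b c : Test)

def Test.Holds (p : ℝ) (m : Memory) : Test → Prop
  | le x y => x.eval m ≤ y.eval m
  | eq x y => x.eval m = y.eval m
  | leMulParam x y => (x.eval m : ℝ) ≤ p * (y.eval m : ℝ)
  | not b => ¬ b.Holds p m
  | and b c => b.Holds p m ∧ c.Holds p m

/-- Programs. `coin a i j` stores a fresh random bit in a cell. -/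
inductive Program where
  | skip
  | assign (a : ℕ) (i j x : Expr)
  | coin (a : ℕ) (i j : Expr)
  | seq (c d : Program)
  | ite (b : Test) (c d : Program)
  | while (b : Test) (c : Program)

/-- A machine state: the memory and the number of random bits drawn so far. -/
structure MachineState where
  mem : Memory
  drawn : ℕ

/-- `Exec p ω c s t s'`: with parameter `p` and with `ω` as the sequence of the random bits, the
program `c` started in the state `s` halts after `t` steps in the state `s'`. Every assignment,
draw of a random bit, evaluation of a test and `skip` is one step. -/
inductive Exec (p : ℝ) (ω : ℕ → Bool) : Program → MachineState → ℕ → MachineState → Prop where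
  | skip (s : MachineState) : Exec p ω .skip s 1 s
  | assign (a : ℕ) (i j x : Expr) (s : MachineState) :
      Exec p ω (.assign a i j x) s 1
        ⟨s.mem.write a (i.eval s.mem) (j.eval s.mem) (x.eval s.mem), s.drawn⟩
  | coin (a : ℕ) (i j : Expr) (s : MachineState) :
      Exec p ω (.coin a i j) s 1
        ⟨s.mem.write a (i.eval s.mem) (j.eval s.mem) (ω s.drawn).toNat, s.drawn + 1⟩
  | seq {c d : Program} {s s' s'' : MachineState} {t t' : ℕ} :
      Exec p ω c s t s' → Exec p ω d s' t' s'' → Exec p ω (.seq c d) s (t + t') s''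
  | ite_true {b : Test} {c d : Program} {s s' : MachineState} {t : ℕ} :
      b.Holds p s.mem → Exec p ω c s t s' → Exec p ω (.ite b c d) s (t + 1) s'
  | ite_false {b : Test} {c d : Program} {s s' : MachineState} {t : ℕ} :
      ¬ b.Holds p s.mem → Exec p ω d s t s' → Exec p ω (.ite b c d) s (t + 1) s'
  | while_true {b : Test} {c : Program} {s s' s'' : MachineState} {t t' : ℕ} :
      b.Holds p s.mem → Exec p ω c s t s' → Exec p ω (.while b c) s' t' s'' →
        Exec p ω (.while b c) s (t + t' + 1) s''
  | while_false {b : Test} {c : Program} {s : MachineState} :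
      ¬ b.Holds p s.mem → Exec p ω (.while b c) s 1 s

/-- Running times and final states are determined by the initial state and the random bits. -/
theorem Exec.unique {p : ℝ} {ω : ℕ → Bool} {c : Program} {s s₁ s₂ : MachineState} {t₁ t₂ : ℕ}
    (h₁ : Exec p ω c s t₁ s₁) (h₂ : Exec p ω c s t₂ s₂) : t₁ = t₂ ∧ s₁ = s₂ := by
  induction h₁ generalizing t₂ s₂ with
  | skip => cases h₂; exact ⟨rfl, rfl⟩
  | assign => cases h₂; exact ⟨rfl, rfl⟩
  | coin => cases h₂; exact ⟨rfl, rfl⟩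
  | seq _ _ ih ih' =>
    cases h₂ with
    | seq g g' =>
      obtain ⟨rfl, rfl⟩ := ih g
      obtain ⟨rfl, rfl⟩ := ih' g'
      exact ⟨rfl, rfl⟩
  | ite_true hb _ ih =>
    cases h₂ with
    | ite_true _ g => obtain ⟨rfl, rfl⟩ := ih g; exact ⟨rfl, rfl⟩
    | ite_false hb' _ => exact absurd hb hb'
  | ite_false hb _ ih =>
    cases h₂ with
    | ite_true hb' _ => exact absurd hb' hb
    | ite_false _ g => obtain ⟨rfl, rfl⟩ := ih g; exact ⟨rfl, rfl⟩
  | while_true hb _ _ ih ih' =>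
    cases h₂ with
    | while_true _ g g' =>
      obtain ⟨rfl, rfl⟩ := ih g
      obtain ⟨rfl, rfl⟩ := ih' g'
      exact ⟨rfl, rfl⟩
    | while_false hb' => exact absurd hb hb'
  | while_false hb =>
    cases h₂ with
    | while_true hb' _ _ => exact absurd hb' hb
    | while_false _ => exact ⟨rfl, rfl⟩

/-! ### Non-adaptive query algorithms -/

/-- The array that represents the graph on `{0, …, n - 1}` with edge set `E`. -/
def adjacencyArray {n : ℕ} (E : Finset (Sym2 (Fin n))) : ℕ → ℕ → ℕ :=
  fun i j => if h : i < n ∧ j < n then if s(⟨i, h.1⟩, ⟨j, h.2⟩) ∈ E then 1 else 0 else 0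

/-- The set of pairs of vertices that an array marks by a nonzero entry. -/
def markedPairs (n : ℕ) (f : ℕ → ℕ → ℕ) : Finset (Sym2 (Fin n)) :=
  (Finset.univ.filter fun uv : Fin n × Fin n => f uv.1 uv.2 ≠ 0).image fun uv => s(uv.1, uv.2)

/-- The initial state: the cell `(0, 0)` of array `0` holds the number of vertices, array `1` holds
the adjacency matrix of the base graph, all other cells hold `0`. -/
def inputState {n : ℕ} (E : Finset (Sym2 (Fin n))) : MachineState where
  mem := (Memory.write (fun _ _ _ => 0) 0 0 0 n).setArray 1 (adjacencyArray E)
  drawn := 0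

/-- A non-adaptive query algorithm: the program `select` chooses, knowing the base graph but not its
realization, the set of all edges to query; the program `answer` continues when it has been told
which of the queried edges are realized. -/
structure QueryAlgorithm where
  select : Program
  answer : Program

/-- `A.Runs p ω E r t Q M`: on the base graph with edge set `E`, with parameter `p`, random bits `ω`
and realization `r`, the algorithm queries the set `Q` (which it marks in array `2`), receives the
realized part of `Q` (in array `3`), and returns the set `M` (marked in array `4`), in `t` steps
altogether. -/
def QueryAlgorithm.Runs (A : QueryAlgorithm) (p : ℝ) (ω : ℕ → Bool) {n : ℕ}
    (E : Finset (Sym2 (Fin n))) (r : Sym2 (Fin n) → Bool) (t : ℕ)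
    (Q M : Finset (Sym2 (Fin n))) : Prop :=
  ∃ (s s' : MachineState) (t₁ t₂ : ℕ),
    Exec p ω A.select (inputState E) t₁ s ∧
    Q = markedPairs n (s.mem 2) ∧
    Exec p ω A.answer ⟨s.mem.setArray 3 (adjacencyArray (realized Q r)), s.drawn⟩ t₂ s' ∧
    M = markedPairs n (s'.mem 4) ∧
    t = t₁ + t₂

/-! ### Matching numbers of two-colorable edge sets -/

/-! Let x(uv) be the probability that uv lies in MM(G_p), so that the x(uv) add up to X = E μ(G_p),
and let the queries be the union of the matchings of R samples. Call a pair crucial if R·x(uv) ≥ κ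
for a suitable constant κ; all samples miss such a pair with probability at most e^{-κ} ≤ ε. Let C
be the part of X on crucial pairs and V the expected matching number of the realized queries. Two
lower bounds on V are combined.

The crucial edges of the matching MM(G_p) of the true realization are almost all queried, which
gives (1 - ε)C ≤ V (`crucial_le_expectedValue`).

The other bound is (1 - 5ε)X - C/e ≤ V (`MatchingModel.Dominates.le_expect`). Every left vertex u
gets an independent realization of its own and proposes along the crucial edge at u in the matching
of that realization, if there is one. A realization that reads each crucial edge from the copy of
its left end, and all other edges from one further copy, is again distributed like G_p
(`expect_mixture`), and in it all proposals are realized. Proposals of different left vertices are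
independent, so a right vertex with crucial mass c receives one with probability at least 1 - e^{-c}
≥ (1 - 1/e)c. Between the vertices that stay free, a flow runs on realized noncrucial edges,
proportional to the number of samples that contain the edge and scaled to have mean x(uv). Its mean
load at a free vertex is at most 1, because the total mass at a vertex is at most 1. As R·x(uv) < κ
and Rp is large, a second moment bound makes the overflow negligible; vertices almost exhausted by
crucial mass are discarded at a cost of O(ε)C. König's theorem bounds the resulting fractional
matching by the matching number (`ColoredBy.sum_le_matchingNumber`).

The second bound plus 1/e times the first gives (1 - 6ε)X ≤ (1 + 1/e)V, and 1/(1 + 1/e) = e/(e + 1).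
Already R = K⌈1/p⌉ samples suffice.

For the algorithm, MM deletes redundant edges one by one (`thinMatching`), which needs matching
numbers only. These come from an auction on the bipartite double cover, so that no two-coloring has
to be computed; complementary slackness up to 1 yields a vertex cover that certifies optimality
(`AuctionInv.exists_cover`) and also proves König's theorem. The predicate `Wp` carries correctness
and step counts through the programs. -/

theorem IsMatchingOf.card_le {V : Type*} {H M : Finset (Sym2 V)} (h : IsMatchingOf H M) :
    M.card ≤ matchingNumber H := by
  classical
  unfold matchingNumber
  exact Finset.le_sup (f := Finset.card) (by simpa using ⟨h.1, h⟩)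

theorem exists_isMaximumMatchingOf {V : Type*} (H : Finset (Sym2 V)) :
    ∃ M, IsMaximumMatchingOf H M := by
  classical
  obtain ⟨M, hM, hc⟩ := Finset.exists_mem_eq_sup (H.powerset.filter (IsMatchingOf H))
    ⟨∅, by simp [IsMatchingOf]⟩ Finset.card
  refine ⟨M, (Finset.mem_filter.1 hM).2, ?_⟩
  rw [← hc]
  unfold matchingNumber
  congr!

theorem IsMatchingOf.mono {V : Type*} {H H' M : Finset (Sym2 V)} (h : IsMatchingOf H M)
    (hH : H ⊆ H') : IsMatchingOf H' M :=
  ⟨h.1.trans hH, h.2⟩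

theorem matchingNumber_mono {V : Type*} {H H' : Finset (Sym2 V)} (hH : H ⊆ H') :
    matchingNumber H ≤ matchingNumber H' := by
  obtain ⟨M, hM, hc⟩ := exists_isMaximumMatchingOf H
  exact hc ▸ (hM.mono hH).card_le

/-- The coloring `c` is a proper coloring of the graph with edge set `H`. -/
def ColoredBy {V : Type*} (c : V → Bool) (H : Finset (Sym2 V)) : Prop :=
  ∀ u v, s(u, v) ∈ H → c u ≠ c v

theorem ColoredBy.mono {V : Type*} {c : V → Bool} {H H' : Finset (Sym2 V)} (h : ColoredBy c H)
    (hH : H' ⊆ H) : ColoredBy c H' :=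
  fun u v huv => h u v (hH huv)

theorem ColoredBy.not {V : Type*} {c : V → Bool} {H : Finset (Sym2 V)} (h : ColoredBy c H) :
    ColoredBy (fun v => !c v) H :=
  fun u v huv => by simpa using h u v huv

/-- Every edge has exactly one orientation that starts in the first color class. -/
theorem ColoredBy.card_oriented {V : Type*} [Fintype V] [DecidableEq V] {c : V → Bool}
    {M : Finset (Sym2 V)} (h : ColoredBy c M) :
    ((Finset.univ : Finset (V × V)).filter fun uv => c uv.1 = false ∧ s(uv.1, uv.2) ∈ M).card
      = M.card := by
  refine Finset.card_bij (fun uv _ => s(uv.1, uv.2)) (fun uv huv => (Finset.mem_filter.1 huv).2.2)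
    ?_ ?_
  · rintro ⟨u, v⟩ huv ⟨u', v'⟩ huv' he
    simp only [Finset.mem_filter, Finset.mem_univ, true_and] at huv huv'
    rcases Sym2.eq_iff.1 he with ⟨rfl, rfl⟩ | ⟨rfl, rfl⟩
    · rfl
    · exact absurd (huv.1.trans huv'.1.symm) (h _ _ huv.2)
  · intro e he
    induction e with
    | h u v =>
      cases hu : c u with
      | false => exact ⟨(u, v), by simp [hu, he], rfl⟩
      | true =>
        have := h u v he
        refine ⟨(v, u), ?_, Sym2.eq_swap⟩
        simp only [Finset.mem_filter, Finset.mem_univ, true_and]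
        refine ⟨by cases hv : c v <;> simp_all, by rwa [Sym2.eq_swap]⟩

/-- The directed edges that leave the first color class, viewed as undirected edges, form a
matching whenever no two of them share a tail or a head. -/
theorem ColoredBy.card_le_of_injOn {V : Type*} [DecidableEq V] {c : V → Bool}
    {H : Finset (Sym2 V)} (h : ColoredBy c H) (F : Finset (V × V))
    (hF : ∀ uv ∈ F, c uv.1 = false ∧ s(uv.1, uv.2) ∈ H)
    (h₁ : ∀ a ∈ F, ∀ b ∈ F, a.1 = b.1 → a = b) (h₂ : ∀ a ∈ F, ∀ b ∈ F, a.2 = b.2 → a = b) :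
    F.card ≤ matchingNumber H := by
  have hinj : Set.InjOn (fun uv : V × V => s(uv.1, uv.2)) F := by
    rintro ⟨u, v⟩ huv ⟨u', v'⟩ huv' he
    rcases Sym2.eq_iff.1 he with ⟨rfl, rfl⟩ | ⟨rfl, rfl⟩
    · rfl
    · exact absurd ((hF _ huv).1.trans (hF _ huv').1.symm) (h _ _ (hF _ huv).2)
  rw [← Finset.card_image_of_injOn hinj]
  refine IsMatchingOf.card_le ⟨?_, ?_⟩
  · intro e he
    obtain ⟨uv, huv, rfl⟩ := Finset.mem_image.1 he
    exact (hF uv huv).2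
  · intro e he f hf v hve hvf
    obtain ⟨a, ha, rfl⟩ := Finset.mem_image.1 he
    obtain ⟨b, hb, rfl⟩ := Finset.mem_image.1 hf
    have ca := h _ _ (hF a ha).2
    have cb := h _ _ (hF b hb).2
    have ca' := (hF a ha).1
    have cb' := (hF b hb).1
    rcases Sym2.mem_iff.1 hve with rfl | rfl <;> rcases Sym2.mem_iff.1 hvf with hv | hv
    · rw [h₁ a ha b hb hv]
    · simp_all
    · simp_all
    · rw [h₂ a ha b hb hv]

/-! ### Auctions on the bipartite double cover -/

/-- The adjacency matrix `A` of a graph on `{0, …, n - 1}`, a partial matching of the bipartite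
double cover (`mt` on the left, `own` on the right; the value `0` means unmatched), and prices `pr`
of the right vertices that satisfy complementary slackness up to `1`. -/
structure AuctionInv (n : ℕ) (A : ℕ → ℕ → ℕ) (own mt pr : ℕ → ℕ) : Prop where
  own_iff : ∀ u < n, ∀ w < n, own w = u + 1 ↔ mt u = w + 1
  own_le : ∀ w < n, own w ≤ n
  mt_le : ∀ u < n, mt u ≤ n
  adj : ∀ u < n, ∀ w < n, mt u = w + 1 → A u w ≠ 0
  pos : ∀ w < n, 0 < pr w → own w ≠ 0
  slack : ∀ u < n, ∀ w < n, mt u = w + 1 → ∀ w' < n, A u w' ≠ 0 → pr w ≤ pr w' + 1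
  pr_le : ∀ w < n, pr w ≤ n + 1

/-- The matched right vertices of an auction. -/
def auctionSold (n : ℕ) (own : ℕ → ℕ) : Finset ℕ := (Finset.range n).filter fun w => own w ≠ 0

theorem AuctionInv.start (n : ℕ) (A : ℕ → ℕ → ℕ) {own mt pr : ℕ → ℕ} (ho : ∀ w < n, own w = 0)
    (hm : ∀ w < n, mt w = 0) (hp : ∀ w < n, pr w = 0) : AuctionInv n A own mt pr where
  own_iff u hu w hw := by simp [ho w hw, hm u hu]
  own_le w hw := by simp [ho w hw]
  mt_le u hu := by simp [hm u hu]
  adj u hu w hw := by simp [hm u hu]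
  pos w hw := by simp [hp w hw]
  slack u hu w hw := by simp [hm u hu]
  pr_le w hw := by simp [hp w hw]

/-- A bid of the unmatched left vertex `u` for the cheapest of its neighbors. -/
theorem AuctionInv.bid {n : ℕ} {A : ℕ → ℕ → ℕ} {own mt pr own' mt' pr' : ℕ → ℕ}
    (h : AuctionInv n A own mt pr) {u w : ℕ} (hu : u < n) (hw : w < n) (hmu : mt u = 0)
    (hA : A u w ≠ 0) (hp : pr w < n + 1) (hmin : ∀ w' < n, A u w' ≠ 0 → pr w ≤ pr w')
    (ho : ∀ w' < n, own' w' = if w' = w then u + 1 else own w')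
    (hm : ∀ u' < n, mt' u' = if u' = u then w + 1 else if own w = u' + 1 then 0 else mt u')
    (hpr : ∀ w' < n, pr' w' = if w' = w then pr w + 1 else pr w') :
    AuctionInv n A own' mt' pr' where
  own_iff u' hu' w' hw' := by
    have h1 := h.own_iff u' hu' w' hw'
    have h2 := h.own_iff u' hu' w hw
    have h3 := h.own_iff u hu w' hw'
    rw [ho w' hw', hm u' hu']
    grind
  own_le w' hw' := by
    have := h.own_le w' hw'
    rw [ho w' hw']; grind
  mt_le u' hu' := by
    have := h.mt_le u' hu'
    rw [hm u' hu']; grind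
  adj u' hu' w' hw' := by
    have := h.adj u' hu' w' hw'
    rw [hm u' hu']; grind
  pos w' hw' := by
    have := h.pos w' hw'
    rw [hpr w' hw', ho w' hw']; grind
  -- The bidder paid at most one more than its cheapest neighbor; the previous owner of `w` is now
  -- unmatched; for all others only the prices of alternatives may have risen.
  slack u' hu' w' hw' := by
    have h1 := h.slack u' hu' w' hw'
    have h2 := h.own_iff u' hu' w hw
    rw [hm u' hu', hpr w' hw']
    intro hmt w'' hw'' hAw
    rw [hpr w'' hw'']
    have h3 := hmin w'' hw''
    have h4 := fun hh => h1 hh w'' hw'' hAw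
    grind
  pr_le w' hw' := by
    have := h.pr_le w' hw'
    rw [hpr w' hw']; grind

/-- When no left vertex wants to bid any more, some vertex cover of the double cover is no larger
than the matching. -/
theorem AuctionInv.exists_cover {n : ℕ} {A : ℕ → ℕ → ℕ} {own mt pr : ℕ → ℕ}
    (h : AuctionInv n A own mt pr)
    (hfin : ∀ u < n, mt u = 0 → ∀ w < n, A u w ≠ 0 → n + 1 ≤ pr w) :
    ∃ S T : Finset ℕ, (∀ u < n, ∀ w < n, A u w ≠ 0 → u ∈ S ∨ w ∈ T) ∧
      S.card + T.card ≤ (auctionSold n own).card := by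
  -- Pigeonhole: `n` prices cannot occupy all of the `n + 1` levels `1, …, n + 1`.
  obtain ⟨l, hl, hgap⟩ : ∃ l ∈ Finset.Icc 1 (n + 1), l ∉ (Finset.range n).image pr := by
    by_contra! hcon
    have := Finset.card_le_card (show Finset.Icc 1 (n + 1) ⊆ (Finset.range n).image pr from hcon)
    have := Finset.card_image_le (s := Finset.range n) (f := pr)
    simp at *
    omega
  have hl' := Finset.mem_Icc.1 hl
  have hgap' : ∀ w < n, pr w ≠ l := fun w hw e =>
    hgap (Finset.mem_image.2 ⟨w, Finset.mem_range.2 hw, e⟩)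
  -- Sold vertices above the gap enter the cover themselves, those below it are represented by their
  -- owners.
  let S : Finset ℕ := ((auctionSold n own).filter fun w => pr w < l).image fun w => own w - 1
  let T : Finset ℕ := (auctionSold n own).filter fun w => l < pr w
  refine ⟨S, T, ?_, ?_⟩
  · intro u hu w hw hA
    by_cases hT : l < pr w
    · right
      simp only [T, auctionSold, Finset.mem_filter, Finset.mem_range]
      exact ⟨⟨hw, h.pos w hw (by omega)⟩, hT⟩
    · left
      -- Here `pr w < l ≤ n + 1`, so `u` is matched, say to `x`. By slackness `pr x ≤ pr w + 1 ≤ l`,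
      -- and the gap turns this into `pr x < l`, which puts `u` into `S`.
      have h1 : mt u ≠ 0 := fun h0 => by
        have := hfin u hu h0 w hw hA
        have := hgap' w hw
        omega
      obtain ⟨x, hx⟩ := Nat.exists_eq_succ_of_ne_zero h1
      have hxn : x < n := by have := h.mt_le u hu; omega
      have hown := (h.own_iff u hu x hxn).2 hx
      have := h.slack u hu x hxn hx w hw hA
      have := hgap' x hxn
      have := hgap' w hw
      simp only [S, auctionSold, Finset.mem_image, Finset.mem_filter, Finset.mem_range]
      exact ⟨x, ⟨⟨hxn, by omega⟩, by omega⟩, by omega⟩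
  · have hdis : Disjoint ((auctionSold n own).filter fun w => pr w < l) T :=
      Finset.disjoint_filter.2 fun w _ => by omega
    calc S.card + T.card ≤ ((auctionSold n own).filter fun w => pr w < l).card + T.card :=
          Nat.add_le_add_right Finset.card_image_le _
      _ = (((auctionSold n own).filter fun w => pr w < l) ∪ T).card :=
          (Finset.card_union_of_disjoint hdis).symm
      _ ≤ _ := Finset.card_le_card
          (Finset.union_subset (Finset.filter_subset _ _) (Finset.filter_subset _ _))

theorem adjacencyArray_ne_zero {n : ℕ} {H : Finset (Sym2 (Fin n))} {u v : Fin n} :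
    adjacencyArray H u v ≠ 0 ↔ s(u, v) ∈ H := by
  simp [adjacencyArray]

/-- A matching of the double cover splits according to the color of the left end. Each of the two
parts projects to a matching of `H`, because its edges are all oriented in the same way between the
color classes. -/
theorem AuctionInv.card_sold_le {n : ℕ} {H : Finset (Sym2 (Fin n))} {c : Fin n → Bool}
    (hc : ColoredBy c H) {own mt pr : ℕ → ℕ} (h : AuctionInv n (adjacencyArray H) own mt pr) :
    (auctionSold n own).card ≤ 2 * matchingNumber H := by
  classical
  let F : Finset (Fin n × Fin n) := Finset.univ.filter fun uw => mt uw.1 = uw.2 + 1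
  have hFc : (auctionSold n own).card ≤ F.card := by
    refine (Finset.card_le_card (t := F.image fun uw => (uw.2 : ℕ)) ?_).trans Finset.card_image_le
    intro w hw
    simp only [auctionSold, Finset.mem_filter, Finset.mem_range] at hw
    have hle := h.own_le w hw.1
    have hu : own w - 1 < n := by omega
    refine Finset.mem_image.2 ⟨(⟨own w - 1, hu⟩, ⟨w, hw.1⟩), ?_, rfl⟩
    simp only [F, Finset.mem_filter, Finset.mem_univ, true_and]
    exact (h.own_iff _ hu w hw.1).1 (by omega)
  have key : ∀ d : Fin n → Bool, ColoredBy d H →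
      (F.filter fun uw => d uw.1 = false).card ≤ matchingNumber H := by
    intro d hd
    refine hd.card_le_of_injOn _ ?_ ?_ ?_
    · intro uw huw
      simp only [F, Finset.mem_filter, Finset.mem_univ, true_and] at huw
      exact ⟨huw.2, adjacencyArray_ne_zero.1 (h.adj _ uw.1.2 _ uw.2.2 huw.1)⟩
    · rintro ⟨u, w⟩ ha ⟨u', w'⟩ hb (rfl : u = u')
      simp only [F, Finset.mem_filter, Finset.mem_univ, true_and] at ha hb
      have : (w : ℕ) = w' := by omega
      rw [Fin.ext this]
    · rintro ⟨u, w⟩ ha ⟨u', w'⟩ hb (rfl : w = w')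
      simp only [F, Finset.mem_filter, Finset.mem_univ, true_and] at ha hb
      have h1 := (h.own_iff _ u.2 _ w.2).2 ha.1
      have h2 := (h.own_iff _ u'.2 _ w.2).2 hb.1
      have : (u : ℕ) = u' := by omega
      rw [Fin.ext this]
  have h1 := key c hc
  have h2 := key _ hc.not
  have h3 := Finset.card_filter_add_card_filter_not (s := F) (fun uw => c uw.1 = false)
  simp only [Bool.not_eq_false, Bool.not_eq_eq_eq_not, Bool.not_false] at h2 h3
  omega

/-- A vertex cover of the double cover of a bipartite graph splits into two vertex covers. -/
theorem ColoredBy.exists_cover_of_double_cover {n : ℕ} {H : Finset (Sym2 (Fin n))}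
    {c : Fin n → Bool} (hc : ColoredBy c H) {S T : Finset ℕ}
    (hST : ∀ u < n, ∀ w < n, adjacencyArray H u w ≠ 0 → u ∈ S ∨ w ∈ T) :
    ∃ C : Finset (Fin n), (∀ u v, s(u, v) ∈ H → u ∈ C ∨ v ∈ C) ∧
      2 * C.card ≤ S.card + T.card := by
  classical
  -- `D d` takes the first class from `S` and the second from `T`. For `c` and its complement
  -- together, each membership in `S` or `T` is counted once, so the smaller of the two covers has
  -- at most half the size.
  let D : (Fin n → Bool) → Finset (Fin n) := fun d =>
    Finset.univ.filter fun v => (d v = false ∧ (v : ℕ) ∈ S) ∨ (d v = true ∧ (v : ℕ) ∈ T)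
  have hcov : ∀ d, ColoredBy d H → ∀ u v, s(u, v) ∈ H → u ∈ D d ∨ v ∈ D d := by
    intro d hd u v huv
    have h0 := hd u v huv
    have h1 := hST u u.2 v v.2 (adjacencyArray_ne_zero.2 huv)
    have h2 := hST v v.2 u u.2 (adjacencyArray_ne_zero.2 (by rwa [Sym2.eq_swap]))
    simp only [D, Finset.mem_filter, Finset.mem_univ, true_and]
    cases hu : d u <;> cases hv : d v <;> simp_all [or_comm]
  have hS : (Finset.univ.filter fun v : Fin n => (v : ℕ) ∈ S).card ≤ S.card := by
    rw [← Finset.card_map Fin.valEmbedding]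
    refine Finset.card_le_card fun x hx => ?_
    simp only [Finset.mem_map, Finset.mem_filter, Finset.mem_univ, true_and] at hx
    obtain ⟨v, hv, rfl⟩ := hx
    exact hv
  have hT : (Finset.univ.filter fun v : Fin n => (v : ℕ) ∈ T).card ≤ T.card := by
    rw [← Finset.card_map Fin.valEmbedding]
    refine Finset.card_le_card fun x hx => ?_
    simp only [Finset.mem_map, Finset.mem_filter, Finset.mem_univ, true_and] at hx
    obtain ⟨v, hv, rfl⟩ := hx
    exact hv
  have hsum : (D c).card + (D fun v => !c v).card ≤ S.card + T.card := by
    refine le_trans (le_of_eq ?_) (Nat.add_le_add hS hT)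
    simp only [D, Finset.card_filter, ← Finset.sum_add_distrib]
    refine Finset.sum_congr rfl fun v _ => ?_
    cases c v <;> simp [add_comm]
  rcases le_total (D c).card (D fun v => !c v).card with hle | hle
  · exact ⟨D c, hcov c hc, by omega⟩
  · exact ⟨D _, hcov _ hc.not, by omega⟩

/-- The size of a matching is at most the size of a vertex cover. -/
theorem matchingNumber_le_card_cover {V : Type*} {H : Finset (Sym2 V)} {C : Finset V}
    (hC : ∀ u v, s(u, v) ∈ H → u ∈ C ∨ v ∈ C) : matchingNumber H ≤ C.card := by
  classical
  obtain ⟨M, hM, hc⟩ := exists_isMaximumMatchingOf H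
  rw [← hc]
  have : ∀ e ∈ M, ∃ v ∈ C, v ∈ e := by
    intro e he
    induction e with
    | h u v => rcases hC u v (hM.1 he) with h | h
               · exact ⟨u, h, by simp⟩
               · exact ⟨v, h, by simp⟩
  cases isEmpty_or_nonempty V
  · simp [Finset.eq_empty_of_isEmpty]
  choose! f hf hfe using this
  exact Finset.card_le_card_of_injOn f hf fun e he e' he' hee =>
    hM.2 e he e' he' (f e) (hfe e he) (hee ▸ hfe e' he')

/-- Weak duality closes the chain: 2μ(H) ≤ 2|C| ≤ |S| + |T| ≤ sold ≤ 2μ(H). -/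
theorem AuctionInv.card_sold_eq {n : ℕ} {H : Finset (Sym2 (Fin n))} {c : Fin n → Bool}
    (hc : ColoredBy c H) {own mt pr : ℕ → ℕ} (h : AuctionInv n (adjacencyArray H) own mt pr)
    (hfin : ∀ u < n, mt u = 0 → ∀ w < n, adjacencyArray H u w ≠ 0 → n + 1 ≤ pr w) :
    (auctionSold n own).card = 2 * matchingNumber H := by
  obtain ⟨S, T, hST, hcard⟩ := h.exists_cover hfin
  obtain ⟨C, hC, hC'⟩ := hc.exists_cover_of_double_cover hST
  have := matchingNumber_le_card_cover hC
  have := h.card_sold_le hc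
  omega

/-! ### Existence of final auctions and vertex covers -/

/-- An auction that never became final would raise the sum of the prices with every bid, but this
sum is at most `n * (n + 1)`. -/
theorem AuctionInv.exists_final (n : ℕ) (A : ℕ → ℕ → ℕ) :
    ∃ own mt pr, AuctionInv n A own mt pr ∧
      ∀ u < n, mt u = 0 → ∀ w < n, A u w ≠ 0 → n + 1 ≤ pr w := by
  by_contra! hcon
  have key : ∀ k : ℕ, ∃ own mt pr, AuctionInv n A own mt pr ∧ k ≤ ∑ w ∈ Finset.range n, pr w := by
    intro k
    induction k with
    | zero => exact ⟨_, _, _, AuctionInv.start n A (own := 0) (mt := 0) (pr := 0)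
        (by simp) (by simp) (by simp), by simp⟩
    | succ k ih =>
      obtain ⟨own, mt, pr, h, hk⟩ := ih
      obtain ⟨u, hu, hmu, w₀, hw₀, hA₀, hp₀⟩ := hcon own mt pr h
      obtain ⟨w, hw, hmin⟩ := Finset.exists_min_image ((Finset.range n).filter fun w => A u w ≠ 0)
        pr ⟨w₀, by simp [hw₀, hA₀]⟩
      simp only [Finset.mem_filter, Finset.mem_range, and_imp] at hw hmin
      refine ⟨_, _, _, h.bid hu hw.1 hmu hw.2 ((hmin w₀ hw₀ hA₀).trans_lt hp₀) hmin
        (fun _ _ => rfl) (fun _ _ => rfl) (fun _ _ => rfl), ?_⟩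
      refine (Nat.succ_le_of_lt (Nat.lt_of_le_of_lt hk ?_))
      refine Finset.sum_lt_sum (fun w' _ => ?_) ⟨w, Finset.mem_range.2 hw.1, by simp⟩
      split_ifs with e
      · rw [e]; omega
      · exact le_rfl
  obtain ⟨own, mt, pr, h, hk⟩ := key (n * (n + 1) + 1)
  have : ∑ w ∈ Finset.range n, pr w ≤ ∑ _w ∈ Finset.range n, (n + 1) :=
    Finset.sum_le_sum fun w hw => h.pr_le w (Finset.mem_range.1 hw)
  simp at this
  omega

/-- König's theorem: a bipartite graph has a vertex cover of the size of a maximum matching. -/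
theorem ColoredBy.exists_cover {n : ℕ} {H : Finset (Sym2 (Fin n))} {c : Fin n → Bool}
    (hc : ColoredBy c H) :
    ∃ C : Finset (Fin n), (∀ u v, s(u, v) ∈ H → u ∈ C ∨ v ∈ C) ∧ C.card ≤ matchingNumber H := by
  obtain ⟨own, mt, pr, h, hfin⟩ := AuctionInv.exists_final n (adjacencyArray H)
  obtain ⟨S, T, hST, hcard⟩ := h.exists_cover hfin
  obtain ⟨C, hC, hC'⟩ := hc.exists_cover_of_double_cover hST
  have := h.card_sold_le hc
  exact ⟨C, hC, by omega⟩

/-! ### A canonical maximum matching -/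

/-- Deletes the pair `uv` of a graph if this does not decrease the matching number. -/
noncomputable def thinAt {n : ℕ} (H : Finset (Sym2 (Fin n))) (u v : ℕ) : Finset (Sym2 (Fin n)) :=
  if h : u < n ∧ v < n then
    if matchingNumber (H.erase s(⟨u, h.1⟩, ⟨v, h.2⟩)) = matchingNumber H then
      H.erase s(⟨u, h.1⟩, ⟨v, h.2⟩) else H
  else H

/-- Treats the pairs `uv` with `v < k`, one after the other. -/
noncomputable def thinRow {n : ℕ} (H : Finset (Sym2 (Fin n))) (u : ℕ) : ℕ → Finset (Sym2 (Fin n))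
  | 0 => H
  | v + 1 => thinAt (thinRow H u v) u v

/-- Treats the pairs `uv` with `u < k`, one after the other. -/
noncomputable def thinRows {n : ℕ} (H : Finset (Sym2 (Fin n))) : ℕ → Finset (Sym2 (Fin n))
  | 0 => H
  | u + 1 => thinRow (thinRows H u) u n

/-- The maximum matching that remains after all redundant edges have been deleted one by one. -/
noncomputable def thinMatching (n : ℕ) (H : Finset (Sym2 (Fin n))) : Finset (Sym2 (Fin n)) :=
  thinRows H n

/-- `H'` has the matching number of `H ⊇ H'`, and its edges with `D u v` are in all maximum
matchings. -/
structure IsThinning {n : ℕ} (H H' : Finset (Sym2 (Fin n))) (D : ℕ → ℕ → Prop) : Prop where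
  subset : H' ⊆ H
  number_eq : matchingNumber H' = matchingNumber H
  critical : ∀ u v : Fin n, D u v → s(u, v) ∈ H' →
    matchingNumber (H'.erase s(u, v)) < matchingNumber H

/-- A pair that survives its own test is critical at that moment. It stays critical, since later
deletions only shrink the graph while the matching number to be kept is unchanged. -/
theorem IsThinning.thinAt {n : ℕ} {H H' : Finset (Sym2 (Fin n))} {D D' : ℕ → ℕ → Prop}
    (h : IsThinning H H' D) (a b : ℕ) (hD : ∀ u v, D' u v → D u v ∨ (u = a ∧ v = b)) :
    IsThinning H (thinAt H' a b) D' := by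
  have hsub : _root_.thinAt H' a b ⊆ H' := by
    unfold _root_.thinAt
    split_ifs
    exacts [Finset.erase_subset _ _, subset_rfl, subset_rfl]
  refine ⟨hsub.trans h.subset, ?_, ?_⟩
  · rw [← h.number_eq]
    unfold _root_.thinAt
    split_ifs with h1 h2
    exacts [h2, rfl, rfl]
  · intro u v huv hmem
    rcases hD _ _ huv with hd | ⟨hu, hv⟩
    · exact (matchingNumber_mono (Finset.erase_subset_erase _ hsub)).trans_lt
        (h.critical u v hd (hsub hmem))
    · subst hu hv
      have hlt : (u : ℕ) < n ∧ (v : ℕ) < n := ⟨u.2, v.2⟩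
      unfold _root_.thinAt at hmem ⊢
      rw [dif_pos hlt] at hmem ⊢
      split_ifs at hmem ⊢ with h2
      · simp at hmem
      · rw [← h.number_eq]
        exact lt_of_le_of_ne (matchingNumber_mono (Finset.erase_subset _ _)) h2

theorem IsThinning.thinRow {n : ℕ} {H H' : Finset (Sym2 (Fin n))} {a : ℕ}
    (h : IsThinning H H' fun u _ => u < a) (k : ℕ) :
    IsThinning H (thinRow H' a k) fun u v => u < a ∨ (u = a ∧ v < k) := by
  induction k with
  | zero => exact ⟨h.subset, h.number_eq, fun u v huv => h.critical u v (by simpa using huv)⟩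
  | succ k ih => exact ih.thinAt a k fun u v => by omega

theorem isThinning_thinRows {n : ℕ} (H : Finset (Sym2 (Fin n))) (k : ℕ) :
    IsThinning H (thinRows H k) fun u _ => u < k := by
  induction k with
  | zero => exact ⟨subset_rfl, rfl, by simp⟩
  | succ k ih =>
    have := ih.thinRow n
    exact ⟨this.subset, this.number_eq, fun u v huv =>
      this.critical u v (by have := v.2; omega)⟩

/-- A maximum matching of the thinned graph cannot omit an edge, as this edge would then be
redundant. Hence the thinned graph is itself that matching. -/
theorem isMaximumMatchingOf_thinMatching {n : ℕ} (H : Finset (Sym2 (Fin n))) :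
    IsMaximumMatchingOf H (thinMatching n H) := by
  have h := isThinning_thinRows H n
  obtain ⟨M, hM, hc⟩ := exists_isMaximumMatchingOf (thinRows H n)
  have : M = thinRows H n := by
    refine hM.1.antisymm fun e he => ?_
    induction e with
    | h u v =>
      by_contra hne
      have h1 := h.critical u v u.2 he
      have h2 : IsMatchingOf ((thinRows H n).erase s(u, v)) M :=
        ⟨Finset.subset_erase.2 ⟨hM.1, hne⟩, hM.2⟩
      have := h2.card_le
      rw [hc, h.number_eq] at this
      omega
  rw [this] at hM hc
  exact ⟨hM.mono h.subset, hc.trans h.number_eq⟩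

/-! ### Total correctness with time bounds -/

theorem Memory.write_apply (m : Memory) (a i j x a' i' j' : ℕ) :
    m.write a i j x a' i' j' = if a' = a ∧ i' = i ∧ j' = j then x else m a' i' j' := rfl

theorem Memory.write_of_ne (m : Memory) {a a' : ℕ} (i j x : ℕ) (h : a' ≠ a) :
    m.write a i j x a' = m a' := by
  funext i' j'
  simp [Memory.write, h]

/-- The arrays to which a program may write. -/
def Program.writes : Program → List ℕ
  | skip => []
  | assign a _ _ _ => [a]
  | coin a _ _ => [a]
  | seq c d => c.writes ++ d.writes
  | ite _ c d => c.writes ++ d.writes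
  | .while _ c => c.writes

/-- The program draws no random bits. -/
def Program.coinFree : Program → Bool
  | skip => true
  | assign _ _ _ _ => true
  | coin _ _ _ => false
  | seq c d => c.coinFree && d.coinFree
  | ite _ c d => c.coinFree && d.coinFree
  | .while _ c => c.coinFree

/-- The states `s` and `s'` differ only in arrays to which `c` may write, and not in the number of
random bits drawn unless `c` draws random bits. -/
structure FrameOf (c : Program) (s s' : MachineState) : Prop where
  mem : ∀ a, a ∉ c.writes → s'.mem a = s.mem a
  drawn : c.coinFree = true → s'.drawn = s.drawn

theorem FrameOf.trans {c : Program} {s s' s'' : MachineState} (h : FrameOf c s s')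
    (h' : FrameOf c s' s'') : FrameOf c s s'' :=
  ⟨fun a ha => (h'.mem a ha).trans (h.mem a ha), fun hc => (h'.drawn hc).trans (h.drawn hc)⟩

theorem FrameOf.refl (c : Program) (s : MachineState) : FrameOf c s s :=
  ⟨fun _ _ => rfl, fun _ => rfl⟩

theorem Exec.frame {p : ℝ} {ω : ℕ → Bool} {c : Program} {s s' : MachineState} {t : ℕ}
    (h : Exec p ω c s t s') : FrameOf c s s' := by
  induction h with
  | skip => exact FrameOf.refl _ _
  | assign a i j x s =>
    exact ⟨fun b hb => Memory.write_of_ne _ _ _ _ (by simpa [Program.writes] using hb),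
      fun _ => rfl⟩
  | coin a i j s =>
    exact ⟨fun b hb => Memory.write_of_ne _ _ _ _ (by simpa [Program.writes] using hb),
      fun h => by simp [Program.coinFree] at h⟩
  | seq _ _ ih ih' =>
    refine ⟨fun a ha => ?_, fun hc => ?_⟩
    · simp only [Program.writes, List.mem_append, not_or] at ha
      rw [ih'.mem a ha.2, ih.mem a ha.1]
    · simp only [Program.coinFree, Bool.and_eq_true] at hc
      rw [ih'.drawn hc.2, ih.drawn hc.1]
  | ite_true _ _ ih =>
    refine ⟨fun a ha => ?_, fun hc => ?_⟩
    · simp only [Program.writes, List.mem_append, not_or] at ha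
      exact ih.mem a ha.1
    · simp only [Program.coinFree, Bool.and_eq_true] at hc
      exact ih.drawn hc.1
  | ite_false _ _ ih =>
    refine ⟨fun a ha => ?_, fun hc => ?_⟩
    · simp only [Program.writes, List.mem_append, not_or] at ha
      exact ih.mem a ha.2
    · simp only [Program.coinFree, Bool.and_eq_true] at hc
      exact ih.drawn hc.2
  | while_true _ _ _ ih ih' => exact FrameOf.trans ⟨ih.mem, ih.drawn⟩ ih'
  | while_false => exact FrameOf.refl _ _

/-- Started in the state `s`, the program `c` halts after at most `T` steps in a state with `Q`. -/
def Wp (p : ℝ) (ω : ℕ → Bool) (c : Program) (s : MachineState) (T : ℕ)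
    (Q : MachineState → Prop) : Prop :=
  ∃ t ≤ T, ∃ s', Exec p ω c s t s' ∧ Q s'

/-! ### Proof rules for programs -/

section Rules

variable {p : ℝ} {ω : ℕ → Bool} {c d : Program} {s : MachineState} {T T' : ℕ}
  {Q Q' : MachineState → Prop}

theorem Wp.mono (h : Wp p ω c s T Q) (hT : T ≤ T') (hQ : ∀ s', Q s' → Q' s') :
    Wp p ω c s T' Q' := by
  obtain ⟨t, ht, s', he, hq⟩ := h
  exact ⟨t, ht.trans hT, s', he, hQ s' hq⟩

/-- Postconditions need to mention only what changes: the values of all other arrays are recovered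
from the list of written arrays, where membership is decidable. -/
theorem Wp.framed (h : Wp p ω c s T Q) : Wp p ω c s T fun s' => Q s' ∧ FrameOf c s s' := by
  obtain ⟨t, ht, s', he, hq⟩ := h
  exact ⟨t, ht, s', he, hq, he.frame⟩

theorem wp_skip (h : Q s) : Wp p ω .skip s 1 Q :=
  ⟨1, le_rfl, _, .skip s, h⟩

theorem wp_assign {a : ℕ} {i j x : Expr}
    (h : Q ⟨s.mem.write a (i.eval s.mem) (j.eval s.mem) (x.eval s.mem), s.drawn⟩) :
    Wp p ω (.assign a i j x) s 1 Q :=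
  ⟨1, le_rfl, _, .assign a i j x s, h⟩

theorem wp_coin {a : ℕ} {i j : Expr}
    (h : Q ⟨s.mem.write a (i.eval s.mem) (j.eval s.mem) (ω s.drawn).toNat, s.drawn + 1⟩) :
    Wp p ω (.coin a i j) s 1 Q :=
  ⟨1, le_rfl, _, .coin a i j s, h⟩

/-- The new state is passed on as an arbitrary state with three properties, so that nested
`Memory.write` terms do not pile up. -/
theorem wp_set {a : ℕ} {x : Expr}
    (h : ∀ s' : MachineState, (∀ a', a' ≠ a → s'.mem a' = s.mem a') → s'.drawn = s.drawn →
      s'.mem a 0 0 = x.eval s.mem → Q s') :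
    Wp p ω (.assign a (.const 0) (.const 0) x) s 1 Q :=
  wp_assign (h _ (fun _ ha => Memory.write_of_ne _ _ _ _ ha) rfl
    (by simp [Memory.write_apply, Expr.eval]))

theorem wp_seq (h : Wp p ω c s T fun s' => Wp p ω d s' T' Q) :
    Wp p ω (.seq c d) s (T + T') Q := by
  obtain ⟨t, ht, s', he, t', ht', s'', he', hq⟩ := h
  exact ⟨t + t', Nat.add_le_add ht ht', s'', .seq he he', hq⟩

theorem wp_ite {b : Test} (h₁ : b.Holds p s.mem → Wp p ω c s T Q)
    (h₂ : ¬ b.Holds p s.mem → Wp p ω d s T Q) : Wp p ω (.ite b c d) s (T + 1) Q := by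
  by_cases hb : b.Holds p s.mem
  · obtain ⟨t, ht, s', he, hq⟩ := h₁ hb
    exact ⟨t + 1, by omega, s', .ite_true hb he, hq⟩
  · obtain ⟨t, ht, s', he, hq⟩ := h₂ hb
    exact ⟨t + 1, by omega, s', .ite_false hb he, hq⟩

/-- A loop with an invariant `I k` in which `k` bounds the number of the remaining rounds. -/
theorem wp_while {b : Test} (I : ℕ → MachineState → Prop) (h₀ : ∀ s, I 0 s → ¬ b.Holds p s.mem)
    (hs : ∀ k s, I (k + 1) s → b.Holds p s.mem → Wp p ω c s T (I k)) (k : ℕ)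
    (hk : I k s) :
    Wp p ω (.while b c) s (k * (T + 1) + 1) fun s' => (∃ j, I j s') ∧ ¬ b.Holds p s'.mem := by
  induction k generalizing s with
  | zero => exact ⟨1, by omega, s, .while_false (h₀ s hk), ⟨0, hk⟩, h₀ s hk⟩
  | succ k ih =>
    by_cases hb : b.Holds p s.mem
    · obtain ⟨t, ht, s', he, hI⟩ := hs k s hk hb
      obtain ⟨t', ht', s'', he', hq⟩ := ih hI
      exact ⟨t + t' + 1, by nlinarith, s'', .while_true hb he he', hq⟩
    · exact ⟨1, by omega, s, .while_false hb, ⟨_, hk⟩, hb⟩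

/-- The scalar variable that is stored in the cell `(0, 0)` of the array `a`. -/
abbrev Expr.var (a : ℕ) : Expr := .cell a (.const 0) (.const 0)

/-- Assignment to a scalar variable. -/
abbrev Program.set (a : ℕ) (x : Expr) : Program := .assign a (.const 0) (.const 0) x

/-- The loop `for i = 0, …, b - 1`, where `b` is the value of a scalar variable. -/
def Program.forTo (i b : ℕ) (body : Program) : Program :=
  .seq (.set i (.const 0))
    (.while (.not (.le (.var b) (.var i))) (.seq body (.set i (.add (.var i) (.const 1)))))

theorem Program.writes_forTo (i b : ℕ) (body : Program) :
    (Program.forTo i b body).writes = i :: (body.writes ++ [i]) := rfl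

theorem Program.coinFree_forTo (i b : ℕ) (body : Program) :
    (Program.forTo i b body).coinFree = body.coinFree := by
  simp [Program.forTo, Program.coinFree]

/-- The counter is updated outside the body, so the invariant must be insensitive to it (`hI`). A
round costs the body plus a test and an increment; the final `2` pays for the initialization and the
failing test. -/
theorem wp_forTo {i b N : ℕ} {body : Program} (I : ℕ → MachineState → Prop)
    (hN : s.mem b 0 0 = N) (hib : b ≠ i) (hi : i ∉ body.writes) (hb : b ∉ body.writes)
    (hI : ∀ k s s', (∀ a, a ≠ i → s'.mem a = s.mem a) → s'.drawn = s.drawn → I k s → I k s')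
    (h₀ : I 0 s)
    (hs : ∀ k < N, ∀ s', FrameOf (.forTo i b body) s s' → s'.mem i 0 0 = k → I k s' →
      Wp p ω body s' T (I (k + 1))) :
    Wp p ω (.forTo i b body) s (N * (T + 2) + 2) (I N) := by
  have hfr : ∀ (s' : MachineState) (x : ℕ), FrameOf (.forTo i b body) s'
      ⟨s'.mem.write i 0 0 x, s'.drawn⟩ := fun s' x =>
    ⟨fun a ha => Memory.write_of_ne _ _ _ _ (by
      simp only [Program.writes_forTo, List.mem_cons, not_or] at ha; exact ha.1), fun _ => rfl⟩
  have hfb : ∀ s' s'', FrameOf body s' s'' → FrameOf (.forTo i b body) s' s'' := fun s' s'' h =>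
    ⟨fun a ha => h.mem a fun h' => ha (by simp [Program.writes_forTo, h']),
      fun hc => h.drawn (by rwa [Program.coinFree_forTo] at hc)⟩
  have hbw : b ∉ (Program.forTo i b body).writes := by
    simp [Program.writes_forTo, hib, hb]
  -- `wp_while` counts the remaining rounds, hence `k` is complementary to the counter.
  let J : ℕ → MachineState → Prop := fun k s' =>
    FrameOf (.forTo i b body) s s' ∧ s'.mem i 0 0 + k = N ∧ I (s'.mem i 0 0) s'
  refine Wp.mono (wp_seq (T := 1) (T' := N * (T + 1 + 1) + 1) (wp_assign ?_)) (by nlinarith)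
    fun _ h => h
  refine (wp_while (T := T + 1) J ?_ ?_ N ?_).mono le_rfl ?_
  · rintro s' ⟨h1, h2, -⟩ hcon
    simp only [Test.Holds, Expr.eval, h1.mem b hbw, hN] at hcon
    omega
  · rintro k s' ⟨h1, h2, h3⟩ -
    refine wp_seq ((hs _ (by omega) s' h1 rfl h3).framed.mono le_rfl fun s'' h => wp_assign ?_)
    have hi' : s''.mem i = s'.mem i := h.2.mem i hi
    simp only [Expr.eval, J]
    refine ⟨(h1.trans (hfb _ _ h.2)).trans (hfr _ _), ?_, ?_⟩
    · simp only [Memory.write_apply, and_self, if_true, hi']; omega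
    · have : (s''.mem.write i 0 0 (s''.mem i 0 0 + 1)) i 0 0 = s'.mem i 0 0 + 1 := by
        simp [Memory.write_apply, hi']
      rw [this]
      exact hI _ s'' _ (fun a ha => Memory.write_of_ne _ _ _ _ ha) rfl h.1
  · refine ⟨hfr _ _, ?_, ?_⟩
    · simp [Expr.eval, Memory.write_apply]
    · simp only [Expr.eval, Memory.write_apply, and_self, if_true]
      exact hI _ s _ (fun a ha => Memory.write_of_ne _ _ _ _ ha) rfl h₀
  · rintro s' ⟨⟨k, h1, h2, h3⟩, h4⟩
    simp only [Test.Holds, Expr.eval, h1.mem b hbw, hN] at h4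
    have : s'.mem i 0 0 = N := by omega
    rwa [this] at h3

end Rules

/-! ### The auction program

Array `6` holds a graph. Arrays `7`, `8` and `9` hold the owners of the right vertices, the partners
of the left vertices and the prices, array `12` the best offer, array `13` tells whether
there has been a bid in the present pass, and array `14` receives the number of sold vertices. -/

/-- The entry of the array `a` at the value of the scalar variable `i`. -/
abbrev Expr.at (a i : ℕ) : Expr := .cell a (.var i) (.const 0)

/-- No vertex is matched, all prices are zero. -/
def auctionReset : Program :=
  .forTo 10 0 (.seq (.assign 7 (.var 10) (.const 0) (.const 0))
    (.seq (.assign 8 (.var 10) (.const 0) (.const 0)) (.assign 9 (.var 10) (.const 0) (.const 0))))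

/-- Vertex `11` is an acceptable offer for vertex `10` that is better than all previous ones. -/
def auctionBetter : Test :=
  .and (.and (.not (.eq (.cell 6 (.var 10) (.var 11)) (.const 0))) (.le (.at 9 11) (.var 0)))
    (.not (.and (.not (.eq (.var 12) (.const 0)))
      (.le (.cell 9 (.sub (.var 12) (.const 1)) (.const 0)) (.at 9 11))))

/-- Finds the cheapest neighbor of vertex `10`. -/
def auctionFind : Program :=
  .seq (.set 12 (.const 0))
    (.forTo 11 0 (.ite auctionBetter (.set 12 (.add (.var 11) (.const 1))) .skip))

/-- Vertex `10` bids for the vertex that has been found. -/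
def auctionBid : Program :=
  .ite (.not (.eq (.var 12) (.const 0)))
    (.seq (.ite (.eq (.cell 7 (.sub (.var 12) (.const 1)) (.const 0)) (.const 0)) .skip
      (.assign 8 (.sub (.cell 7 (.sub (.var 12) (.const 1)) (.const 0)) (.const 1)) (.const 0)
        (.const 0)))
    (.seq (.assign 7 (.sub (.var 12) (.const 1)) (.const 0) (.add (.var 10) (.const 1)))
    (.seq (.assign 8 (.var 10) (.const 0) (.var 12))
    (.seq (.assign 9 (.sub (.var 12) (.const 1)) (.const 0)
      (.add (.cell 9 (.sub (.var 12) (.const 1)) (.const 0)) (.const 1)))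
    (.set 13 (.const 1))))))
    .skip

/-- Lets all unmatched left vertices bid. -/
def auctionPass : Program :=
  .forTo 10 0 (.ite (.eq (.at 8 10) (.const 0)) (.seq auctionFind auctionBid) .skip)

/-- Counts the sold vertices. -/
def auctionCount : Program :=
  .seq (.set 14 (.const 0))
    (.forTo 10 0 (.ite (.eq (.at 7 10) (.const 0)) .skip (.set 14 (.add (.var 14) (.const 1)))))

/-- Computes twice the matching number of the graph in array `6`. -/
def auctionProgram : Program :=
  .seq auctionReset (.seq (.set 13 (.const 1))
    (.seq (.while (.not (.eq (.var 13) (.const 0))) (.seq (.set 13 (.const 0)) auctionPass))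
      auctionCount))

/-- No left vertex `u` with `D u` is unmatched and has a neighbor with a low price. -/
def AuctionDone (n : ℕ) (A : ℕ → ℕ → ℕ) (mt pr : ℕ → ℕ) (D : ℕ → Prop) : Prop :=
  ∀ u < n, D u → mt u = 0 → ∀ w < n, A u w ≠ 0 → n + 1 ≤ pr w

/-! ### Correctness and running time of the auction -/

section Auction

variable {p : ℝ} {ω : ℕ → Bool} {n : ℕ}

theorem wp_auctionReset {s : MachineState} (hn : s.mem 0 0 0 = n) :
    Wp p ω auctionReset s (n * 5 + 2) fun s' =>
      ∀ w < n, s'.mem 7 w 0 = 0 ∧ s'.mem 8 w 0 = 0 ∧ s'.mem 9 w 0 = 0 := by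
  refine wp_forTo (T := 3)
    (fun k s' => ∀ w < k, s'.mem 7 w 0 = 0 ∧ s'.mem 8 w 0 = 0 ∧ s'.mem 9 w 0 = 0)
    hn (by decide) (by decide) (by decide) ?_ (by simp) ?_
  · intro k s s' hs _ h
    rwa [hs 7 (by decide), hs 8 (by decide), hs 9 (by decide)]
  · intro k hk s' _ hi h
    refine wp_seq (T := 1) (T' := 2) (wp_assign (wp_seq (T := 1) (T' := 1)
      (wp_assign (wp_assign ?_))))
    intro w hw
    have := h w
    simp only [Expr.eval, Memory.write_apply, hi]
    grind

/-- The invariant of the scan is the postcondition restricted to the vertices already seen. An offer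
`w` is stored as `w + 1`, so that `0` can stand for no acceptable offer. -/
theorem wp_auctionFind {s : MachineState} (hn : s.mem 0 0 0 = n) :
    Wp p ω auctionFind s (n * 4 + 3) fun s' =>
      (s'.mem 12 0 0 = 0 → ∀ w < n, s.mem 6 (s.mem 10 0 0) w ≠ 0 → n + 1 ≤ s.mem 9 w 0) ∧
      ∀ w, s'.mem 12 0 0 = w + 1 → w < n ∧ s.mem 6 (s.mem 10 0 0) w ≠ 0 ∧ s.mem 9 w 0 < n + 1 ∧
        ∀ w' < n, s.mem 6 (s.mem 10 0 0) w' ≠ 0 → s.mem 9 w 0 ≤ s.mem 9 w' 0 := by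
  refine Wp.mono (wp_seq (T := 1) (T' := n * 4 + 2) (wp_set fun s₀ hs₀ _ hv => ?_)) (by omega)
    fun _ h => h
  refine wp_forTo (T := 2) (fun k s' =>
      (s'.mem 12 0 0 = 0 → ∀ w < k, s.mem 6 (s.mem 10 0 0) w ≠ 0 → n + 1 ≤ s.mem 9 w 0) ∧
      ∀ w, s'.mem 12 0 0 = w + 1 → w < n ∧ s.mem 6 (s.mem 10 0 0) w ≠ 0 ∧ s.mem 9 w 0 < n + 1 ∧
        ∀ w' < k, s.mem 6 (s.mem 10 0 0) w' ≠ 0 → s.mem 9 w 0 ≤ s.mem 9 w' 0)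
    ?_ (by decide) (by decide) (by decide) ?_ ?_ ?_
  · rw [hs₀ 0 (by decide), hn]
  · intro k s s' hs _ h
    rwa [hs 12 (by decide)]
  · simp [hv, Expr.eval]
  · intro k hk s' hf hi h
    have h0 : s'.mem 0 = s.mem 0 := by
      rw [hf.mem 0 (by decide), hs₀ 0 (by decide)]
    have h6 : s'.mem 6 = s.mem 6 := by
      rw [hf.mem 6 (by decide), hs₀ 6 (by decide)]
    have h9 : s'.mem 9 = s.mem 9 := by
      rw [hf.mem 9 (by decide), hs₀ 9 (by decide)]
    have h10 : s'.mem 10 = s.mem 10 := by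
      rw [hf.mem 10 (by decide), hs₀ 10 (by decide)]
    obtain ⟨ha, hb⟩ := h
    refine wp_ite (T := 1) (fun ht => wp_assign ?_) (fun ht => wp_skip ?_)
    · simp only [auctionBetter, Test.Holds, Expr.eval, h0, h6, h9, h10, hi, hn] at ht
      simp only [Memory.write_apply, Expr.eval, hi, and_self, if_true]
      refine ⟨by omega, fun w hw => ?_⟩
      obtain rfl : w = k := by omega
      refine ⟨hk, ht.1.1, by omega, fun w' hw' hA => ?_⟩
      rcases Nat.lt_succ_iff_lt_or_eq.1 hw' with hlt | rfl
      · cases hx : s'.mem 12 0 0 with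
        | zero => have := ha hx w' hlt hA; omega
        | succ x =>
          have := (hb x hx).2.2.2 w' hlt hA
          have h2 := ht.2
          rw [hx] at h2
          simp only [Nat.add_sub_cancel] at h2
          omega
      · exact le_rfl
    · simp only [auctionBetter, Test.Holds, Expr.eval, h0, h6, h9, h10, hi, hn] at ht
      refine ⟨fun hz w hw hA => ?_, fun w hw => ?_⟩
      · rcases Nat.lt_succ_iff_lt_or_eq.1 hw with hlt | rfl
        · exact ha hz w hlt hA
        · by_contra hcon
          exact ht ⟨⟨hA, by omega⟩, fun h => h.1 hz⟩
      · obtain ⟨b1, b2, b3, b4⟩ := hb w hw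
        refine ⟨b1, b2, b3, fun w' hw' hA => ?_⟩
        rcases Nat.lt_succ_iff_lt_or_eq.1 hw' with hlt | rfl
        · exact b4 w' hlt hA
        · by_contra hcon
          refine ht ⟨⟨hA, by omega⟩, fun h => ?_⟩
          have h2 := h.2
          rw [hw] at h2
          simp only [Nat.add_sub_cancel] at h2
          omega

/-- The clauses on arrays 7, 8 and 9 have the form of the update hypotheses of `AuctionInv.bid`. -/
theorem wp_auctionBid {s : MachineState} {w : ℕ} (hw : s.mem 12 0 0 = w + 1) :
    Wp p ω auctionBid s 7 fun s' =>
      (∀ w', s'.mem 7 w' 0 = if w' = w then s.mem 10 0 0 + 1 else s.mem 7 w' 0) ∧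
      (∀ u', s'.mem 8 u' 0 = if u' = s.mem 10 0 0 then w + 1 else
        if s.mem 7 w 0 = u' + 1 then 0 else s.mem 8 u' 0) ∧
      (∀ w', s'.mem 9 w' 0 = if w' = w then s.mem 9 w 0 + 1 else s.mem 9 w' 0) ∧
      s'.mem 13 0 0 = 1 := by
  refine wp_ite (T := 6) (fun _ => ?_) (fun ht => absurd ?_ ht)
  · refine wp_seq (T := 2) (T' := 4) (wp_ite (T := 1) (fun ht => wp_skip ?_)
      (fun ht => wp_assign ?_))
    · refine wp_seq (T := 1) (T' := 3) (wp_assign (wp_seq (T := 1) (T' := 2) (wp_assign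
        (wp_seq (T := 1) (T' := 1) (wp_assign (wp_assign ?_))))))
      simp only [Test.Holds, Expr.eval, hw, Nat.add_sub_cancel] at ht
      simp [Memory.write_apply, Expr.eval, hw, ht]
    · refine wp_seq (T := 1) (T' := 3) (wp_assign (wp_seq (T := 1) (T' := 2) (wp_assign
        (wp_seq (T := 1) (T' := 1) (wp_assign (wp_assign ?_))))))
      simp only [Test.Holds, Expr.eval, hw, Nat.add_sub_cancel] at ht
      simp only [Memory.write_apply, Expr.eval, hw, Nat.add_sub_cancel]
      simp
      grind
  · simp [Test.Holds, Expr.eval, hw]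

theorem wp_auctionBid_of_eq_zero {s : MachineState} (hw : s.mem 12 0 0 = 0)
    {Q : MachineState → Prop} (hQ : Q s) : Wp p ω auctionBid s 7 Q := by
  refine wp_ite (T := 6) (fun ht => absurd hw ht) (fun _ => (wp_skip hQ).mono (by omega)
    fun _ h => h)

/-- The state of an auction for the graph `A` within a pass that started with price sum `S` and
has treated the left vertices before `k`. -/
structure PassInv (n : ℕ) (A : ℕ → ℕ → ℕ) (S k : ℕ) (s : MachineState) : Prop where
  inv : AuctionInv n A (fun w => s.mem 7 w 0) (fun u => s.mem 8 u 0) (fun w => s.mem 9 w 0)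
  progress : (s.mem 13 0 0 = 0 ∧
      AuctionDone n A (fun u => s.mem 8 u 0) (fun w => s.mem 9 w 0) fun u => u < k) ∨
    (s.mem 13 0 0 ≠ 0 ∧ S < ∑ w ∈ Finset.range n, s.mem 9 w 0)
  sum_le : S ≤ ∑ w ∈ Finset.range n, s.mem 9 w 0

theorem PassInv.congr {A : ℕ → ℕ → ℕ} {S k : ℕ} {s s' : MachineState} (h : PassInv n A S k s)
    (h7 : s'.mem 7 = s.mem 7) (h8 : s'.mem 8 = s.mem 8) (h9 : s'.mem 9 = s.mem 9)
    (h13 : s'.mem 13 = s.mem 13) : PassInv n A S k s' :=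
  ⟨by rw [h7, h8, h9]; exact h.inv, by rw [h8, h9, h13]; exact h.progress,
    by rw [h9]; exact h.sum_le⟩

/-- Without a bid nothing changes during the pass, so the conclusions about earlier vertices remain
valid and the pass certifies that the auction is final. Any bid raises the sum of the prices above
`S`. -/
theorem wp_auctionPass {s : MachineState} {A : ℕ → ℕ → ℕ} {S : ℕ} (hn : s.mem 0 0 0 = n)
    (hA : s.mem 6 = A) (h : PassInv n A S 0 s) :
    Wp p ω auctionPass s (n * (n * 4 + 13) + 2) (PassInv n A S n) := by
  refine wp_forTo (T := n * 4 + 11) (PassInv n A S) hn (by decide) (by decide) (by decide) ?_ h ?_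
  · intro k s s' hs _ h
    exact h.congr (hs 7 (by decide)) (hs 8 (by decide)) (hs 9 (by decide)) (hs 13 (by decide))
  · intro k hk s' hf hi h
    have h0 : s'.mem 0 0 0 = n := by rw [hf.mem 0 (by decide), hn]
    have h6 : s'.mem 6 = A := by rw [hf.mem 6 (by decide), hA]
    refine wp_ite (T := n * 4 + 10) (fun ht => ?_) (fun ht => (wp_skip ?_).mono (by omega)
      fun _ h => h)
    · simp only [Test.Holds, Expr.eval, hi] at ht
      refine wp_seq (T := n * 4 + 3) (T' := 7) ((wp_auctionFind h0).framed.mono le_rfl ?_)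
      rintro s₁ ⟨⟨hz, hw⟩, hf₁⟩
      have e7 : s₁.mem 7 = s'.mem 7 := hf₁.mem 7 (by decide)
      have e8 : s₁.mem 8 = s'.mem 8 := hf₁.mem 8 (by decide)
      have e9 : s₁.mem 9 = s'.mem 9 := hf₁.mem 9 (by decide)
      have e10 : s₁.mem 10 = s'.mem 10 := hf₁.mem 10 (by decide)
      have e13 : s₁.mem 13 = s'.mem 13 := hf₁.mem 13 (by decide)
      rw [hi, h6] at hz hw
      cases hx : s₁.mem 12 0 0 with
      | zero =>
        refine wp_auctionBid_of_eq_zero hx ⟨?_, ?_, ?_⟩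
        · rw [e7, e8, e9]; exact h.inv
        · rw [e8, e9, e13]
          refine h.progress.imp (fun hp => ⟨hp.1, fun u hu huk hm w hwn hAw => ?_⟩) id
          rcases Nat.lt_succ_iff_lt_or_eq.1 huk with hlt | rfl
          · exact hp.2 u hu hlt hm w hwn hAw
          · exact hz hx w hwn hAw
        · rw [e9]; exact h.sum_le
      | succ w =>
        obtain ⟨w1, w2, w3, w4⟩ := hw w hx
        refine (wp_auctionBid hx).mono le_rfl ?_
        rintro s₂ ⟨q7, q8, q9, q13⟩
        rw [e10, hi, e7] at q7
        rw [e10, hi, e7, e8] at q8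
        rw [e9] at q9
        have hlt : ∑ w ∈ Finset.range n, s'.mem 9 w 0 < ∑ w ∈ Finset.range n, s₂.mem 9 w 0 := by
          refine Finset.sum_lt_sum (fun w' _ => ?_) ⟨w, Finset.mem_range.2 w1, ?_⟩
          · rw [q9]; split_ifs with e
            · rw [e]; omega
            · exact le_rfl
          · rw [q9, if_pos rfl]; omega
        have := h.sum_le
        exact ⟨h.inv.bid hk w1 ht w2 w3 w4 (fun w' _ => q7 w') (fun u' _ => q8 u')
          (fun w' _ => q9 w'), Or.inr ⟨by omega, by omega⟩, by omega⟩
    · simp only [Test.Holds, Expr.eval, hi] at ht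
      refine ⟨h.inv, h.progress.imp (fun hp => ⟨hp.1, fun u hu huk hm => ?_⟩) id, h.sum_le⟩
      rcases Nat.lt_succ_iff_lt_or_eq.1 huk with hlt | rfl
      · exact hp.2 u hu hlt hm
      · exact absurd hm ht

theorem wp_auctionCount {s : MachineState} (hn : s.mem 0 0 0 = n) :
    Wp p ω auctionCount s (n * 4 + 3) fun s' =>
      s'.mem 14 0 0 = (auctionSold n fun w => s.mem 7 w 0).card := by
  refine Wp.mono (wp_seq (T := 1) (T' := n * 4 + 2) (wp_set fun s₀ hs₀ _ hv => ?_)) (by omega)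
    fun _ h => h
  refine wp_forTo (T := 2) (fun k s' =>
      s'.mem 14 0 0 = (auctionSold k fun w => s.mem 7 w 0).card)
    ?_ (by decide) (by decide) (by decide) ?_ ?_ ?_
  · rw [hs₀ 0 (by decide), hn]
  · intro k s s' hs _ h
    rwa [hs 14 (by decide)]
  · simp [hv, Expr.eval, auctionSold]
  · intro k hk s' hf hi h
    have h7 : s'.mem 7 = s.mem 7 := by
      rw [hf.mem 7 (by decide), hs₀ 7 (by decide)]
    refine wp_ite (T := 1) (fun ht => wp_skip ?_) (fun ht => wp_assign ?_)
    · simp only [Test.Holds, Expr.eval, hi, h7] at ht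
      rw [h, auctionSold, auctionSold, Finset.range_add_one, Finset.filter_insert,
        if_neg (by simpa using ht)]
    · simp only [Test.Holds, Expr.eval, hi, h7] at ht
      simp only [Memory.write_apply, Expr.eval, and_self, if_true]
      rw [h, auctionSold, auctionSold, Finset.range_add_one, Finset.filter_insert, if_pos ht,
        Finset.card_insert_of_notMem (by simp)]

/-- A bound for the running time of the auction. -/
def auctionTime (n : ℕ) : ℕ := (n * (n + 1) + 1) * (n * (n * 4 + 13) + 4) + n * 9 + 7

theorem wp_auctionProgram {s : MachineState} {H : Finset (Sym2 (Fin n))} {c : Fin n → Bool}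
    (hc : ColoredBy c H) (hn : s.mem 0 0 0 = n) (hA : s.mem 6 = adjacencyArray H) :
    Wp p ω auctionProgram s (auctionTime n) fun s' => s'.mem 14 0 0 = 2 * matchingNumber H := by
  have h1 : auctionTime n = (n * 5 + 2) + (1 +
      (((n * (n + 1) + 1) * ((1 + (n * (n * 4 + 13) + 2)) + 1) + 1) + (n * 4 + 3))) := by
    unfold auctionTime; ring
  rw [h1]
  refine wp_seq ((wp_auctionReset hn).framed.mono le_rfl ?_)
  rintro s₁ ⟨hz, hf₁⟩
  refine wp_seq (wp_set fun s₀ hw _ hv => wp_seq ?_)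
  -- Either the auction is final, or the remaining rounds `k` and the sum of the prices together
  -- exceed the maximal possible sum `n * (n + 1)`. The latter is impossible for `k = 0`, which
  -- bounds the number of passes.
  let I : ℕ → MachineState → Prop := fun k s' =>
    s'.mem 0 0 0 = n ∧ s'.mem 6 = adjacencyArray H ∧
    AuctionInv n (adjacencyArray H) (fun w => s'.mem 7 w 0) (fun u => s'.mem 8 u 0)
      (fun w => s'.mem 9 w 0) ∧
    ((s'.mem 13 0 0 = 0 ∧ AuctionDone n (adjacencyArray H) (fun u => s'.mem 8 u 0)
      (fun w => s'.mem 9 w 0) fun u => u < n) ∨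
      (s'.mem 13 0 0 ≠ 0 ∧ n * (n + 1) + 1 ≤ k + ∑ w ∈ Finset.range n, s'.mem 9 w 0))
  have hsum : ∀ k s', I k s' → ∑ w ∈ Finset.range n, s'.mem 9 w 0 ≤ n * (n + 1) := by
    rintro k s' ⟨-, -, h, -⟩
    refine (Finset.sum_le_sum fun w hw => h.pr_le w (Finset.mem_range.1 hw)).trans ?_
    simp
  refine (wp_while I ?_ ?_ (n * (n + 1) + 1) ?_).mono le_rfl ?_
  · intro s' h hcon
    have := hsum 0 s' h
    simp only [Test.Holds, Expr.eval] at hcon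
    rcases h.2.2.2 with h | h <;> omega
  · intro k s' h hb
    have hk : n * (n + 1) + 1 ≤ k + 1 + ∑ w ∈ Finset.range n, s'.mem 9 w 0 := by
      simp only [Test.Holds, Expr.eval] at hb
      exact (h.2.2.2.resolve_left fun h' => hb h'.1).2
    refine wp_seq (wp_set fun s₀ hw _ hv => ?_)
    refine (wp_auctionPass (A := adjacencyArray H) (S := ∑ w ∈ Finset.range n, s'.mem 9 w 0)
      (by rw [hw 0 (by decide), h.1]) (by rw [hw 6 (by decide), h.2.1]) ?_).framed.mono le_rfl ?_
    · refine ⟨by rw [hw 7 (by decide), hw 8 (by decide), hw 9 (by decide)]; exact h.2.2.1,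
        Or.inl ⟨hv, fun u _ hu => by omega⟩,
        by rw [hw 9 (by decide)]⟩
    · rintro s'' ⟨hp, hf⟩
      refine ⟨?_, ?_, hp.inv, ?_⟩
      · rw [hf.mem 0 (by decide), hw 0 (by decide), h.1]
      · rw [hf.mem 6 (by decide), hw 6 (by decide), h.2.1]
      · refine hp.progress.imp id fun h' => ⟨h'.1, ?_⟩
        omega
  · refine ⟨by rw [hw 0 (by decide), hf₁.mem 0 (by decide), hn],
      by rw [hw 6 (by decide), hf₁.mem 6 (by decide), hA], ?_,
      Or.inr ⟨by rw [hv]; simp [Expr.eval], by omega⟩⟩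
    rw [hw 7 (by decide), hw 8 (by decide), hw 9 (by decide)]
    exact AuctionInv.start _ _ (fun w hw => (hz w hw).1) (fun w hw => (hz w hw).2.1)
      (fun w hw => (hz w hw).2.2)
  · rintro s₂ ⟨⟨j, hI⟩, hb⟩
    have hk := hsum j s₂ hI
    simp only [Test.Holds, Expr.eval, not_not] at hb
    refine (wp_auctionCount hI.1).mono le_rfl fun s₃ h₃ => ?_
    rw [h₃]
    refine hI.2.2.1.card_sold_eq hc ?_
    exact fun u hu => (hI.2.2.2.resolve_right fun h' => h'.1 hb).2 u hu hu

end Auction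

/-! ### Loops over all pairs of vertices -/

/-- The loop over all pairs of vertices. -/
def Program.forPairs (i j : ℕ) (body : Program) : Program :=
  .forTo i 0 (.forTo j 0 body)

section Pairs

variable {p : ℝ} {ω : ℕ → Bool} {n : ℕ}

theorem wp_forPairs {s : MachineState} {i j T : ℕ} {body : Program}
    (I : ℕ → ℕ → MachineState → Prop) (hn : s.mem 0 0 0 = n) (hi : i ∉ body.writes)
    (hj : j ∉ body.writes) (h0 : 0 ∉ body.writes) (hij : i ≠ j) (hi0 : 0 ≠ i) (hj0 : 0 ≠ j)
    (hI : ∀ u v s s', (∀ a, a ≠ i → a ≠ j → s'.mem a = s.mem a) → s'.drawn = s.drawn →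
      I u v s → I u v s')
    (hnext : ∀ u s, I u n s → I (u + 1) 0 s) (hstart : I 0 0 s)
    (hs : ∀ u < n, ∀ v < n, ∀ s', FrameOf (.forPairs i j body) s s' → s'.mem i 0 0 = u →
      s'.mem j 0 0 = v → I u v s' → Wp p ω body s' T (I u (v + 1))) :
    Wp p ω (.forPairs i j body) s (n * (n * (T + 2) + 4) + 2) (I n 0) := by
  refine wp_forTo (T := n * (T + 2) + 2) (fun u => I u 0) hn hi0 ?_ ?_ ?_ hstart ?_
  · simp [Program.writes_forTo, hi, hij]
  · simp [Program.writes_forTo, h0, hj0]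
  · exact fun u s s' h hd => hI u 0 s s' (fun a ha _ => h a ha) hd
  · intro u hu s₁ hf₁ hiu h₁
    have h00 : 0 ∉ (Program.forTo i 0 (.forTo j 0 body)).writes := by
      simp [Program.writes_forTo, hj0, hi0, h0]
    refine (wp_forTo (T := T) (N := n) (I u) ?_ hj0 hj h0
      (fun v s s' h hd => hI u v s s' (fun a _ ha => h a ha) hd) h₁ ?_).mono le_rfl (hnext u)
    · rw [hf₁.mem 0 h00, hn]
    · intro v hv s₂ hf₂ hjv h₂
      have hi' : i ∉ (Program.forTo j 0 body).writes := by
        simp [Program.writes_forTo, hi, hij]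
      refine hs u hu v hv s₂ ⟨fun a ha => ?_, fun hc => ?_⟩ ?_ hjv h₂
      · rw [hf₂.mem a fun h => ha ?_, hf₁.mem a ha]
        simp [Program.forPairs, Program.writes_forTo] at h ⊢
        tauto
      · have hc' : body.coinFree = true := by
          rwa [Program.forPairs, Program.coinFree_forTo, Program.coinFree_forTo] at hc
        rw [hf₂.drawn (by rwa [Program.coinFree_forTo]), hf₁.drawn hc]
      · rw [hf₂.mem i hi', hiu]

/-- The assignment of the value of `e` to each cell of the array `a`. -/
def Program.fill (i j a : ℕ) (e : Expr) : Program :=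
  .forPairs i j (.assign a (.var i) (.var j) e)

/-- When `e` is evaluated for a cell, this cell still has its old value; `hf` may use this, which
permits updates of an array in place. -/
theorem wp_fill {s : MachineState} {i j a : ℕ} {e : Expr} (f : ℕ → ℕ → ℕ) (hn : s.mem 0 0 0 = n)
    (hi : a ≠ i) (hj : a ≠ j) (ha : a ≠ 0) (hij : i ≠ j) (hi0 : 0 ≠ i) (hj0 : 0 ≠ j)
    (hf : ∀ u < n, ∀ v < n, ∀ s' : MachineState,
      (∀ b, b ≠ i → b ≠ j → b ≠ a → s'.mem b = s.mem b) → s'.mem i 0 0 = u → s'.mem j 0 0 = v →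
      s'.mem a u v = s.mem a u v → e.eval s'.mem = f u v) :
    Wp p ω (.fill i j a e) s (n * (n * 3 + 4) + 2) fun s' =>
      s'.mem a = fun x y => if x < n ∧ y < n then f x y else s.mem a x y := by
  refine (wp_forPairs (T := 1) (fun u v s' => ∀ x y, s'.mem a x y =
      if x < n ∧ y < n ∧ (x < u ∨ x = u ∧ y < v) then f x y else s.mem a x y) hn
    (by simp [Program.writes, hi.symm]) (by simp [Program.writes, hj.symm])
    (by simp [Program.writes, ha.symm]) hij hi0 hj0 ?_ ?_ ?_ ?_).mono le_rfl ?_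
  · intro u v s s' h _ hI
    rwa [h a hi hj]
  · intro u s' h x y
    rw [h x y]
    refine if_congr ?_ rfl rfl
    omega
  · simp
  · intro u hu v hv s' hfr hiu hjv h
    refine wp_assign fun x y => ?_
    have hval : e.eval s'.mem = f u v := by
      refine hf u hu v hv s' (fun b hbi hbj hba => hfr.mem b ?_) hiu hjv ?_
      · simp [Program.forPairs, Program.writes_forTo, Program.writes, hbi, hbj, hba]
      · rw [h u v, if_neg (by omega)]
    simp only [Expr.eval, Memory.write_apply, hiu, hjv, hval, h x y, true_and]
    by_cases hx : x = u ∧ y = v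
    · obtain ⟨rfl, rfl⟩ := hx
      rw [if_pos ⟨rfl, rfl⟩, if_pos (by omega)]
    · rw [if_neg hx]
      refine if_congr ?_ rfl rfl
      omega
  · intro s' h
    funext x y
    rw [h x y]
    refine if_congr ?_ rfl rfl
    omega

end Pairs

/-! ### Thinning -/

theorem adjacencyArray_of_lt {n : ℕ} (H : Finset (Sym2 (Fin n))) {x y : ℕ} (hx : x < n)
    (hy : y < n) : adjacencyArray H x y = if s(⟨x, hx⟩, ⟨y, hy⟩) ∈ H then 1 else 0 := by
  simp [adjacencyArray, hx, hy]

theorem adjacencyArray_of_not_lt {n : ℕ} (H : Finset (Sym2 (Fin n))) {x y : ℕ}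
    (h : ¬ (x < n ∧ y < n)) : adjacencyArray H x y = 0 := by
  simp [adjacencyArray, h]

theorem adjacencyArray_comm {n : ℕ} (H : Finset (Sym2 (Fin n))) (x y : ℕ) :
    adjacencyArray H x y = adjacencyArray H y x := by
  by_cases h : x < n ∧ y < n
  · rw [adjacencyArray_of_lt H h.1 h.2, adjacencyArray_of_lt H h.2 h.1, Sym2.eq_swap]
  · rw [adjacencyArray_of_not_lt H h, adjacencyArray_of_not_lt H (by tauto)]

theorem adjacencyArray_erase {n : ℕ} (H : Finset (Sym2 (Fin n))) {u v : ℕ} (hu : u < n)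
    (hv : v < n) (x y : ℕ) : adjacencyArray (H.erase s(⟨u, hu⟩, ⟨v, hv⟩)) x y =
      if (x = u ∧ y = v) ∨ (x = v ∧ y = u) then 0 else adjacencyArray H x y := by
  by_cases h : x < n ∧ y < n
  · rw [adjacencyArray_of_lt _ h.1 h.2, adjacencyArray_of_lt _ h.1 h.2]
    simp only [Finset.mem_erase, ne_eq, Sym2.eq_iff, Fin.mk.injEq]
    split_ifs <;> tauto
  · rw [adjacencyArray_of_not_lt _ h, adjacencyArray_of_not_lt _ h]
    simp

/-- Deletes the pair of the vertices `15` and `16`, unless this changes the matching number. -/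
def thinStep : Program :=
  .seq (.set 17 (.cell 6 (.var 15) (.var 16)))
  (.seq (.assign 6 (.var 15) (.var 16) (.const 0))
  (.seq (.assign 6 (.var 16) (.var 15) (.const 0))
  (.seq auctionProgram
  (.ite (.eq (.var 14) (.var 18)) .skip
    (.seq (.assign 6 (.var 15) (.var 16) (.var 17))
      (.assign 6 (.var 16) (.var 15) (.var 17)))))))

/-- Replaces the graph in array `6` by a maximum matching. -/
def thinProgram : Program :=
  .seq auctionProgram (.seq (.set 18 (.var 14)) (.forPairs 15 16 thinStep))

/-- A bound for the running time of the thinning program. -/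
def thinTime (n : ℕ) : ℕ := auctionTime n + (1 + (n * (n * (auctionTime n + 8) + 4) + 2))

/-! ### Correctness and running time of the thinning -/

section Thinning

variable {p : ℝ} {ω : ℕ → Bool} {n : ℕ}

/-- Arrays 14 and 18 both hold doubled matching numbers, so comparing them decides redundancy. One
saved entry suffices to restore both cells of the pair because the adjacency matrix is symmetric. -/
theorem wp_thinStep {s : MachineState} {H : Finset (Sym2 (Fin n))} {c : Fin n → Bool} {u v : ℕ}
    (hc : ColoredBy c H) (hn : s.mem 0 0 0 = n) (hA : s.mem 6 = adjacencyArray H) (hu : u < n)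
    (hv : v < n) (h15 : s.mem 15 0 0 = u) (h16 : s.mem 16 0 0 = v)
    (h18 : s.mem 18 0 0 = 2 * matchingNumber H) :
    Wp p ω thinStep s (auctionTime n + 6) fun s' => s'.mem 6 = adjacencyArray (thinAt H u v) := by
  have hT : auctionTime n + 6 = 1 + (1 + (1 + (auctionTime n + (2 + 1)))) := by ring
  rw [hT]
  refine wp_seq (wp_set fun s₁ hs₁ _ hv₁ => wp_seq (wp_assign (wp_seq (wp_assign (wp_seq ?_)))))
  have h17 : s₁.mem 17 0 0 = adjacencyArray H u v := by
    rw [hv₁]; simp [Expr.eval, h15, h16, hA]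
  have k0 : s₁.mem 0 0 0 = n := by rw [hs₁ 0 (by decide), hn]
  have k6 : s₁.mem 6 = adjacencyArray H := by rw [hs₁ 6 (by decide), hA]
  have k15 : s₁.mem 15 0 0 = u := by rw [hs₁ 15 (by decide), h15]
  have k16 : s₁.mem 16 0 0 = v := by rw [hs₁ 16 (by decide), h16]
  have k18 : s₁.mem 18 0 0 = 2 * matchingNumber H := by rw [hs₁ 18 (by decide), h18]
  let H' := H.erase s(⟨u, hu⟩, ⟨v, hv⟩)
  refine (wp_auctionProgram (n := n) (H := H') (hc.mono (Finset.erase_subset _ _)) ?_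
    ?_).framed.mono le_rfl ?_
  · simpa [Memory.write_apply] using k0
  · funext x y
    simp only [H', adjacencyArray_erase, Expr.eval, Memory.write_apply, k15, k16, k6]
    simp
    grind
  · rintro s₂ ⟨h14, hf⟩
    have e6 : ∀ x y, s₂.mem 6 x y = adjacencyArray H' x y := by
      intro x y
      rw [hf.mem 6 (by decide)]
      simp only [H', adjacencyArray_erase, Expr.eval, Memory.write_apply, k15, k16, k6]
      simp
      grind
    have e15 : s₂.mem 15 0 0 = u := by
      rw [hf.mem 15 (by decide)]; simpa [Memory.write_apply] using k15
    have e16 : s₂.mem 16 0 0 = v := by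
      rw [hf.mem 16 (by decide)]; simpa [Memory.write_apply] using k16
    have e17 : s₂.mem 17 0 0 = adjacencyArray H u v := by
      rw [hf.mem 17 (by decide)]; simpa [Memory.write_apply] using h17
    have e18 : s₂.mem 18 0 0 = 2 * matchingNumber H := by
      rw [hf.mem 18 (by decide)]; simpa [Memory.write_apply] using k18
    refine wp_ite (T := 2) (fun ht => (wp_skip ?_).mono (by omega) fun _ h => h) (fun ht =>
      wp_seq (T := 1) (T' := 1) (wp_assign (wp_assign ?_)))
    · simp only [Test.Holds, Expr.eval, h14, e18, H'] at ht
      funext x y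
      rw [e6, thinAt, dif_pos ⟨hu, hv⟩, if_pos (by omega)]
    · simp only [Test.Holds, Expr.eval, h14, e18, H'] at ht
      rw [thinAt, dif_pos ⟨hu, hv⟩, if_neg (by omega)]
      funext x y
      have := adjacencyArray_comm H u v
      simp only [Expr.eval, Memory.write_apply, e15, e16, e17, e6, H', adjacencyArray_erase]
      simp
      grind

/-- The target in array 18 is computed only once: thinning preserves the matching number. -/
theorem wp_thinProgram {s : MachineState} {H : Finset (Sym2 (Fin n))} {c : Fin n → Bool}
    (hc : ColoredBy c H) (hn : s.mem 0 0 0 = n) (hA : s.mem 6 = adjacencyArray H) :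
    Wp p ω thinProgram s (thinTime n) fun s' =>
      s'.mem 6 = adjacencyArray (thinMatching n H) := by
  refine wp_seq ((wp_auctionProgram hc hn hA).framed.mono le_rfl ?_)
  rintro s₁ ⟨h14, hf⟩
  refine wp_seq (wp_set fun s₂ hs₂ _ hv₂ => ?_)
  have k0 : s₂.mem 0 0 0 = n := by rw [hs₂ 0 (by decide), hf.mem 0 (by decide), hn]
  have k6 : s₂.mem 6 = adjacencyArray H := by rw [hs₂ 6 (by decide), hf.mem 6 (by decide), hA]
  have k18 : s₂.mem 18 0 0 = 2 * matchingNumber H := by rw [hv₂]; simpa [Expr.eval] using h14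
  refine wp_forPairs (T := auctionTime n + 6)
    (fun u v s' => s'.mem 6 = adjacencyArray (thinRow (thinRows H u) u v)) k0 (by decide)
    (by decide) (by decide) (by decide) (by decide) (by decide) ?_ ?_ ?_ ?_
  · intro u v s s' h _ hI
    rwa [h 6 (by decide) (by decide)]
  · exact fun u s h => h
  · exact k6
  · intro u hu v hv s' hfr h15 h16 hI
    have hth := (isThinning_thinRows H u).thinRow v
    refine wp_thinStep (hc.mono hth.subset) ?_ hI hu hv h15 h16 ?_
    · rw [hfr.mem 0 (by decide), k0]
    · rw [hfr.mem 18 (by decide), k18, hth.number_eq]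

end Thinning

/-! ### The query algorithm -/

/-- A constant multiple of an expression. -/
def Expr.times : ℕ → Expr → Expr
  | 0, _ => .const 0
  | k + 1, x => .add (Expr.times k x) x

theorem Expr.eval_times (m : Memory) (k : ℕ) (x : Expr) :
    (Expr.times k x).eval m = k * x.eval m := by
  induction k with
  | zero => simp [Expr.times, Expr.eval]
  | succ k ih => simp [Expr.times, Expr.eval, ih, Nat.succ_mul]

/-- The bits of the `i`-th realization that is drawn from the tape `ω`. -/
def sampleBits (n : ℕ) (ω : ℕ → Bool) (i : ℕ) : Sym2 (Fin n) → Bool :=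
  fun e => ω (i * (n * n) + (e.inf * n + e.sup))

/-- The presence of the edge between the vertices `22` and `23` in a realization that is given by
the random bits in the upper triangle of array `5`. -/
def sampleExpr : Expr :=
  .sub (.cell 1 (.var 22) (.var 23)) (.sub (.const 1)
    (.cell 5 (.sub (.var 22) (.sub (.var 22) (.var 23)))
      (.add (.var 23) (.sub (.var 22) (.var 23)))))

/-- Draws a realization and adds a maximum matching of it to the queries. -/
def roundProgram : Program :=
  .seq (.forPairs 22 23 (.coin 5 (.var 22) (.var 23)))
  (.seq (.fill 22 23 6 sampleExpr)
  (.seq thinProgram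
  (.fill 22 23 2 (.add (.cell 2 (.var 22) (.var 23)) (.cell 6 (.var 22) (.var 23))))))

/-- Computes `⌈1 / p⌉` and runs `K * ⌈1 / p⌉` rounds. -/
def selectProgram (K : ℕ) : Program :=
  .seq (.set 19 (.const 1))
  (.seq (.while (.not (.leMulParam (.const 1) (.var 19))) (.set 19 (.add (.var 19) (.const 1))))
  (.seq (.set 20 (.times K (.var 19)))
  (.forTo 21 20 roundProgram)))

/-- Computes a maximum matching of the graph in array `3`. -/
def answerProgram : Program :=
  .seq (.fill 22 23 6 (.cell 3 (.var 22) (.var 23)))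
  (.seq thinProgram (.fill 22 23 4 (.cell 6 (.var 22) (.var 23))))

/-- The algorithm that queries maximum matchings of `K * ⌈1 / p⌉` random realizations. -/
def matchingAlgorithm (K : ℕ) : QueryAlgorithm where
  select := selectProgram K
  answer := answerProgram

/-- A bound for the running time of one round. -/
def roundTime (n : ℕ) : ℕ :=
  (n * (n * 3 + 4) + 2) + ((n * (n * 3 + 4) + 2) + (thinTime n + (n * (n * 3 + 4) + 2)))

theorem mem_markedPairs {n : ℕ} {f : ℕ → ℕ → ℕ} {u v : Fin n} :
    s(u, v) ∈ markedPairs n f ↔ f u v ≠ 0 ∨ f v u ≠ 0 := by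
  simp only [markedPairs, Finset.mem_image, Finset.mem_filter, Finset.mem_univ, true_and,
    Prod.exists, Sym2.eq_iff]
  constructor
  · rintro ⟨a, b, h, ⟨rfl, rfl⟩ | ⟨rfl, rfl⟩⟩
    exacts [Or.inl h, Or.inr h]
  · rintro (h | h)
    exacts [⟨u, v, h, Or.inl ⟨rfl, rfl⟩⟩, ⟨v, u, h, Or.inr ⟨rfl, rfl⟩⟩]

theorem markedPairs_add {n : ℕ} {f g h : ℕ → ℕ → ℕ}
    (hg : ∀ x < n, ∀ y < n, g x y = f x y + h x y) :
    markedPairs n g = markedPairs n f ∪ markedPairs n h := by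
  ext e
  induction e with
  | h u v =>
    rw [Finset.mem_union, mem_markedPairs, mem_markedPairs, mem_markedPairs,
      hg u u.2 v v.2, hg v v.2 u u.2]
    omega

theorem markedPairs_eq {n : ℕ} {f : ℕ → ℕ → ℕ} {H : Finset (Sym2 (Fin n))}
    (hf : ∀ x < n, ∀ y < n, f x y = adjacencyArray H x y) : markedPairs n f = H := by
  ext e
  induction e with
  | h u v =>
    rw [mem_markedPairs, hf u u.2 v v.2, hf v v.2 u u.2, adjacencyArray_ne_zero,
      adjacencyArray_ne_zero, Sym2.eq_swap (a := v), or_self]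

/-- For entries in `{0, 1}` the truncated difference `a - (1 - b)` is the conjunction of `a` and
`b`; `sampleExpr` computes it in this way. -/
theorem adjacencyArray_realized {n : ℕ} (E : Finset (Sym2 (Fin n))) (r : Sym2 (Fin n) → Bool)
    {x y : ℕ} (hx : x < n) (hy : y < n) : adjacencyArray (realized E r) x y =
      adjacencyArray E x y - (1 - (r s(⟨x, hx⟩, ⟨y, hy⟩)).toNat) := by
  rw [adjacencyArray_of_lt _ hx hy, adjacencyArray_of_lt _ hx hy]
  simp only [realized, Finset.mem_filter]
  cases h : r s(⟨x, hx⟩, ⟨y, hy⟩) <;> split_ifs <;> simp_all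

/-! ### Correctness and running time of the query algorithm -/

section Query

variable {p : ℝ} {ω : ℕ → Bool} {n : ℕ}

/-- A bit is drawn for every ordered pair although only the upper triangle is used later. Thus every
round consumes exactly `n * n` bits, and the position of each bit on the tape is explicit. -/
theorem wp_drawBits {s : MachineState} (hn : s.mem 0 0 0 = n) :
    Wp p ω (.forPairs 22 23 (.coin 5 (.var 22) (.var 23))) s (n * (n * 3 + 4) + 2) fun s' =>
      s'.drawn = s.drawn + n * n ∧
      ∀ x < n, ∀ y < n, s'.mem 5 x y = (ω (s.drawn + (x * n + y))).toNat := by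
  refine (wp_forPairs (T := 1) (fun u v s' => s'.drawn = s.drawn + (u * n + v) ∧
      ∀ x y, y < n → (x < u ∨ x = u ∧ y < v) → s'.mem 5 x y = (ω (s.drawn + (x * n + y))).toNat)
    hn (by decide) (by decide) (by decide) (by decide) (by decide) (by decide)
    ?_ ?_ ?_ ?_).mono le_rfl ?_
  · rintro u v s s' h hd ⟨h1, h2⟩
    rw [h 5 (by decide) (by decide), hd]
    exact ⟨h1, h2⟩
  · rintro u s' ⟨h1, h2⟩
    exact ⟨by rw [h1]; ring, fun x y hy hx => h2 x y hy (by omega)⟩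
  · simp
  · rintro u hu v hv s' _ hiu hjv ⟨h1, h2⟩
    refine wp_coin ⟨by simp only [h1]; ring, fun x y hy hx => ?_⟩
    simp only [Expr.eval, Memory.write_apply, hiu, hjv, true_and]
    by_cases hxy : x = u ∧ y = v
    · rw [if_pos hxy, h1, hxy.1, hxy.2]
    · rw [if_neg hxy]
      exact h2 x y hy (by omega)
  · rintro s' ⟨h1, h2⟩
    exact ⟨by rw [h1]; ring, fun x hx y hy => h2 x y hy (by omega)⟩

/-- `h6` serves to know that array 6 vanishes outside the `n × n` square, which the fill loop does
not touch. Queries are accumulated by adding entries, since only their being nonzero counts. -/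
theorem wp_roundProgram {s : MachineState} {E H : Finset (Sym2 (Fin n))} {c : Fin n → Bool}
    {i : ℕ} (hc : ColoredBy c E) (hn : s.mem 0 0 0 = n) (h1 : s.mem 1 = adjacencyArray E)
    (h6 : s.mem 6 = adjacencyArray H) (hd : s.drawn = i * (n * n)) :
    Wp p ω roundProgram s (roundTime n) fun s' =>
      (∃ H' : Finset (Sym2 (Fin n)), s'.mem 6 = adjacencyArray H') ∧
      s'.drawn = (i + 1) * (n * n) ∧
      markedPairs n (s'.mem 2) = markedPairs n (s.mem 2) ∪
        thinMatching n (realized E (sampleBits n ω i)) := by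
  refine wp_seq ((wp_drawBits hn).framed.mono le_rfl ?_)
  rintro s₁ ⟨⟨hd₁, h5⟩, hf₁⟩
  rw [hd] at hd₁ h5
  have k0 : s₁.mem 0 0 0 = n := by rw [hf₁.mem 0 (by decide), hn]
  refine wp_seq ((wp_fill (adjacencyArray (realized E (sampleBits n ω i))) k0 (by decide)
    (by decide) (by decide) (by decide) (by decide) (by decide) ?_).framed.mono le_rfl ?_)
  · intro u hu v hv s' hs' hi hj _
    rw [adjacencyArray_realized _ _ hu hv]
    simp only [sampleExpr, Expr.eval, hi, hj, hs' 1 (by decide) (by decide) (by decide),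
      hs' 5 (by decide) (by decide) (by decide), hf₁.mem 1 (by decide), h1]
    -- With truncated subtraction, `u - (u - v)` is the minimum of `u` and `v`, and `v + (u - v)` is
    -- their maximum.
    rw [h5 _ (by omega) _ (by omega)]
    simp only [sampleBits, Sym2.inf_mk, Sym2.sup_mk]
    rcases le_total u v with huv | huv
    · rw [min_eq_left (by exact huv), max_eq_right (by exact huv)]
      simp [huv]
    · rw [min_eq_right (by exact huv), max_eq_left (by exact huv)]
      simp [huv, Nat.sub_sub_self huv]
  · rintro s₂ ⟨e6, hf₂⟩
    have k6 : s₂.mem 6 = adjacencyArray (realized E (sampleBits n ω i)) := by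
      rw [e6]
      funext x y
      split_ifs with hxy
      · rfl
      · rw [hf₁.mem 6 (by decide), h6, adjacencyArray_of_not_lt _ hxy,
          adjacencyArray_of_not_lt _ hxy]
    have k0 : s₂.mem 0 0 0 = n := by rw [hf₂.mem 0 (by decide), k0]
    have hc' : ColoredBy c (realized E (sampleBits n ω i)) := hc.mono (Finset.filter_subset _ _)
    refine wp_seq ((wp_thinProgram hc' k0 k6).framed.mono
      le_rfl ?_)
    rintro s₃ ⟨e6, hf₃⟩
    have k0 : s₃.mem 0 0 0 = n := by rw [hf₃.mem 0 (by decide), k0]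
    refine (wp_fill (fun x y => s₃.mem 2 x y + s₃.mem 6 x y) k0 (by decide)
      (by decide) (by decide) (by decide) (by decide) (by decide) ?_).framed.mono le_rfl ?_
    · intro u hu v hv s' hs' hi hj h2
      simp only [Expr.eval, hi, hj, hs' 6 (by decide) (by decide) (by decide), h2]
    · rintro s₄ ⟨e2, hf₄⟩
      refine ⟨⟨_, by rw [hf₄.mem 6 (by decide), e6]⟩, ?_, ?_⟩
      · rw [hf₄.drawn (by decide), hf₃.drawn (by decide), hf₂.drawn (by decide), hd₁]
        ring
      · have k2 : s₃.mem 2 = s.mem 2 := by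
          rw [hf₃.mem 2 (by decide), hf₂.mem 2 (by decide), hf₁.mem 2 (by decide)]
        rw [markedPairs_add (f := s₃.mem 2) (h := s₃.mem 6), k2, e6,
          markedPairs_eq (f := adjacencyArray _) fun _ _ _ _ => rfl]
        intro x hx y hy
        rw [e2]
        simp only [hx, hy, and_self, if_true]

/-- The union of the maximum matchings of the first `R` realizations on the tape. -/
noncomputable def tapeQueries (E : Finset (Sym2 (Fin n))) (R : ℕ) (ω : ℕ → Bool) :
    Finset (Sym2 (Fin n)) :=
  (Finset.range R).biUnion fun i => thinMatching n (realized E (sampleBits n ω i))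

theorem wp_selectProgram {E : Finset (Sym2 (Fin n))} {c : Fin n → Bool} (hc : ColoredBy c E)
    (hp : 0 < p) (K : ℕ) :
    Wp p ω (selectProgram K) (inputState E)
      (1 + ((⌈1 / p⌉₊ * 2 + 1) + (1 + (K * ⌈1 / p⌉₊ * (roundTime n + 2) + 2)))) fun s' =>
      s'.mem 0 0 0 = n ∧ (∃ H' : Finset (Sym2 (Fin n)), s'.mem 6 = adjacencyArray H') ∧
      markedPairs n (s'.mem 2) = tapeQueries E (K * ⌈1 / p⌉₊) ω := by
  have hN : 1 ≤ ⌈1 / p⌉₊ := Nat.one_le_ceil_iff.2 (by positivity)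
  -- This is how comparisons with `p` find the ceiling: the search stops at the least `d ≥ 1` with
  -- `1 ≤ p * d`.
  have hle : ∀ d : ℕ, 1 ≤ p * d ↔ ⌈1 / p⌉₊ ≤ d := fun d => by
    rw [Nat.ceil_le, div_le_iff₀ hp, mul_comm]
  refine wp_seq (wp_set fun s₁ hs₁ hd₁ hv₁ => wp_seq ?_)
  refine ((wp_while (T := 1) (fun k s' => s'.mem 19 0 0 + k = ⌈1 / p⌉₊) ?_ ?_ (⌈1 / p⌉₊ - 1)
    ?_).framed.mono (by omega) ?_)
  · intro s' h hb
    simp only [Test.Holds, Expr.eval, Nat.cast_one, hle] at hb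
    omega
  · intro k s' h _
    refine wp_set fun s'' _ _ hv => ?_
    rw [hv]
    simp only [Expr.eval]
    omega
  · rw [hv₁]; simp only [Expr.eval]; omega
  · rintro s₂ ⟨⟨⟨j, hj⟩, hb⟩, hf₂⟩
    simp only [Test.Holds, Expr.eval, Nat.cast_one, hle, not_not] at hb
    have h19 : s₂.mem 19 0 0 = ⌈1 / p⌉₊ := by omega
    refine wp_seq (wp_set fun s₃ hs₃ hd₃ hv₃ => ?_)
    rw [Expr.eval_times] at hv₃
    simp only [Expr.eval, h19] at hv₃
    have hmem : ∀ a, a ≠ 19 → a ≠ 20 → s₃.mem a = (inputState E).mem a := fun a ha hb => by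
      rw [hs₃ a hb, hf₂.mem a (by simpa [Program.writes] using ha), hs₁ a ha]
    have hdr : s₃.drawn = 0 := by rw [hd₃, hf₂.drawn (by decide), hd₁]; rfl
    have k0 : s₃.mem 0 0 0 = n := by
      rw [hmem 0 (by decide) (by decide)]
      simp [inputState, Memory.setArray, Memory.write]
    have k1 : s₃.mem 1 = adjacencyArray E := by
      rw [hmem 1 (by decide) (by decide)]
      simp [inputState, Memory.setArray]
    have kz : ∀ a, a ≠ 0 → a ≠ 1 → a ≠ 19 → a ≠ 20 → s₃.mem a = fun _ _ => 0 :=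
      fun a h0 h1 h2 h3 => by
        rw [hmem a h2 h3]
        funext x y
        simp [inputState, Memory.setArray, Memory.write, h0, h1]
    refine (wp_forTo (T := roundTime n) (fun k s' => s'.drawn = k * (n * n) ∧
        (∃ H' : Finset (Sym2 (Fin n)), s'.mem 6 = adjacencyArray H') ∧
        markedPairs n (s'.mem 2) = tapeQueries E k ω) hv₃ (by decide) (by decide) (by decide)
      ?_ ?_ ?_).framed.mono le_rfl ?_
    · rintro k s s' hs hd ⟨h1, h2, h3⟩
      rw [hs 6 (by decide), hs 2 (by decide), hd]
      exact ⟨h1, h2, h3⟩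
    · refine ⟨by simp [hdr], ⟨∅, ?_⟩, ?_⟩
      · rw [kz 6 (by decide) (by decide) (by decide) (by decide)]
        funext x y
        simp [adjacencyArray]
      · rw [kz 2 (by decide) (by decide) (by decide) (by decide)]
        simp [tapeQueries, markedPairs]
    · rintro k hk s' hfr - ⟨hd, ⟨H', h6⟩, h2⟩
      refine (wp_roundProgram hc ?_ ?_ h6 hd).mono le_rfl ?_
      · rw [hfr.mem 0 (by decide), k0]
      · rw [hfr.mem 1 (by decide), k1]
      · rintro s'' ⟨q6, qd, q2⟩
        refine ⟨qd, q6, ?_⟩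
        rw [q2, h2, tapeQueries, tapeQueries, Finset.range_add_one, Finset.biUnion_insert,
          Finset.union_comm]
    · rintro s' ⟨⟨-, h6, h2⟩, hfr⟩
      exact ⟨by rw [hfr.mem 0 (by decide), k0], h6, h2⟩

theorem wp_answerProgram {s : MachineState} {E H : Finset (Sym2 (Fin n))} {c : Fin n → Bool}
    (hc : ColoredBy c E) (hn : s.mem 0 0 0 = n) (h3 : s.mem 3 = adjacencyArray E)
    (h6 : s.mem 6 = adjacencyArray H) :
    Wp p ω answerProgram s ((n * (n * 3 + 4) + 2) + (thinTime n + (n * (n * 3 + 4) + 2)))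
      fun s' => markedPairs n (s'.mem 4) = thinMatching n E := by
  refine wp_seq ((wp_fill (adjacencyArray E) hn (by decide)
    (by decide) (by decide) (by decide) (by decide) (by decide) ?_).framed.mono le_rfl ?_)
  · intro u hu v hv s' hs' hi hj _
    simp only [Expr.eval, hi, hj, hs' 3 (by decide) (by decide) (by decide), h3]
  · rintro s₂ ⟨e6, hf₂⟩
    have k6 : s₂.mem 6 = adjacencyArray E := by
      rw [e6]
      funext x y
      split_ifs with hxy
      · rfl
      · rw [h6, adjacencyArray_of_not_lt _ hxy, adjacencyArray_of_not_lt _ hxy]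
    have k0 : s₂.mem 0 0 0 = n := by rw [hf₂.mem 0 (by decide), hn]
    refine wp_seq ((wp_thinProgram hc k0 k6).framed.mono le_rfl ?_)
    rintro s₃ ⟨e6, hf₃⟩
    have k0 : s₃.mem 0 0 0 = n := by rw [hf₃.mem 0 (by decide), k0]
    refine (wp_fill (fun x y => s₃.mem 6 x y) k0 (by decide)
      (by decide) (by decide) (by decide) (by decide) (by decide) ?_).mono le_rfl ?_
    · intro u hu v hv s' hs' hi hj _
      simp only [Expr.eval, hi, hj, hs' 6 (by decide) (by decide) (by decide)]
    · intro s₄ e4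
      refine markedPairs_eq fun x hx y hy => ?_
      rw [e4, ← e6]
      simp only [hx, hy, and_self, if_true]

/-- A polynomial that bounds the running time of the algorithm. -/
noncomputable def queryTime (K : ℕ) : Polynomial ℕ :=
  open Polynomial in
  let fill : ℕ[X] := X * (X * 3 + 4) + 2
  let auction : ℕ[X] := (X * (X + 1) + 1) * (X * (X * 4 + 13) + 4) + X * 9 + 7
  let thin : ℕ[X] := auction + (1 + (X * (X * (auction + 8) + 4) + 2))
  (1 + ((X * 2 + 1) + (1 + (C K * X * ((fill + (fill + (thin + fill))) + 2) + 2)))) +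
    (fill + (thin + fill))

theorem thinTime_mono {n m : ℕ} (h : n ≤ m) : thinTime n ≤ thinTime m := by
  unfold thinTime auctionTime
  gcongr

theorem matchingAlgorithm_runs {E : Finset (Sym2 (Fin n))} {c : Fin n → Bool}
    (hc : ColoredBy c E) (hp : 0 < p) (K : ℕ) (ω : ℕ → Bool)
    (r : Sym2 (Fin n) → Bool) :
    ∃ t ≤ (queryTime K).eval (n + ⌈1 / p⌉₊),
      (matchingAlgorithm K).Runs p ω E r t (tapeQueries E (K * ⌈1 / p⌉₊) ω)
        (thinMatching n (realized (tapeQueries E (K * ⌈1 / p⌉₊) ω) r)) := by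
  obtain ⟨t₁, ht₁, s, he, h0, ⟨H', h6⟩, h2⟩ := wp_selectProgram (ω := ω) hc hp K
  have hsub : tapeQueries E (K * ⌈1 / p⌉₊) ω ⊆ E := by
    refine Finset.biUnion_subset.2 fun i _ => ?_
    exact (isMaximumMatchingOf_thinMatching _).1.1.trans (Finset.filter_subset _ _)
  have hc' : ColoredBy c (realized (tapeQueries E (K * ⌈1 / p⌉₊) ω) r) :=
    hc.mono ((Finset.filter_subset _ _).trans hsub)
  obtain ⟨t₂, ht₂, s', he', h4⟩ := wp_answerProgram (p := p) (ω := ω) (H := H')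
    (s := ⟨s.mem.setArray 3 (adjacencyArray (realized (tapeQueries E (K * ⌈1 / p⌉₊) ω) r)),
      s.drawn⟩) hc' (by simpa [Memory.setArray] using h0) (by simp [Memory.setArray])
    (by simpa [Memory.setArray] using h6)
  refine ⟨t₁ + t₂, ?_, s, s', t₁, t₂, he, h2.symm, he', h4.symm, rfl⟩
  refine (Nat.add_le_add ht₁ ht₂).trans ?_
  -- The time bound is monotone in both parameters, so each of them may be replaced by their sum,
  -- which makes it a polynomial in one variable.
  have h1 : n ≤ n + ⌈1 / p⌉₊ := by omega
  have h2 : ⌈1 / p⌉₊ ≤ n + ⌈1 / p⌉₊ := by omega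
  generalize n + ⌈1 / p⌉₊ = m at h1 h2 ⊢
  have ht : (queryTime K).eval m = (1 + ((m * 2 + 1) + (1 + (K * m * (roundTime m + 2) + 2)))) +
      ((m * (m * 3 + 4) + 2) + (thinTime m + (m * (m * 3 + 4) + 2))) := by
    simp [queryTime, roundTime, thinTime, auctionTime]
  rw [ht]
  have := thinTime_mono h1
  unfold roundTime
  gcongr

end Query

/-! ### Expectations on finite probability spaces -/

/-- The expectation of `f` with respect to the weights `wt`. -/
noncomputable def expect {S : Type*} [Fintype S] (wt : S → ℝ) (f : S → ℝ) : ℝ := ∑ s, wt s * f s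

/-- The weights `wt` form a probability distribution. -/
structure IsProbWeight {S : Type*} [Fintype S] (wt : S → ℝ) : Prop where
  nonneg : ∀ s, 0 ≤ wt s
  sum_eq_one : ∑ s, wt s = 1

/-- The weights of a family of independent variables. -/
noncomputable def piWeight {S : Type*} (ι : Type*) [Fintype ι] (wt : S → ℝ) : (ι → S) → ℝ :=
  fun h => ∏ i, wt (h i)

section Expect

variable {S S' S'' : Type*} [Fintype S] [Fintype S'] [Fintype S''] {wt : S → ℝ}
  {wt' : S' → ℝ} {wt'' : S'' → ℝ} {ι : Type*}

theorem expect_sum (t : Finset ι) (f : ι → S → ℝ) :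
    expect wt (fun s => ∑ i ∈ t, f i s) = ∑ i ∈ t, expect wt (f i) := by
  simp only [expect, Finset.mul_sum]
  exact Finset.sum_comm

theorem expect_const_mul (a : ℝ) (f : S → ℝ) : expect wt (fun s => a * f s) = a * expect wt f := by
  simp only [expect, Finset.mul_sum]
  exact Finset.sum_congr rfl fun s _ => by ring

theorem expect_add (f g : S → ℝ) : expect wt (fun s => f s + g s) = expect wt f + expect wt g := by
  simp only [expect, mul_add, Finset.sum_add_distrib]

theorem expect_sub (f g : S → ℝ) : expect wt (fun s => f s - g s) = expect wt f - expect wt g := by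
  simp only [expect, mul_sub, Finset.sum_sub_distrib]

theorem IsProbWeight.expect_const (h : IsProbWeight wt) (a : ℝ) : expect wt (fun _ => a) = a := by
  simp only [expect, ← Finset.sum_mul, h.sum_eq_one, one_mul]

theorem IsProbWeight.expect_mono (h : IsProbWeight wt) {f g : S → ℝ} (hfg : ∀ s, f s ≤ g s) :
    expect wt f ≤ expect wt g :=
  Finset.sum_le_sum fun s _ => mul_le_mul_of_nonneg_left (hfg s) (h.nonneg s)

theorem IsProbWeight.expect_nonneg (h : IsProbWeight wt) {f : S → ℝ} (hf : ∀ s, 0 ≤ f s) :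
    0 ≤ expect wt f :=
  Finset.sum_nonneg fun s _ => mul_nonneg (h.nonneg s) (hf s)

/-- Independence in finite form, by expanding a product of sums. Later statements about one or two
coordinates set the remaining factors to `1`. -/
theorem expect_pi_prod [Fintype ι] [DecidableEq ι] (g : ι → S → ℝ) :
    expect (piWeight ι wt) (fun h => ∏ i, g i (h i)) = ∏ i, expect wt (g i) := by
  simp only [expect, piWeight, ← Finset.prod_mul_distrib]
  rw [Finset.prod_univ_sum, Fintype.piFinset_univ]

theorem IsProbWeight.pi [Fintype ι] [DecidableEq ι] (h : IsProbWeight wt) :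
    IsProbWeight (piWeight ι wt) := by
  refine ⟨fun s => Finset.prod_nonneg fun i _ => h.nonneg _, ?_⟩
  have := expect_pi_prod (wt := wt) (ι := ι) fun _ _ => 1
  simpa [h.sum_eq_one, expect] using this

theorem IsProbWeight.expect_pi_eval [Fintype ι] [DecidableEq ι] (h : IsProbWeight wt) (i : ι)
    (f : S → ℝ) : expect (piWeight ι wt) (fun x => f (x i)) = expect wt f := by
  have := expect_pi_prod (wt := wt) fun j s => if j = i then f s else 1
  simp only [Finset.prod_ite_eq', Finset.mem_univ, if_true] at this
  rw [this, Finset.prod_eq_single i (fun j _ hj => by simp [hj, h.expect_const]) (by simp)]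
  simp

theorem IsProbWeight.expect_pi_eval_mul [Fintype ι] [DecidableEq ι] (h : IsProbWeight wt)
    {i j : ι} (hij : i ≠ j) (f g : S → ℝ) :
    expect (piWeight ι wt) (fun x => f (x i) * g (x j)) = expect wt f * expect wt g := by
  have := expect_pi_prod (wt := wt) fun k s => (if k = i then f s else 1) * if k = j then g s else 1
  simp only [Finset.prod_mul_distrib, Finset.prod_ite_eq', Finset.mem_univ, if_true] at this
  rw [this, Finset.prod_eq_mul i j hij (fun k _ hk => by simp [hk.1, hk.2, h.expect_const])
    (by simp) (by simp)]
  simp [hij, hij.symm]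

/-- The weights of three independent variables. -/
noncomputable def tripleWeight (wt : S → ℝ) (wt' : S' → ℝ) (wt'' : S'' → ℝ) :
    S × S' × S'' → ℝ :=
  fun z => wt z.1 * (wt' z.2.1 * wt'' z.2.2)

theorem expect_triple_mul (f : S → ℝ) (g : S' → ℝ) (k : S'' → ℝ) :
    expect (tripleWeight wt wt' wt'') (fun z => f z.1 * g z.2.1 * k z.2.2) =
      expect wt f * expect wt' g * expect wt'' k := by
  simp only [expect, tripleWeight, Fintype.sum_prod_type]
  rw [Finset.sum_mul_sum, Finset.sum_mul]
  refine Finset.sum_congr rfl fun _ _ => ?_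
  rw [Finset.sum_mul]
  refine Finset.sum_congr rfl fun _ _ => ?_
  rw [Finset.mul_sum]
  exact Finset.sum_congr rfl fun _ _ => by ring

theorem IsProbWeight.triple (h : IsProbWeight wt) (h' : IsProbWeight wt')
    (h'' : IsProbWeight wt'') : IsProbWeight (tripleWeight wt wt' wt'') := by
  refine ⟨fun z => mul_nonneg (h.nonneg _) (mul_nonneg (h'.nonneg _) (h''.nonneg _)), ?_⟩
  have := expect_triple_mul (wt := wt) (wt' := wt') (wt'' := wt'') (fun _ => 1) (fun _ => 1)
    fun _ => 1
  simpa [h.sum_eq_one, h'.sum_eq_one, h''.sum_eq_one, expect] using this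

/-- A second moment bound for sums of variables that are pairwise negatively correlated. -/
theorem IsProbWeight.expect_sq_sub_le [Fintype ι] [DecidableEq ι] (h : IsProbWeight wt)
    (W : ι → S → ℝ) (y σ κ : ι → ℝ) (hκ : ∀ k, 0 ≤ κ k) (h₁ : ∀ k, expect wt (W k) = y k)
    (h₂ : ∀ k l, k ≠ l → expect wt (fun s => W k s * W l s) ≤ y k * y l)
    (h₃ : ∀ k, expect wt (fun s => W k s * W k s) ≤ σ k) :
    expect wt (fun s => (∑ k, κ k * W k s - ∑ k, κ k * y k) ^ 2) ≤ ∑ k, κ k ^ 2 * σ k := by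
  set m := ∑ k, κ k * y k with hm
  have hE : expect wt (fun s => ∑ k, κ k * W k s) = m := by
    rw [expect_sum]
    simp only [expect_const_mul, h₁, hm]
  have hE2 : expect wt (fun s => (∑ k, κ k * W k s) ^ 2) =
      ∑ k, ∑ l, κ k * κ l * expect wt (fun s => W k s * W l s) := by
    simp only [sq, Finset.sum_mul_sum]
    rw [expect_sum]
    refine Finset.sum_congr rfl fun k _ => ?_
    rw [expect_sum]
    refine Finset.sum_congr rfl fun l _ => ?_
    rw [← expect_const_mul]
    congr 1
    funext s
    ring
  have hexp : expect wt (fun s => (∑ k, κ k * W k s - m) ^ 2) =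
      expect wt (fun s => (∑ k, κ k * W k s) ^ 2) - m ^ 2 := by
    have : (fun s => (∑ k, κ k * W k s - m) ^ 2) =
        fun s => ((∑ k, κ k * W k s) ^ 2 - (2 * m) * ∑ k, κ k * W k s) + m ^ 2 := by
      funext s; ring
    rw [this, expect_add, expect_sub, expect_const_mul, hE, h.expect_const]
    ring
  rw [hexp, hE2]
  -- Off the diagonal this is negative correlation. On the diagonal the second moment is already
  -- bounded by `σ`, and the square of the mean is added for free.
  have hbound : ∀ k l, κ k * κ l * expect wt (fun s => W k s * W l s) ≤
      κ k * y k * (κ l * y l) + if l = k then κ k ^ 2 * σ k else 0 := by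
    intro k l
    have h0 := mul_nonneg (hκ k) (hκ l)
    by_cases hkl : l = k
    · subst hkl
      rw [if_pos rfl]
      nlinarith [mul_le_mul_of_nonneg_left (h₃ l) h0, sq_nonneg (κ l * y l)]
    · rw [if_neg hkl]
      nlinarith [mul_le_mul_of_nonneg_left (h₂ k l (Ne.symm hkl)) h0]
  have hm2 : m ^ 2 = ∑ k, ∑ l, κ k * y k * (κ l * y l) := by
    rw [sq, hm, Finset.sum_mul_sum]
  rw [hm2, sub_le_iff_le_add', ← Finset.sum_add_distrib]
  refine Finset.sum_le_sum fun k _ => (Finset.sum_le_sum fun l _ => hbound k l).trans ?_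
  rw [Finset.sum_add_distrib]
  simp

end Expect

/-- An estimate for the part of a load that exceeds `1`. -/
theorem excess_le {Y m δ : ℝ} (hδ : 0 < δ) (hm : m ≤ 1) (hY : 0 ≤ Y) :
    max (Y - 1) 0 ≤ δ * Y + (Y - m) ^ 2 / (4 * δ) := by
  have h0 : 0 ≤ (Y - m) ^ 2 / (4 * δ) := by positivity
  refine max_le ?_ (by positivity)
  by_cases h1 : Y ≤ 1
  · nlinarith [mul_nonneg hδ.le hY]
  · push Not at h1
    -- This says that the square of `Y - m - 2 * δ` is nonnegative. Since `m ≤ 1 < Y`, it remains to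
    -- use `Y - 1 ≤ Y - m` and `δ ≤ δ * Y`.
    have h2 : Y - m ≤ δ + (Y - m) ^ 2 / (4 * δ) := by
      have h3 : (Y - m) ^ 2 / (4 * δ) - (Y - m) + δ = ((Y - m) - 2 * δ) ^ 2 / (4 * δ) := by
        field_simp
        ring
      have h4 : 0 ≤ ((Y - m) - 2 * δ) ^ 2 / (4 * δ) := by positivity
      linarith
    nlinarith

/-! ### Random matchings and proposals -/

/-- A finite probability space with a random matching `m` between `U` and `V`, given by its
indicator, and the indicators `ξ` of the realized pairs. -/
structure MatchingModel (S U V : Type*) [Fintype S] [Fintype U] [Fintype V] where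
  wt : S → ℝ
  m : S → U → V → ℝ
  ξ : S → U → V → ℝ
  p : ℝ
  prob : IsProbWeight wt
  m_eq : ∀ s u v, m s u v = 0 ∨ m s u v = 1
  row_le : ∀ s u, ∑ v, m s u v ≤ 1
  col_le : ∀ s v, ∑ u, m s u v ≤ 1
  ξ_eq : ∀ s u v, ξ s u v = 0 ∨ ξ s u v = 1
  p_pos : 0 < p
  expect_ξ : ∀ u v, expect wt (fun s => ξ s u v) = p
  expect_ξ_row : ∀ u v v', v ≠ v' → expect wt (fun s => ξ s u v * ξ s u v') = p * p
  expect_ξ_col : ∀ u u' v, u ≠ u' → expect wt (fun s => ξ s u v * ξ s u' v) = p * p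

namespace MatchingModel

variable {S U V : Type*} [Fintype S] [Fintype U] [Fintype V] (X : MatchingModel S U V)

/-- The probability that the pair `uv` is in the matching. -/
noncomputable def x (u : U) (v : V) : ℝ := expect X.wt fun s => X.m s u v

theorem m_nonneg (s : S) (u : U) (v : V) : 0 ≤ X.m s u v := by
  rcases X.m_eq s u v with h | h <;> simp [h]

theorem m_le_one (s : S) (u : U) (v : V) : X.m s u v ≤ 1 := by
  rcases X.m_eq s u v with h | h <;> simp [h]

theorem x_nonneg (u : U) (v : V) : 0 ≤ X.x u v := X.prob.expect_nonneg fun s => X.m_nonneg s u v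

theorem sum_x_row_le (u : U) : ∑ v, X.x u v ≤ 1 := by
  unfold x
  rw [← expect_sum]
  exact (X.prob.expect_mono fun s => X.row_le s u).trans (X.prob.expect_const 1).le

theorem sum_x_col_le (v : V) : ∑ u, X.x u v ≤ 1 := by
  unfold x
  rw [← expect_sum]
  exact (X.prob.expect_mono fun s => X.col_le s v).trans (X.prob.expect_const 1).le

theorem m_mul_row {u : U} {v v' : V} (h : v ≠ v') (s : S) : X.m s u v * X.m s u v' = 0 := by
  classical
  rcases X.m_eq s u v with h1 | h1
  · simp [h1]
  rcases X.m_eq s u v' with h2 | h2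
  · simp [h2]
  have h3 := Finset.sum_le_univ_sum_of_nonneg (s := {v, v'}) fun w => X.m_nonneg s u w
  rw [Finset.sum_pair h, h1, h2] at h3
  linarith [X.row_le s u]

theorem m_mul_col {u u' : U} {v : V} (h : u ≠ u') (s : S) : X.m s u v * X.m s u' v = 0 := by
  classical
  rcases X.m_eq s u v with h1 | h1
  · simp [h1]
  rcases X.m_eq s u' v with h2 | h2
  · simp [h2]
  have h3 := Finset.sum_le_univ_sum_of_nonneg (s := {u, u'}) fun w => X.m_nonneg s w v
  rw [Finset.sum_pair h, h1, h2] at h3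
  linarith [X.col_le s v]

/-! #### Multiplicities in repeated samples -/

/-- The number of samples whose matching contains `uv`. -/
def count {R : ℕ} (t : Fin R → S) (u : U) (v : V) : ℝ := ∑ i, X.m (t i) u v

/-- The indicator of the event that no sample has `uv` in its matching. -/
def missed {R : ℕ} (t : Fin R → S) (u : U) (v : V) : ℝ := ∏ i, (1 - X.m (t i) u v)

theorem count_nonneg {R : ℕ} (t : Fin R → S) (u : U) (v : V) : 0 ≤ X.count t u v :=
  Finset.sum_nonneg fun _ _ => X.m_nonneg _ u v

theorem missed_nonneg {R : ℕ} (t : Fin R → S) (u : U) (v : V) : 0 ≤ X.missed t u v :=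
  Finset.prod_nonneg fun _ _ => sub_nonneg.2 (X.m_le_one _ u v)

theorem missed_eq {R : ℕ} (t : Fin R → S) (u : U) (v : V) :
    X.missed t u v = 1 ∨ (X.missed t u v = 0 ∧ X.count t u v ≠ 0) := by
  by_cases h : ∃ i, X.m (t i) u v = 1
  · obtain ⟨i, hi⟩ := h
    refine Or.inr ⟨Finset.prod_eq_zero (Finset.mem_univ i) (by rw [hi]; ring), fun h0 => ?_⟩
    have := (Finset.sum_eq_zero_iff_of_nonneg fun i _ => X.m_nonneg (t i) u v).1 h0 i
      (Finset.mem_univ i)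
    rw [hi] at this
    norm_num at this
  · push Not at h
    refine Or.inl (Finset.prod_eq_one fun i _ => ?_)
    rw [(X.m_eq (t i) u v).resolve_right (h i), sub_zero]

theorem expect_missed (R : ℕ) (u : U) (v : V) :
    expect (piWeight (Fin R) X.wt) (fun t => X.missed t u v) = (1 - X.x u v) ^ R := by
  have := expect_pi_prod (wt := X.wt) (ι := Fin R) fun _ s => 1 - X.m s u v
  simp only [missed, this, expect_sub, X.prob.expect_const, Finset.prod_const, Finset.card_univ,
    Fintype.card_fin, x]

theorem expect_count (R : ℕ) (u : U) (v : V) :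
    expect (piWeight (Fin R) X.wt) (fun t => X.count t u v) = R * X.x u v := by
  simp only [count]
  rw [expect_sum]
  simp [X.prob.expect_pi_eval _ (fun s => X.m s u v), x]

/-- Equal samples contribute the joint probability, different samples are independent. For two
different pairs that share a vertex the first term vanishes and the counts are negatively
correlated; for equal pairs this is a second moment bound. -/
theorem expect_count_mul (R : ℕ) (u u' : U) (v v' : V) :
    expect (piWeight (Fin R) X.wt) (fun t => X.count t u v * X.count t u' v') ≤
      R * expect X.wt (fun s => X.m s u v * X.m s u' v') + R * X.x u v * (R * X.x u' v') := by
  simp only [count, Finset.sum_mul_sum]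
  rw [expect_sum]
  have h0 : 0 ≤ X.x u v * X.x u' v' := mul_nonneg (X.x_nonneg u v) (X.x_nonneg u' v')
  have h1 : 0 ≤ expect X.wt (fun s => X.m s u v * X.m s u' v') :=
    X.prob.expect_nonneg fun s => mul_nonneg (X.m_nonneg s u v) (X.m_nonneg s u' v')
  have : ∀ i : Fin R, expect (piWeight (Fin R) X.wt)
      (fun t => ∑ j, X.m (t i) u v * X.m (t j) u' v') ≤
      expect X.wt (fun s => X.m s u v * X.m s u' v') + R * (X.x u v * X.x u' v') := by
    intro i
    rw [expect_sum]
    calc ∑ j, expect (piWeight (Fin R) X.wt) (fun t => X.m (t i) u v * X.m (t j) u' v')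
        ≤ ∑ j, ((if j = i then expect X.wt (fun s => X.m s u v * X.m s u' v') else 0) +
            X.x u v * X.x u' v') := by
          refine Finset.sum_le_sum fun j _ => ?_
          by_cases hij : j = i
          · subst hij
            rw [if_pos rfl, X.prob.expect_pi_eval j (fun s => X.m s u v * X.m s u' v')]
            linarith
          · rw [if_neg hij, X.prob.expect_pi_eval_mul (Ne.symm hij) (fun s => X.m s u v)
              (fun s => X.m s u' v'), zero_add]
            exact le_rfl
      _ = _ := by simp [Finset.sum_add_distrib]
  refine (Finset.sum_le_sum fun i _ => this i).trans (le_of_eq ?_)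
  simp
  ring

/-! #### Proposals along crucial pairs -/

variable (R : ℕ) (κ ε : ℝ)

/-- The pair `uv` is contained in `κ` of `R` samples on average. -/
def Crucial (u : U) (v : V) : Prop := κ ≤ R * X.x u v

open Classical in
/-- The probability of a crucial pair. -/
noncomputable def xc (u : U) (v : V) : ℝ := if X.Crucial R κ u v then X.x u v else 0

open Classical in
/-- The indicator of the event that the crucial pair `uv` is in the matching. -/
noncomputable def offer (s : S) (u : U) (v : V) : ℝ := if X.Crucial R κ u v then X.m s u v else 0

/-- The expected number of crucial pairs at `u` in the matching. -/
noncomputable def rowMass (u : U) : ℝ := ∑ v, X.xc R κ u v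

/-- The expected number of crucial pairs at `v` in the matching. -/
noncomputable def colMass (v : V) : ℝ := ∑ u, X.xc R κ u v

/-- The indicator of the event that `u` makes no proposal. -/
noncomputable def idle (h : U → S) (u : U) : ℝ := 1 - ∑ v, X.offer R κ (h u) u v

/-- The indicator of the event that `v` receives no proposal. -/
noncomputable def vacant (h : U → S) (v : V) : ℝ := ∏ u, (1 - X.offer R κ (h u) u v)

/-- The probability that `v` receives no proposal. -/
noncomputable def vacancy (v : V) : ℝ := ∏ u, (1 - X.xc R κ u v)

theorem xc_nonneg (u : U) (v : V) : 0 ≤ X.xc R κ u v := by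
  unfold xc; split_ifs; exacts [X.x_nonneg u v, le_rfl]

theorem xc_le (u : U) (v : V) : X.xc R κ u v ≤ X.x u v := by
  unfold xc; split_ifs; exacts [le_rfl, X.x_nonneg u v]

theorem xc_le_colMass (u : U) (v : V) : X.xc R κ u v ≤ X.colMass R κ v :=
  Finset.single_le_sum (f := fun u => X.xc R κ u v) (fun u _ => X.xc_nonneg R κ u v)
    (Finset.mem_univ u)

theorem rowMass_nonneg (u : U) : 0 ≤ X.rowMass R κ u :=
  Finset.sum_nonneg fun v _ => X.xc_nonneg R κ u v

theorem colMass_nonneg (v : V) : 0 ≤ X.colMass R κ v :=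
  Finset.sum_nonneg fun u _ => X.xc_nonneg R κ u v

theorem rowMass_le_one (u : U) : X.rowMass R κ u ≤ 1 :=
  (Finset.sum_le_sum fun v _ => X.xc_le R κ u v).trans (X.sum_x_row_le u)

theorem colMass_le_one (v : V) : X.colMass R κ v ≤ 1 :=
  (Finset.sum_le_sum fun u _ => X.xc_le R κ u v).trans (X.sum_x_col_le v)

theorem offer_eq (s : S) (u : U) (v : V) : X.offer R κ s u v = 0 ∨ X.offer R κ s u v = 1 := by
  unfold offer; split_ifs; exacts [X.m_eq s u v, Or.inl rfl]

theorem offer_nonneg (s : S) (u : U) (v : V) : 0 ≤ X.offer R κ s u v := by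
  rcases X.offer_eq R κ s u v with h | h <;> simp [h]

theorem offer_le (s : S) (u : U) (v : V) : X.offer R κ s u v ≤ X.m s u v := by
  unfold offer; split_ifs; exacts [le_rfl, X.m_nonneg s u v]

theorem offer_le_one (s : S) (u : U) (v : V) : X.offer R κ s u v ≤ 1 :=
  (X.offer_le R κ s u v).trans (X.m_le_one s u v)

theorem sum_offer_le (s : S) (u : U) : ∑ v, X.offer R κ s u v ≤ 1 :=
  (Finset.sum_le_sum fun v _ => X.offer_le R κ s u v).trans (X.row_le s u)

theorem expect_offer (u : U) (v : V) :
    expect X.wt (fun s => X.offer R κ s u v) = X.xc R κ u v := by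
  unfold offer xc
  split_ifs
  · rfl
  · exact X.prob.expect_const 0

theorem idle_nonneg (h : U → S) (u : U) : 0 ≤ X.idle R κ h u :=
  sub_nonneg.2 (X.sum_offer_le R κ (h u) u)

/-- A vertex that is not idle has exactly one offer. -/
theorem idle_eq (h : U → S) (u : U) :
    X.idle R κ h u = 0 ∨ (X.idle R κ h u = 1 ∧ ∀ v, X.offer R κ (h u) u v = 0) := by
  by_cases hex : ∃ v, X.offer R κ (h u) u v = 1
  · obtain ⟨v, hv⟩ := hex
    have h1 := Finset.single_le_sum (f := fun v => X.offer R κ (h u) u v)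
      (fun v _ => X.offer_nonneg R κ (h u) u v) (Finset.mem_univ v)
    have h2 := X.sum_offer_le R κ (h u) u
    simp only [hv] at h1
    left
    unfold idle
    linarith
  · push Not at hex
    have h0 : ∀ v, X.offer R κ (h u) u v = 0 := fun v =>
      (X.offer_eq R κ (h u) u v).resolve_right (hex v)
    exact Or.inr ⟨by simp [idle, h0], h0⟩

theorem vacant_eq (h : U → S) (v : V) :
    (X.vacant R κ h v = 0 ∧ ∃ u, X.offer R κ (h u) u v = 1) ∨
      (X.vacant R κ h v = 1 ∧ ∀ u, X.offer R κ (h u) u v = 0) := by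
  by_cases hex : ∃ u, X.offer R κ (h u) u v = 1
  · obtain ⟨u, hu⟩ := hex
    exact Or.inl ⟨Finset.prod_eq_zero (Finset.mem_univ u) (by rw [hu]; ring), u, hu⟩
  · push Not at hex
    have h0 : ∀ u, X.offer R κ (h u) u v = 0 := fun u =>
      (X.offer_eq R κ (h u) u v).resolve_right (hex u)
    exact Or.inr ⟨by simp [vacant, h0], h0⟩

theorem idle_sq (h : U → S) (u : U) : X.idle R κ h u * X.idle R κ h u = X.idle R κ h u := by
  rcases X.idle_eq R κ h u with e | ⟨e, -⟩ <;> rw [e] <;> ring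

theorem vacant_sq (h : U → S) (v : V) :
    X.vacant R κ h v * X.vacant R κ h v = X.vacant R κ h v := by
  rcases X.vacant_eq R κ h v with ⟨e, -⟩ | ⟨e, -⟩ <;> rw [e] <;> ring

theorem vacant_nonneg (h : U → S) (v : V) : 0 ≤ X.vacant R κ h v := by
  rcases X.vacant_eq R κ h v with ⟨e, -⟩ | ⟨e, -⟩ <;> simp [e]

theorem one_sub_xc_nonneg (u : U) (v : V) : 0 ≤ 1 - X.xc R κ u v := by
  linarith [X.xc_le_colMass R κ u v, X.colMass_le_one R κ v]

/-- The union bound. It makes room for the flow at `v`: a free right vertex can take in at least the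
mass that crucial pairs leave over. -/
theorem one_sub_colMass_le_vacancy (v : V) : 1 - X.colMass R κ v ≤ X.vacancy R κ v := by
  have key : ∀ s : Finset U, 1 - ∑ u ∈ s, X.xc R κ u v ≤ ∏ u ∈ s, (1 - X.xc R κ u v) := by
    classical
    intro s
    induction s using Finset.induction_on with
    | empty => simp
    | insert a s ha ih =>
      rw [Finset.sum_insert ha, Finset.prod_insert ha]
      have h1 := X.one_sub_xc_nonneg R κ a v
      have h2 := X.xc_nonneg R κ a v
      have h3 : 0 ≤ ∑ u ∈ s, X.xc R κ u v := Finset.sum_nonneg fun u _ => X.xc_nonneg R κ u v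
      nlinarith [mul_le_mul_of_nonneg_left ih h1, mul_nonneg h2 h3]
  exact key Finset.univ

theorem vacancy_le_exp (v : V) : X.vacancy R κ v ≤ Real.exp (-X.colMass R κ v) := by
  unfold vacancy colMass
  rw [← Finset.sum_neg_distrib, Real.exp_sum]
  refine Finset.prod_le_prod (fun u _ => X.one_sub_xc_nonneg R κ u v) fun u _ => ?_
  linarith [Real.add_one_le_exp (-X.xc R κ u v)]

/-- The concavity of `1 - exp (-c)`. -/
theorem colMass_mul_le (v : V) :
    (1 - Real.exp (-1)) * X.colMass R κ v ≤ 1 - X.vacancy R κ v := by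
  have h0 := X.colMass_nonneg R κ v
  have h1 := X.colMass_le_one R κ v
  have h2 := X.vacancy_le_exp R κ v
  have h3 := convexOn_exp.2 (Set.mem_univ (-1)) (Set.mem_univ 0) h0 (sub_nonneg.2 h1)
    (by ring)
  simp only [smul_eq_mul, mul_neg, mul_one, mul_zero, add_zero, Real.exp_zero] at h3
  nlinarith

/-! ### Moments of the idle and vacant indicators -/

section Independence

variable [DecidableEq U]

theorem expect_idle (u : U) :
    expect (piWeight U X.wt) (fun h => X.idle R κ h u) = 1 - X.rowMass R κ u := by
  unfold idle rowMass
  rw [X.prob.expect_pi_eval u (fun s => 1 - ∑ v, X.offer R κ s u v), expect_sub,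
    X.prob.expect_const, expect_sum]
  simp only [expect_offer]

theorem expect_idle_mul {u u' : U} (huu : u ≠ u') :
    expect (piWeight U X.wt) (fun h => X.idle R κ h u * X.idle R κ h u') =
      (1 - X.rowMass R κ u) * (1 - X.rowMass R κ u') := by
  rw [← X.expect_idle, ← X.expect_idle]
  unfold idle
  rw [X.prob.expect_pi_eval_mul huu (fun s => 1 - ∑ v, X.offer R κ s u v)
    (fun s => 1 - ∑ v, X.offer R κ s u' v),
    X.prob.expect_pi_eval u (fun s => 1 - ∑ v, X.offer R κ s u v),
    X.prob.expect_pi_eval u' (fun s => 1 - ∑ v, X.offer R κ s u' v)]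

theorem expect_vacant (v : V) :
    expect (piWeight U X.wt) (fun h => X.vacant R κ h v) = X.vacancy R κ v := by
  have := expect_pi_prod (wt := X.wt) fun u s => 1 - X.offer R κ s u v
  unfold vacant vacancy
  rw [this]
  refine Finset.prod_congr rfl fun u _ => ?_
  rw [expect_sub, X.prob.expect_const, expect_offer]

/-- Each `u` makes an offer to at most one of `v` and `v'`, so its factor has mean `1 - a - b ≤ (1 -
a) * (1 - b)`, and the left vertices are independent. -/
theorem expect_vacant_mul {v v' : V} (hvv : v ≠ v') :
    expect (piWeight U X.wt) (fun h => X.vacant R κ h v * X.vacant R κ h v') ≤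
      X.vacancy R κ v * X.vacancy R κ v' := by
  have := expect_pi_prod (wt := X.wt) fun u s =>
    (1 - X.offer R κ s u v) * (1 - X.offer R κ s u v')
  simp only [vacant, vacancy, ← Finset.prod_mul_distrib]
  rw [this]
  refine Finset.prod_le_prod (fun u _ => X.prob.expect_nonneg fun s => mul_nonneg
    (sub_nonneg.2 (X.offer_le_one R κ s u v)) (sub_nonneg.2 (X.offer_le_one R κ s u v')))
    fun u _ => ?_
  have hz : ∀ s, (1 - X.offer R κ s u v) * (1 - X.offer R κ s u v') =
      (1 - X.offer R κ s u v) - X.offer R κ s u v' := by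
    intro s
    have h1 := X.m_mul_row (u := u) hvv s
    have : X.offer R κ s u v * X.offer R κ s u v' = 0 := by
      unfold offer; split_ifs <;> simp [h1]
    linear_combination this
  simp only [hz]
  rw [expect_sub, expect_sub, X.prob.expect_const, expect_offer, expect_offer]
  nlinarith [mul_nonneg (X.xc_nonneg R κ u v) (X.xc_nonneg R κ u v')]

/-- Idleness of `u` depends on `h u` alone. Vacancy of `v` does not depend on `h u`, since `u` never
makes an offer along a pair that is not crucial. -/
theorem expect_idle_mul_vacant {u : U} {v : V} (huv : ¬ X.Crucial R κ u v) :
    expect (piWeight U X.wt) (fun h => X.idle R κ h u * X.vacant R κ h v) =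
      (1 - X.rowMass R κ u) * X.vacancy R κ v := by
  have h0 : ∀ s, X.offer R κ s u v = 0 := fun s => by simp [offer, huv]
  have hc : X.xc R κ u v = 0 := by simp [xc, huv]
  have := expect_pi_prod (wt := X.wt) fun u' s =>
    (if u' = u then 1 - ∑ v, X.offer R κ s u v else 1) * (1 - X.offer R κ s u' v)
  simp only [Finset.prod_mul_distrib, Finset.prod_ite_eq', Finset.mem_univ, if_true] at this
  unfold idle vacant vacancy
  rw [this, ← Finset.mul_prod_erase Finset.univ _ (Finset.mem_univ u),
    ← Finset.mul_prod_erase Finset.univ (fun u => 1 - X.xc R κ u v) (Finset.mem_univ u), hc]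
  simp only [h0, if_true, sub_zero, mul_one, one_mul]
  congr 1
  · rw [expect_sub, X.prob.expect_const, expect_sum]
    simp only [expect_offer, rowMass]
  · refine Finset.prod_congr rfl fun u' hu' => ?_
    simp only [Finset.ne_of_mem_erase hu', if_false, one_mul]
    rw [expect_sub, X.prob.expect_const, expect_offer]

end Independence

end MatchingModel

namespace MatchingModel

variable {S U V : Type*} [Fintype S] [Fintype U] [Fintype V] (X : MatchingModel S U V)
variable (R : ℕ) (κ ε : ℝ)

/-! ### The fractional matching -/

/-- The pair `uv` is not crucial, and its ends are not almost always covered by crucial pairs. -/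
def Good (u : U) (v : V) : Prop :=
  ¬ X.Crucial R κ u v ∧ X.rowMass R κ u ≤ 1 - ε ∧ X.colMass R κ v ≤ 1 - ε

open Classical in
/-- The probability of a good pair. -/
noncomputable def xg (u : U) (v : V) : ℝ := if X.Good R κ ε u v then X.x u v else 0

open Classical in
/-- The factor that makes the flow on good pairs unbiased. -/
noncomputable def coef (u : U) (v : V) : ℝ :=
  if X.Good R κ ε u v then 1 / (R * X.p * ((1 - X.rowMass R κ u) * X.vacancy R κ v)) else 0

/-- The fractional matching on good pairs that avoids all proposals. -/
noncomputable def flow (z : (Fin R → S) × S × (U → S)) (u : U) (v : V) : ℝ :=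
  X.coef R κ ε u v * (X.count z.1 u v * X.ξ z.2.1 u v * (X.idle R κ z.2.2 u * X.vacant R κ z.2.2 v))

/-- The flow at `u` if `u` is idle. -/
noncomputable def rowLoad (z : (Fin R → S) × S × (U → S)) (u : U) : ℝ :=
  ∑ v, X.coef R κ ε u v * (X.count z.1 u v * X.ξ z.2.1 u v * X.vacant R κ z.2.2 v)

/-- The flow at `v` if `v` is vacant. -/
noncomputable def colLoad (z : (Fin R → S) × S × (U → S)) (v : V) : ℝ :=
  ∑ u, X.coef R κ ε u v * (X.count z.1 u v * X.ξ z.2.1 u v * X.idle R κ z.2.2 u)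

/-- The joint weights of the samples, of the realization of the pairs that are not crucial, and of
the realizations that determine the proposals. -/
noncomputable def joint : (Fin R → S) × S × (U → S) → ℝ :=
  tripleWeight (piWeight (Fin R) X.wt) X.wt (piWeight U X.wt)

theorem joint_isProbWeight [DecidableEq U] : IsProbWeight (X.joint (U := U) R) :=
  X.prob.pi.triple X.prob X.prob.pi

theorem ξ_nonneg (s : S) (u : U) (v : V) : 0 ≤ X.ξ s u v := by
  rcases X.ξ_eq s u v with h | h <;> simp [h]

theorem ξ_sq (s : S) (u : U) (v : V) : X.ξ s u v * X.ξ s u v = X.ξ s u v := by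
  rcases X.ξ_eq s u v with h | h <;> simp [h]

theorem m_sq (s : S) (u : U) (v : V) : X.m s u v * X.m s u v = X.m s u v := by
  rcases X.m_eq s u v with h | h <;> simp [h]

theorem xg_nonneg (u : U) (v : V) : 0 ≤ X.xg R κ ε u v := by
  unfold xg; split_ifs; exacts [X.x_nonneg u v, le_rfl]

theorem xg_add_xc_le (u : U) (v : V) : X.xg R κ ε u v + X.xc R κ u v ≤ X.x u v := by
  have := X.x_nonneg u v
  unfold xg xc
  split_ifs with h1 h2
  · exact absurd h2 h1.1
  all_goals linarith

/-- Good and crucial pairs are disjoint and share a total mass of at most `1`. Divided by the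
probability that `u` is idle, this bounds the mean load of an idle vertex by `1`. -/
theorem sum_xg_row_le (u : U) : ∑ v, X.xg R κ ε u v ≤ 1 - X.rowMass R κ u := by
  have := Finset.sum_le_sum fun v (_ : v ∈ Finset.univ) => X.xg_add_xc_le R κ ε u v
  rw [Finset.sum_add_distrib] at this
  have h2 := X.sum_x_row_le u
  unfold rowMass
  linarith

theorem sum_xg_col_le (v : V) : ∑ u, X.xg R κ ε u v ≤ 1 - X.colMass R κ v := by
  have := Finset.sum_le_sum fun u (_ : u ∈ Finset.univ) => X.xg_add_xc_le R κ ε u v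
  rw [Finset.sum_add_distrib] at this
  have h2 := X.sum_x_col_le v
  unfold colMass
  linarith

/-! ### Means and variances of the loads -/

variable {R κ ε}

theorem Good.factors {X : MatchingModel S U V} {u : U} {v : V} (h : X.Good R κ ε u v) :
    ε ≤ 1 - X.rowMass R κ u ∧ ε ≤ X.vacancy R κ v :=
  ⟨by linarith [h.2.1], by linarith [h.2.2, X.one_sub_colMass_le_vacancy R κ v]⟩

theorem vacancy_nonneg (v : V) : 0 ≤ X.vacancy R κ v :=
  Finset.prod_nonneg fun u _ => X.one_sub_xc_nonneg R κ u v

theorem coef_nonneg (u : U) (v : V) : 0 ≤ X.coef R κ ε u v := by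
  unfold coef
  split_ifs
  · have := X.p_pos
    have := X.vacancy_nonneg (R := R) (κ := κ) v
    have := sub_nonneg.2 (X.rowMass_le_one R κ u)
    positivity
  · exact le_rfl

/-- Count, realization and freeness come from independent sources, with means `R * x`, `p` and, as
the pair is not crucial, the product of the two probabilities. The coefficient cancels all factors
but `x`. -/
theorem expect_flow [DecidableEq U] (hR : 0 < R) (hε : 0 < ε) (u : U) (v : V) :
    expect (X.joint R) (fun z => X.flow R κ ε z u v) = X.xg R κ ε u v := by
  unfold flow joint
  rw [expect_const_mul, expect_triple_mul (fun t => X.count t u v) (fun s => X.ξ s u v)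
    (fun h => X.idle R κ h u * X.vacant R κ h v), expect_count, expect_ξ]
  unfold coef xg
  split_ifs with hg
  · obtain ⟨h1, h2⟩ := hg.factors
    rw [X.expect_idle_mul_vacant R κ hg.1]
    have := X.p_pos
    have h3 : 0 < 1 - X.rowMass R κ u := by linarith
    have h4 : 0 < X.vacancy R κ v := by linarith
    have : (0 : ℝ) < R := by exact_mod_cast hR
    field_simp
  · ring

/-- The mean contribution of `v` to the load at `u`. The load omits the indicator that `u` is idle,
so the corresponding factor of the coefficient survives as a denominator. -/
theorem coef_mul_row (hR : 0 < R) (hε : 0 < ε) (u : U) (v : V) :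
    X.coef R κ ε u v * (R * X.x u v * X.p * X.vacancy R κ v) =
      X.xg R κ ε u v / (1 - X.rowMass R κ u) := by
  unfold coef xg
  split_ifs with hg
  · obtain ⟨h1, h2⟩ := hg.factors
    have := X.p_pos
    have h3 : 0 < 1 - X.rowMass R κ u := by linarith
    have h4 : 0 < X.vacancy R κ v := by linarith
    have : (0 : ℝ) < R := by exact_mod_cast hR
    field_simp
  · ring

theorem coef_mul_col (hR : 0 < R) (hε : 0 < ε) (u : U) (v : V) :
    X.coef R κ ε u v * (R * X.x u v * X.p * (1 - X.rowMass R κ u)) =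
      X.xg R κ ε u v / X.vacancy R κ v := by
  unfold coef xg
  split_ifs with hg
  · obtain ⟨h1, h2⟩ := hg.factors
    have := X.p_pos
    have h3 : 0 < 1 - X.rowMass R κ u := by linarith
    have h4 : 0 < X.vacancy R κ v := by linarith
    have : (0 : ℝ) < R := by exact_mod_cast hR
    field_simp
  · ring

/-- An estimate for the variances of the flow. -/
theorem coef_sq_mul_le (hR : 0 < R) (hε : 0 < ε) (u : U) (v : V) {q : ℝ}
    (hq : X.Good R κ ε u v → q * ε ≤ (1 - X.rowMass R κ u) * X.vacancy R κ v) (hq0 : 0 ≤ q) :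
    X.coef R κ ε u v ^ 2 * ((R * X.x u v + R * X.x u v * (R * X.x u v)) * X.p * q) ≤
      (1 + κ) / (R * X.p * ε ^ 3) * X.xg R κ ε u v := by
  unfold coef xg
  split_ifs with hg
  · obtain ⟨h1, h2⟩ := hg.factors
    have hq := hq hg
    have hp := X.p_pos
    have hx := X.x_nonneg u v
    have hR' : (0 : ℝ) < R := by exact_mod_cast hR
    set D := (1 - X.rowMass R κ u) * X.vacancy R κ v with hD
    have hDε : ε * ε ≤ D := mul_le_mul h1 h2 hε.le (hε.le.trans h1)
    have hD0 : 0 < D := by nlinarith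
    -- Here the threshold matters: off the crucial pairs the quadratic term `(R * x) ^ 2` is at most
    -- `κ * (R * x)`, hence the variance is linear in `x`.
    have hcr : R * X.x u v ≤ κ := (not_le.1 hg.1).le
    have h5 : (1 / (R * X.p * D)) ^ 2 *
        ((R * X.x u v + R * X.x u v * (R * X.x u v)) * X.p * q) =
        (X.x u v * (1 + R * X.x u v)) / (R * X.p) * (q / D ^ 2) := by
      field_simp
    have h6 : q / D ^ 2 ≤ 1 / ε ^ 3 := by
      rw [div_le_div_iff₀ (by positivity) (by positivity)]
      have h7 : q * ε * (ε * ε) ≤ D * D :=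
        mul_le_mul hq hDε (by positivity) hD0.le
      nlinarith
    have h8 : (X.x u v * (1 + R * X.x u v)) / (R * X.p) ≤ (X.x u v * (1 + κ)) / (R * X.p) := by
      gcongr
    have h9 : 0 ≤ (X.x u v * (1 + κ)) / (R * X.p) := by
      refine le_trans ?_ h8
      positivity
    calc _ = _ := h5
      _ ≤ (X.x u v * (1 + κ)) / (R * X.p) * (1 / ε ^ 3) :=
          mul_le_mul h8 h6 (by positivity) h9
      _ = _ := by field_simp
  · simp

/-- The summands for different `v` are negatively correlated: one matching contains at most one pair
at `u`, different pairs are realized independently, and vacancies are negatively correlated. -/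
theorem expect_rowLoad [DecidableEq U] [DecidableEq V] (hR : 0 < R) (hε : 0 < ε) (u : U) :
    expect (X.joint R) (fun z => (X.rowLoad R κ ε z u -
        ∑ v, X.xg R κ ε u v / (1 - X.rowMass R κ u)) ^ 2) ≤
      (1 + κ) / (R * X.p * ε ^ 3) * ∑ v, X.xg R κ ε u v := by
  have h := (X.joint_isProbWeight R).expect_sq_sub_le
    (fun v z => X.count z.1 u v * X.ξ z.2.1 u v * X.vacant R κ z.2.2 v)
    (fun v => R * X.x u v * X.p * X.vacancy R κ v)
    (fun v => (R * X.x u v + R * X.x u v * (R * X.x u v)) * X.p * X.vacancy R κ v)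
    (fun v => X.coef R κ ε u v) (fun v => X.coef_nonneg u v) ?_ ?_ ?_
  · simp only [X.coef_mul_row hR hε] at h
    refine h.trans ?_
    rw [Finset.mul_sum]
    refine Finset.sum_le_sum fun v _ => X.coef_sq_mul_le hR hε u v (fun hg => ?_)
      (X.vacancy_nonneg v)
    nlinarith [hg.factors.1, X.vacancy_nonneg (R := R) (κ := κ) v]
  · intro v
    rw [joint, expect_triple_mul (fun t => X.count t u v) (fun s => X.ξ s u v)
      (fun h => X.vacant R κ h v), expect_count, expect_ξ, expect_vacant]
  · intro v v' hvv
    have h1 := X.expect_count_mul R u u v v'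
    simp only [X.m_mul_row hvv, X.prob.expect_const] at h1
    have h2 := X.expect_vacant_mul R κ hvv
    have h3 : ∀ z : (Fin R → S) × S × (U → S),
        X.count z.1 u v * X.ξ z.2.1 u v * X.vacant R κ z.2.2 v *
          (X.count z.1 u v' * X.ξ z.2.1 u v' * X.vacant R κ z.2.2 v') =
        (X.count z.1 u v * X.count z.1 u v') * (X.ξ z.2.1 u v * X.ξ z.2.1 u v') *
          (X.vacant R κ z.2.2 v * X.vacant R κ z.2.2 v') := fun z => by ring
    simp only [h3]
    rw [joint, expect_triple_mul (fun t => X.count t u v * X.count t u v')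
      (fun s => X.ξ s u v * X.ξ s u v') (fun h => X.vacant R κ h v * X.vacant R κ h v'),
      X.expect_ξ_row u v v' hvv]
    have hp := X.p_pos
    have hv := X.vacancy_nonneg (R := R) (κ := κ) v
    have hv' := X.vacancy_nonneg (R := R) (κ := κ) v'
    have hx := X.x_nonneg u v
    have hx' := X.x_nonneg u v'
    have h4 : 0 ≤ expect (piWeight U X.wt)
        (fun h => X.vacant R κ h v * X.vacant R κ h v') :=
      X.prob.pi.expect_nonneg fun h =>
        mul_nonneg (X.vacant_nonneg R κ h v) (X.vacant_nonneg R κ h v')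
    calc _ ≤ (R * 0 + R * X.x u v * (R * X.x u v')) * (X.p * X.p) *
          (X.vacancy R κ v * X.vacancy R κ v') := by gcongr
      _ = _ := by ring
  · intro v
    have h1 := X.expect_count_mul R u u v v
    simp only [X.m_sq] at h1
    have h3 : ∀ z : (Fin R → S) × S × (U → S),
        X.count z.1 u v * X.ξ z.2.1 u v * X.vacant R κ z.2.2 v *
          (X.count z.1 u v * X.ξ z.2.1 u v * X.vacant R κ z.2.2 v) =
        (X.count z.1 u v * X.count z.1 u v) * X.ξ z.2.1 u v * X.vacant R κ z.2.2 v := fun z => by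
      linear_combination X.count z.1 u v * X.count z.1 u v *
        (X.vacant R κ z.2.2 v * X.vacant R κ z.2.2 v) * X.ξ_sq z.2.1 u v +
        X.count z.1 u v * X.count z.1 u v * X.ξ z.2.1 u v * X.vacant_sq R κ z.2.2 v
    simp only [h3]
    rw [joint, expect_triple_mul (fun t => X.count t u v * X.count t u v)
      (fun s => X.ξ s u v) (fun h => X.vacant R κ h v), expect_ξ, expect_vacant]
    have hp := X.p_pos
    have hv := X.vacancy_nonneg (R := R) (κ := κ) v
    gcongr
    exact h1

/-- As for rows, except that different left vertices are idle independently, because each has its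
own realization. -/
theorem expect_colLoad [DecidableEq U] (hR : 0 < R) (hε : 0 < ε) (v : V) :
    expect (X.joint R) (fun z => (X.colLoad R κ ε z v -
        ∑ u, X.xg R κ ε u v / X.vacancy R κ v) ^ 2) ≤
      (1 + κ) / (R * X.p * ε ^ 3) * ∑ u, X.xg R κ ε u v := by
  have hrow : ∀ u, 0 ≤ 1 - X.rowMass R κ u := fun u => sub_nonneg.2 (X.rowMass_le_one R κ u)
  have h := (X.joint_isProbWeight R).expect_sq_sub_le
    (fun u z => X.count z.1 u v * X.ξ z.2.1 u v * X.idle R κ z.2.2 u)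
    (fun u => R * X.x u v * X.p * (1 - X.rowMass R κ u))
    (fun u => (R * X.x u v + R * X.x u v * (R * X.x u v)) * X.p * (1 - X.rowMass R κ u))
    (fun u => X.coef R κ ε u v) (fun u => X.coef_nonneg u v) ?_ ?_ ?_
  · simp only [X.coef_mul_col hR hε] at h
    refine h.trans ?_
    rw [Finset.mul_sum]
    refine Finset.sum_le_sum fun u _ => X.coef_sq_mul_le hR hε u v (fun hg => ?_) (hrow u)
    nlinarith [hg.factors.2, hrow u]
  · intro u
    rw [joint, expect_triple_mul (fun t => X.count t u v) (fun s => X.ξ s u v)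
      (fun h => X.idle R κ h u), expect_count, expect_ξ, expect_idle]
  · intro u u' huu
    have h1 := X.expect_count_mul R u u' v v
    simp only [X.m_mul_col huu, X.prob.expect_const] at h1
    have h3 : ∀ z : (Fin R → S) × S × (U → S),
        X.count z.1 u v * X.ξ z.2.1 u v * X.idle R κ z.2.2 u *
          (X.count z.1 u' v * X.ξ z.2.1 u' v * X.idle R κ z.2.2 u') =
        (X.count z.1 u v * X.count z.1 u' v) * (X.ξ z.2.1 u v * X.ξ z.2.1 u' v) *
          (X.idle R κ z.2.2 u * X.idle R κ z.2.2 u') := fun z => by ring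
    simp only [h3]
    rw [joint, expect_triple_mul (fun t => X.count t u v * X.count t u' v)
      (fun s => X.ξ s u v * X.ξ s u' v) (fun h => X.idle R κ h u * X.idle R κ h u'),
      X.expect_ξ_col u u' v huu, X.expect_idle_mul R κ huu]
    have hp := X.p_pos
    have hr := hrow u
    have hr' := hrow u'
    calc _ ≤ (R * 0 + R * X.x u v * (R * X.x u' v)) * (X.p * X.p) *
          ((1 - X.rowMass R κ u) * (1 - X.rowMass R κ u')) := by gcongr
      _ = _ := by ring
  · intro u
    have h1 := X.expect_count_mul R u u v v
    simp only [X.m_sq] at h1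
    have h3 : ∀ z : (Fin R → S) × S × (U → S),
        X.count z.1 u v * X.ξ z.2.1 u v * X.idle R κ z.2.2 u *
          (X.count z.1 u v * X.ξ z.2.1 u v * X.idle R κ z.2.2 u) =
        (X.count z.1 u v * X.count z.1 u v) * X.ξ z.2.1 u v * X.idle R κ z.2.2 u := fun z => by
      linear_combination X.count z.1 u v * X.count z.1 u v *
        (X.idle R κ z.2.2 u * X.idle R κ z.2.2 u) * X.ξ_sq z.2.1 u v +
        X.count z.1 u v * X.count z.1 u v * X.ξ z.2.1 u v * X.idle_sq R κ z.2.2 u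
    simp only [h3]
    rw [joint, expect_triple_mul (fun t => X.count t u v * X.count t u v)
      (fun s => X.ξ s u v) (fun h => X.idle R κ h u), expect_ξ, expect_idle]
    have hp := X.p_pos
    have hr := hrow u
    gcongr
    exact h1

end MatchingModel

namespace MatchingModel

variable {S U V : Type*} [Fintype S] [Fintype U] [Fintype V] (X : MatchingModel S U V)
variable (R : ℕ) (κ ε : ℝ)

/-! ### The value of the fractional matching -/

/-- The indicator of a proposal along a sampled pair. -/
noncomputable def usable (z : (Fin R → S) × S × (U → S)) (u : U) (v : V) : ℝ :=
  X.offer R κ (z.2.2 u) u v * (1 - X.missed z.1 u v)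

/-- The usable proposals to `v`, with total weight `1` if there are any. -/
noncomputable def accepted (z : (Fin R → S) × S × (U → S)) (u : U) (v : V) : ℝ :=
  X.usable R κ z u v / ∑ u', X.usable R κ z u' v

/-- `q` is at least the value of every fractional matching `w` that is supported by sampled pairs
which are proposals if they are crucial, and realized otherwise, where loads that exceed `1` count
negatively. -/
def Dominates (q : (Fin R → S) × S × (U → S) → ℝ) : Prop :=
  ∀ z, ∀ w : U → V → ℝ, (∀ u v, 0 ≤ w u v) →
    (∀ u v, w u v ≠ 0 → X.count z.1 u v ≠ 0 ∧
      (X.Crucial R κ u v → X.m (z.2.2 u) u v = 1) ∧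
      (¬ X.Crucial R κ u v → X.ξ z.2.1 u v = 1)) →
    ∑ u, ∑ v, w u v ≤ q z + ∑ u, max (∑ v, w u v - 1) 0 + ∑ v, max (∑ u, w u v - 1) 0

theorem usable_eq (z : (Fin R → S) × S × (U → S)) (u : U) (v : V) :
    X.usable R κ z u v = 0 ∨ (X.usable R κ z u v = 1 ∧ X.offer R κ (z.2.2 u) u v = 1 ∧
      X.count z.1 u v ≠ 0) := by
  unfold usable
  rcases X.offer_eq R κ (z.2.2 u) u v with h | h
  · simp [h]
  · rcases X.missed_eq z.1 u v with h' | ⟨h', hc⟩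
    · simp [h']
    · simp [h, h', hc]

theorem usable_nonneg (z : (Fin R → S) × S × (U → S)) (u : U) (v : V) :
    0 ≤ X.usable R κ z u v := by
  rcases X.usable_eq R κ z u v with h | ⟨h, -⟩ <;> simp [h]

theorem accepted_nonneg (z : (Fin R → S) × S × (U → S)) (u : U) (v : V) :
    0 ≤ X.accepted R κ z u v :=
  div_nonneg (X.usable_nonneg R κ z u v) (Finset.sum_nonneg fun u' _ => X.usable_nonneg R κ z u' v)

theorem accepted_le_offer (z : (Fin R → S) × S × (U → S)) (u : U) (v : V) :
    X.accepted R κ z u v ≤ X.offer R κ (z.2.2 u) u v := by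
  unfold accepted
  rcases X.usable_eq R κ z u v with h | ⟨h, ho, -⟩
  · simp [h, X.offer_nonneg]
  · rw [ho]
    refine div_le_one_of_le₀ ?_ (Finset.sum_nonneg fun u' _ => X.usable_nonneg R κ z u' v)
    exact Finset.single_le_sum (f := fun u => X.usable R κ z u v)
      (fun u' _ => X.usable_nonneg R κ z u' v) (Finset.mem_univ u)

theorem sum_accepted_le_one (z : (Fin R → S) × S × (U → S)) (v : V) :
    ∑ u, X.accepted R κ z u v ≤ 1 := by
  simp only [accepted, ← Finset.sum_div]
  exact div_self_le_one _

/-- A vertex with a usable proposal accepts total weight `1`. A vertex that has proposals but no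
usable one has a proposal along a missed pair, so the subtracted sum is at least `1`. -/
theorem le_sum_accepted (z : (Fin R → S) × S × (U → S)) (v : V) :
    1 - X.vacant R κ z.2.2 v - ∑ u, X.offer R κ (z.2.2 u) u v * X.missed z.1 u v ≤
      ∑ u, X.accepted R κ z u v := by
  have hnn : ∀ u, 0 ≤ X.offer R κ (z.2.2 u) u v * X.missed z.1 u v := fun u =>
    mul_nonneg (X.offer_nonneg R κ _ u v) (X.missed_nonneg z.1 u v)
  have hs : 0 ≤ ∑ u, X.offer R κ (z.2.2 u) u v * X.missed z.1 u v :=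
    Finset.sum_nonneg fun u _ => hnn u
  have hv := X.vacant_nonneg R κ z.2.2 v
  by_cases h0 : ∑ u, X.usable R κ z u v = 0
  · have h1 : 0 ≤ ∑ u, X.accepted R κ z u v :=
      Finset.sum_nonneg fun u _ => X.accepted_nonneg R κ z u v
    rcases X.vacant_eq R κ z.2.2 v with ⟨-, u, hu⟩ | ⟨h, -⟩
    · have h2 := (Finset.sum_eq_zero_iff_of_nonneg fun u _ => X.usable_nonneg R κ z u v).1 h0 u
        (Finset.mem_univ u)
      have h3 := Finset.single_le_sum (fun u _ => hnn u) (Finset.mem_univ u)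
      rw [usable, hu, one_mul] at h2
      rw [hu, one_mul] at h3
      linarith
    · rw [h]; linarith
  · have : ∑ u, X.accepted R κ z u v = 1 := by
      simp only [accepted, ← Finset.sum_div]
      exact div_self h0
    linarith

theorem flow_nonneg (z : (Fin R → S) × S × (U → S)) (u : U) (v : V) :
    0 ≤ X.flow R κ ε z u v :=
  mul_nonneg (X.coef_nonneg u v) (mul_nonneg (mul_nonneg (X.count_nonneg _ u v)
    (X.ξ_nonneg _ u v)) (mul_nonneg (X.idle_nonneg R κ _ u) (X.vacant_nonneg R κ _ v)))

variable {R κ}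

/-- The test matching is the sum of the accepted proposals and the flow. Flow uses only idle left
and vacant right vertices, where nothing is accepted; so the two loads never meet, and only the flow
can exceed `1`. -/
theorem Dominates.le {X : MatchingModel S U V} {q : (Fin R → S) × S × (U → S) → ℝ}
    (hq : X.Dominates R κ q) (z : (Fin R → S) × S × (U → S)) :
    ∑ v, (1 - X.vacant R κ z.2.2 v) -
        ∑ u, ∑ v, X.offer R κ (z.2.2 u) u v * X.missed z.1 u v +
        ∑ u, ∑ v, X.flow R κ ε z u v - ∑ u, max (∑ v, X.flow R κ ε z u v - 1) 0 -
        ∑ v, max (∑ u, X.flow R κ ε z u v - 1) 0 ≤ q z := by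
  have h := hq z (fun u v => X.accepted R κ z u v + X.flow R κ ε z u v)
    (fun u v => add_nonneg (X.accepted_nonneg R κ z u v) (X.flow_nonneg R κ ε z u v)) ?_
  · have h1 : ∑ u, ∑ v, (X.accepted R κ z u v + X.flow R κ ε z u v) =
        ∑ v, ∑ u, X.accepted R κ z u v + ∑ u, ∑ v, X.flow R κ ε z u v := by
      simp only [Finset.sum_add_distrib]
      rw [Finset.sum_comm (f := fun u v => X.accepted R κ z u v)]
    have h2 := Finset.sum_le_sum fun v (_ : v ∈ Finset.univ) => X.le_sum_accepted R κ z v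
    rw [Finset.sum_sub_distrib,
      Finset.sum_comm (f := fun v u => X.offer R κ (z.2.2 u) u v * X.missed z.1 u v)] at h2
    have h3 : ∑ u, max (∑ v, (X.accepted R κ z u v + X.flow R κ ε z u v) - 1) 0 ≤
        ∑ u, max (∑ v, X.flow R κ ε z u v - 1) 0 := by
      refine Finset.sum_le_sum fun u _ => ?_
      rcases X.idle_eq R κ z.2.2 u with h | ⟨-, h⟩
      · refine max_le ?_ (le_max_right _ _)
        have e : ∀ v, X.flow R κ ε z u v = 0 := fun v => by simp [flow, h]
        simp only [e, add_zero]
        have := (Finset.sum_le_sum fun v (_ : v ∈ Finset.univ) =>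
          X.accepted_le_offer R κ z u v).trans (X.sum_offer_le R κ (z.2.2 u) u)
        exact (sub_nonpos.2 this).trans (le_max_right _ _)
      · have e : ∀ v, X.accepted R κ z u v = 0 := fun v =>
          le_antisymm (h v ▸ X.accepted_le_offer R κ z u v) (X.accepted_nonneg R κ z u v)
        simp only [e, zero_add, le_refl]
    have h4 : ∑ v, max (∑ u, (X.accepted R κ z u v + X.flow R κ ε z u v) - 1) 0 ≤
        ∑ v, max (∑ u, X.flow R κ ε z u v - 1) 0 := by
      refine Finset.sum_le_sum fun v _ => ?_
      rcases X.vacant_eq R κ z.2.2 v with ⟨h, -⟩ | ⟨-, h⟩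
      · refine max_le ?_ (le_max_right _ _)
        have e : ∀ u, X.flow R κ ε z u v = 0 := fun u => by simp [flow, h]
        simp only [e, add_zero]
        exact (sub_nonpos.2 (X.sum_accepted_le_one R κ z v)).trans (le_max_right _ _)
      · have e : ∀ u, X.accepted R κ z u v = 0 := fun u =>
          le_antisymm (h u ▸ X.accepted_le_offer R κ z u v) (X.accepted_nonneg R κ z u v)
        simp only [e, zero_add, le_refl]
    linarith
  · intro u v hne
    by_cases hcr : X.Crucial R κ u v
    · have hf : X.flow R κ ε z u v = 0 := by
        simp [flow, coef, show ¬ X.Good R κ ε u v from fun h => h.1 hcr]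
      rw [hf, add_zero] at hne
      rcases X.usable_eq R κ z u v with h | ⟨-, ho, hc⟩
      · exact absurd (by simp [accepted, h]) hne
      · refine ⟨hc, fun _ => ?_, fun h => absurd hcr h⟩
        simpa [offer, hcr] using ho
    · have ha : X.accepted R κ z u v = 0 :=
        le_antisymm ((X.accepted_le_offer R κ z u v).trans (by simp [offer, hcr]))
          (X.accepted_nonneg R κ z u v)
      rw [ha, zero_add, flow] at hne
      refine ⟨fun h => hne (by simp [h]), fun h => absurd h hcr, fun _ => ?_⟩
      exact (X.ξ_eq z.2.1 u v).resolve_left fun h => hne (by simp [h])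

/-! ### Expected excess and the second lower bound -/

variable {ε}

theorem sum_flow_row (z : (Fin R → S) × S × (U → S)) (u : U) :
    ∑ v, X.flow R κ ε z u v = X.idle R κ z.2.2 u * X.rowLoad R κ ε z u := by
  rw [rowLoad, Finset.mul_sum]
  exact Finset.sum_congr rfl fun v _ => by rw [flow]; ring

theorem sum_flow_col (z : (Fin R → S) × S × (U → S)) (v : V) :
    ∑ u, X.flow R κ ε z u v = X.vacant R κ z.2.2 v * X.colLoad R κ ε z v := by
  rw [colLoad, Finset.mul_sum]
  exact Finset.sum_congr rfl fun u _ => by rw [flow]; ring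

/-- The part of a load that exceeds `1`, where the load is present only if the indicator `a`
is `1`. -/
theorem excess_mul_le {a Y m δ : ℝ} (ha : a = 0 ∨ a = 1) (hδ : 0 < δ) (hm : m ≤ 1)
    (hY : 0 ≤ a * Y) : max (a * Y - 1) 0 ≤ δ * (a * Y) + (Y - m) ^ 2 / (4 * δ) := by
  rcases ha with rfl | rfl
  · have : 0 ≤ (Y - m) ^ 2 / (4 * δ) := by positivity
    simpa using this
  · rw [one_mul] at hY ⊢
    exact excess_le hδ hm hY

theorem sum_div_row_le (u : U) : ∑ v, X.xg R κ ε u v / (1 - X.rowMass R κ u) ≤ 1 := by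
  rw [← Finset.sum_div]
  exact div_le_one_of_le₀ (X.sum_xg_row_le R κ ε u) (sub_nonneg.2 (X.rowMass_le_one R κ u))

theorem sum_div_col_le (v : V) : ∑ u, X.xg R κ ε u v / X.vacancy R κ v ≤ 1 := by
  rw [← Finset.sum_div]
  exact div_le_one_of_le₀ ((X.sum_xg_col_le R κ ε v).trans (X.one_sub_colMass_le_vacancy R κ v))
    (X.vacancy_nonneg v)

/-- `excess_mul_le` is applied with `δ = ε` and the mean load as `m`; the linear term is the mean
flow, the quadratic one is the variance. -/
theorem expect_excess_row [DecidableEq U] [DecidableEq V] (hR : 0 < R) (hε : 0 < ε) (u : U) :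
    expect (X.joint R) (fun z => max (∑ v, X.flow R κ ε z u v - 1) 0) ≤
      (ε + (1 + κ) / (R * X.p * ε ^ 3) / (4 * ε)) * ∑ v, X.xg R κ ε u v := by
  have h1 : ∀ z, max (∑ v, X.flow R κ ε z u v - 1) 0 ≤ ε * ∑ v, X.flow R κ ε z u v +
      1 / (4 * ε) * (X.rowLoad R κ ε z u - ∑ v, X.xg R κ ε u v / (1 - X.rowMass R κ u)) ^ 2 := by
    intro z
    have := X.sum_flow_row (ε := ε) z u ▸
      Finset.sum_nonneg fun v (_ : v ∈ Finset.univ) => X.flow_nonneg R κ ε z u v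
    rw [X.sum_flow_row, one_div, ← div_eq_inv_mul]
    exact excess_mul_le ((X.idle_eq R κ z.2.2 u).imp id And.left) hε (X.sum_div_row_le u) this
  refine ((X.joint_isProbWeight R).expect_mono h1).trans ?_
  rw [expect_add, expect_const_mul, expect_const_mul, expect_sum]
  simp only [X.expect_flow hR hε]
  have h2 := mul_le_mul_of_nonneg_left (X.expect_rowLoad (κ := κ) hR hε u)
    (show 0 ≤ 1 / (4 * ε) by positivity)
  refine (add_le_add_right h2 _).trans (le_of_eq ?_)
  ring

theorem expect_excess_col [DecidableEq U] (hR : 0 < R) (hε : 0 < ε) (v : V) :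
    expect (X.joint R) (fun z => max (∑ u, X.flow R κ ε z u v - 1) 0) ≤
      (ε + (1 + κ) / (R * X.p * ε ^ 3) / (4 * ε)) * ∑ u, X.xg R κ ε u v := by
  have h1 : ∀ z, max (∑ u, X.flow R κ ε z u v - 1) 0 ≤ ε * ∑ u, X.flow R κ ε z u v +
      1 / (4 * ε) * (X.colLoad R κ ε z v - ∑ u, X.xg R κ ε u v / X.vacancy R κ v) ^ 2 := by
    intro z
    have := X.sum_flow_col (ε := ε) z v ▸
      Finset.sum_nonneg fun u (_ : u ∈ Finset.univ) => X.flow_nonneg R κ ε z u v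
    rw [X.sum_flow_col, one_div, ← div_eq_inv_mul]
    refine excess_mul_le ?_ hε (X.sum_div_col_le v) this
    exact (X.vacant_eq R κ z.2.2 v).imp And.left And.left
  refine ((X.joint_isProbWeight R).expect_mono h1).trans ?_
  rw [expect_add, expect_const_mul, expect_const_mul, expect_sum]
  simp only [X.expect_flow hR hε]
  have h2 := mul_le_mul_of_nonneg_left (X.expect_colLoad (κ := κ) hR hε v)
    (show 0 ≤ 1 / (4 * ε) by positivity)
  refine (add_le_add_right h2 _).trans (le_of_eq ?_)
  ring

/-- Crucial pairs are rarely missed. -/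
theorem xc_mul_pow_le (hκ : Real.exp (-κ) ≤ ε) (u : U) (v : V) :
    X.xc R κ u v * (1 - X.x u v) ^ R ≤ ε * X.xc R κ u v := by
  unfold xc
  split_ifs with h
  · rw [mul_comm]
    refine mul_le_mul_of_nonneg_right ?_ (X.x_nonneg u v)
    have h1 : X.x u v ≤ 1 := (Finset.single_le_sum (f := fun v => X.x u v)
      (fun v _ => X.x_nonneg u v) (Finset.mem_univ v)).trans (X.sum_x_row_le u)
    calc (1 - X.x u v) ^ R ≤ Real.exp (-X.x u v) ^ R := by
          refine pow_le_pow_left₀ (by linarith) ?_ R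
          linarith [Real.add_one_le_exp (-X.x u v)]
      _ = Real.exp (-(R * X.x u v)) := by rw [← Real.exp_nat_mul]; congr 1; ring
      _ ≤ Real.exp (-κ) := Real.exp_le_exp.2 (neg_le_neg h)
      _ ≤ ε := hκ
  · simp

/-- At a discarded vertex the crucial mass exceeds `1 - ε ≥ 1 / 2`. The noncrucial mass there is
below `ε`, hence at most `2 * ε` times the crucial mass. The two sides of the graph together lose `4
* ε` times the crucial mass. -/
theorem sum_xg_ge (hε : 0 < ε) (hε2 : ε ≤ 1 / 2) :
    ∑ u, ∑ v, (X.x u v - X.xc R κ u v) - 4 * ε * ∑ u, ∑ v, X.xc R κ u v ≤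
      ∑ u, ∑ v, X.xg R κ ε u v := by
  classical
  have hd : ∀ u v, 0 ≤ X.x u v - X.xc R κ u v := fun u v => sub_nonneg.2 (X.xc_le R κ u v)
  have hpt : ∀ u v, X.x u v - X.xc R κ u v - X.xg R κ ε u v ≤
      (if 1 - ε < X.rowMass R κ u then X.x u v - X.xc R κ u v else 0) +
      (if 1 - ε < X.colMass R κ v then X.x u v - X.xc R κ u v else 0) := by
    intro u v
    have h0 := hd u v
    by_cases hcr : X.Crucial R κ u v
    · have e1 : X.xc R κ u v = X.x u v := by simp [xc, hcr]
      have e2 : X.xg R κ ε u v = 0 := by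
        simp [xg, show ¬ X.Good R κ ε u v from fun h => h.1 hcr]
      simp [e1, e2]
    · by_cases h1 : 1 - ε < X.rowMass R κ u
      · rw [if_pos h1]
        have := X.xg_nonneg R κ ε u v
        split_ifs <;> linarith
      · by_cases h2 : 1 - ε < X.colMass R κ v
        · rw [if_pos h2, if_neg h1]
          have := X.xg_nonneg R κ ε u v
          linarith
        · have e1 : X.xc R κ u v = 0 := by simp [xc, hcr]
          have e2 : X.xg R κ ε u v = X.x u v := by
            simp [xg, show X.Good R κ ε u v from ⟨hcr, not_lt.1 h1, not_lt.1 h2⟩]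
          simp [e1, e2, h1, h2]
  have hrow : ∑ u, ∑ v, (if 1 - ε < X.rowMass R κ u then X.x u v - X.xc R κ u v else 0) ≤
      2 * ε * ∑ u, ∑ v, X.xc R κ u v := by
    rw [Finset.mul_sum]
    refine Finset.sum_le_sum fun u _ => ?_
    change _ ≤ 2 * ε * X.rowMass R κ u
    split_ifs with h
    · rw [Finset.sum_sub_distrib]
      change ∑ v, X.x u v - X.rowMass R κ u ≤ _
      nlinarith [X.sum_x_row_le u]
    · simpa using mul_nonneg (by positivity) (X.rowMass_nonneg R κ u)
  have hcol : ∑ u, ∑ v, (if 1 - ε < X.colMass R κ v then X.x u v - X.xc R κ u v else 0) ≤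
      2 * ε * ∑ u, ∑ v, X.xc R κ u v := by
    rw [Finset.sum_comm, Finset.sum_comm (f := fun u v => X.xc R κ u v), Finset.mul_sum]
    refine Finset.sum_le_sum fun v _ => ?_
    change _ ≤ 2 * ε * X.colMass R κ v
    split_ifs with h
    · rw [Finset.sum_sub_distrib]
      change ∑ u, X.x u v - X.colMass R κ v ≤ _
      nlinarith [X.sum_x_col_le v]
    · simpa using mul_nonneg (by positivity) (X.colMass_nonneg R κ v)
  have := Finset.sum_le_sum fun u (_ : u ∈ Finset.univ) =>
    Finset.sum_le_sum fun v (_ : v ∈ Finset.univ) => hpt u v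
  simp only [Finset.sum_add_distrib, Finset.sum_sub_distrib] at this ⊢
  linarith

/-- With X, C and G for the sums of `x`, `xc` and `xg`: proposals yield (1 - 1/e)C minus εC for
missed pairs, the flow yields G ≥ X - C - 4εC, and the excess on both sides costs at most 3εG ≤ 3ε(X
- C). The total error 3εX + 2εC is at most 5εX. -/
theorem Dominates.le_expect [DecidableEq U] [DecidableEq V] {X : MatchingModel S U V}
    {q : (Fin R → S) × S × (U → S) → ℝ} (hq : X.Dominates R κ q) (hR : 0 < R) (hε : 0 < ε)
    (hε2 : ε ≤ 1 / 2) (hκ : Real.exp (-κ) ≤ ε) (hRp : (1 + κ) / (R * X.p) ≤ 2 * ε ^ 5) :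
    (1 - 5 * ε) * ∑ u, ∑ v, X.x u v - Real.exp (-1) * ∑ u, ∑ v, X.xc R κ u v ≤
      expect (X.joint R) q := by
  have hP := X.joint_isProbWeight R
  have h1 := hP.expect_mono (hq.le ε)
  rw [expect_sub, expect_sub, expect_add, expect_sub] at h1
  have e1 : expect (X.joint R) (fun z => ∑ v, (1 - X.vacant R κ z.2.2 v)) =
      ∑ v, (1 - X.vacancy R κ v) := by
    rw [expect_sum]
    refine Finset.sum_congr rfl fun v _ => ?_
    have := expect_triple_mul (wt := piWeight (Fin R) X.wt) (wt' := X.wt)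
      (wt'' := piWeight U X.wt) (fun _ => 1) (fun _ => 1) (fun h => X.vacant R κ h v)
    simp only [one_mul, X.prob.expect_const, X.prob.pi.expect_const, expect_vacant] at this
    rw [expect_sub, hP.expect_const, joint, this]
  have e2 : expect (X.joint R) (fun z => ∑ u, ∑ v, X.offer R κ (z.2.2 u) u v * X.missed z.1 u v) ≤
      ε * ∑ u, ∑ v, X.xc R κ u v := by
    rw [expect_sum, Finset.mul_sum]
    refine Finset.sum_le_sum fun u _ => ?_
    rw [expect_sum, Finset.mul_sum]
    refine Finset.sum_le_sum fun v _ => ?_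
    have := expect_triple_mul (wt := piWeight (Fin R) X.wt) (wt' := X.wt)
      (wt'' := piWeight U X.wt) (fun t => X.missed t u v) (fun _ => 1)
      (fun h => X.offer R κ (h u) u v)
    simp only [mul_one, X.prob.expect_const, expect_missed,
      X.prob.expect_pi_eval u (fun s => X.offer R κ s u v), expect_offer] at this
    simp only [mul_comm (X.offer R κ _ u v)]
    rw [joint, this, mul_comm]
    exact X.xc_mul_pow_le hκ u v
  have e3 : expect (X.joint R) (fun z => ∑ u, ∑ v, X.flow R κ ε z u v) =
      ∑ u, ∑ v, X.xg R κ ε u v := by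
    rw [expect_sum]
    refine Finset.sum_congr rfl fun u _ => ?_
    rw [expect_sum]
    exact Finset.sum_congr rfl fun v _ => X.expect_flow hR hε u v
  set η := ε + (1 + κ) / (R * X.p * ε ^ 3) / (4 * ε) with hη
  have e4 : expect (X.joint R) (fun z => ∑ u, max (∑ v, X.flow R κ ε z u v - 1) 0) ≤
      η * ∑ u, ∑ v, X.xg R κ ε u v := by
    rw [expect_sum, Finset.mul_sum]
    exact Finset.sum_le_sum fun u _ => X.expect_excess_row hR hε u
  have e5 : expect (X.joint R) (fun z => ∑ v, max (∑ u, X.flow R κ ε z u v - 1) 0) ≤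
      η * ∑ u, ∑ v, X.xg R κ ε u v := by
    rw [expect_sum, Finset.sum_comm (f := fun u v => X.xg R κ ε u v), Finset.mul_sum]
    exact Finset.sum_le_sum fun v _ => X.expect_excess_col hR hε v
  -- The variance bound divides by `ε ^ 3` and the excess estimate by `4 * ε`; the bound `2 * ε ^ 5`
  -- in `hRp` leaves `ε / 2`.
  have hη2 : η ≤ 3 / 2 * ε := by
    have hp := X.p_pos
    have hR' : (0 : ℝ) < R := by exact_mod_cast hR
    have : (1 + κ) / (R * X.p * ε ^ 3) / (4 * ε) = (1 + κ) / (R * X.p) * (1 / (4 * ε ^ 4)) := by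
      field_simp
    rw [hη, this]
    have h2 := mul_le_mul_of_nonneg_right hRp (show 0 ≤ 1 / (4 * ε ^ 4) by positivity)
    have h3 : 2 * ε ^ 5 * (1 / (4 * ε ^ 4)) = ε / 2 := by
      field_simp
      norm_num
    linarith
  have e6 : (1 - Real.exp (-1)) * ∑ u, ∑ v, X.xc R κ u v ≤ ∑ v, (1 - X.vacancy R κ v) := by
    rw [Finset.sum_comm, Finset.mul_sum]
    exact Finset.sum_le_sum fun v _ => X.colMass_mul_le R κ v
  have e7 := X.sum_xg_ge (R := R) (κ := κ) hε hε2
  have e8 : ∑ u, ∑ v, X.xg R κ ε u v ≤ ∑ u, ∑ v, X.x u v - ∑ u, ∑ v, X.xc R κ u v := by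
    rw [← Finset.sum_sub_distrib]
    refine Finset.sum_le_sum fun u _ => ?_
    rw [← Finset.sum_sub_distrib]
    exact Finset.sum_le_sum fun v _ => by linarith [X.xg_add_xc_le R κ ε u v]
  have hg0 : 0 ≤ ∑ u, ∑ v, X.xg R κ ε u v :=
    Finset.sum_nonneg fun u _ => Finset.sum_nonneg fun v _ => X.xg_nonneg R κ ε u v
  have hc0 : 0 ≤ ∑ u, ∑ v, X.xc R κ u v :=
    Finset.sum_nonneg fun u _ => Finset.sum_nonneg fun v _ => X.xc_nonneg R κ u v
  simp only [Finset.sum_sub_distrib] at e7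
  rw [e1, e3] at h1
  have h5 := mul_le_mul_of_nonneg_right hη2 hg0
  have h6 := mul_le_mul_of_nonneg_left e8 hε.le
  have h7 := mul_nonneg hε.le hc0
  nlinarith

end MatchingModel

/-! ### Mixtures of independent realizations -/

theorem expect_triple {S S' S'' : Type*} [Fintype S] [Fintype S'] [Fintype S''] (wt : S → ℝ)
    (wt' : S' → ℝ) (wt'' : S'' → ℝ) (f : S → S' → S'' → ℝ) :
    expect (tripleWeight wt wt' wt'') (fun z => f z.1 z.2.1 z.2.2) =
      expect wt fun t => expect wt' fun s => expect wt'' fun h => f t s h := by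
  simp only [expect, tripleWeight, Fintype.sum_prod_type, Finset.mul_sum]
  refine Finset.sum_congr rfl fun _ _ => Finset.sum_congr rfl fun _ _ =>
    Finset.sum_congr rfl fun _ _ => by ring

/-- The coordinates `e` of `s`, or of `h u` if `sel e = some u`. -/
def mixture {ι U B : Type*} (sel : ι → Option U) (s : ι → B) (h : U → ι → B) : ι → B :=
  fun e => (sel e).elim (s e) fun u => h u e

theorem prod_mixture {ι U B : Type*} [Fintype ι] [Fintype U] [DecidableEq U]
    (sel : ι → Option U) (s : ι → B) (h : U → ι → B) (g : ι → B → ℝ) :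
    ∏ e, g e (mixture sel s h e) = (∏ e, if sel e = none then g e (s e) else 1) *
      ∏ u, ∏ e, if sel e = some u then g e (h u e) else 1 := by
  rw [Finset.prod_comm, ← Finset.prod_mul_distrib]
  refine Finset.prod_congr rfl fun e _ => ?_
  unfold mixture
  cases sel e with
  | none => simp
  | some u => simp

/-- A mixture of independent realizations is distributed like a realization. -/
theorem expect_mixture {ι U B : Type*} [Fintype ι] [DecidableEq ι] [Fintype U] [DecidableEq U]
    [Fintype B] [DecidableEq B] {w : B → ℝ} (hw : IsProbWeight w) (sel : ι → Option U)
    (f : (ι → B) → ℝ) :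
    (expect (piWeight ι w) fun s => expect (piWeight U (piWeight ι w)) fun h =>
      f (mixture sel s h)) = expect (piWeight ι w) f := by
  -- For products over the coordinates the claim is independence: each coordinate is read from
  -- exactly one source.
  have key : ∀ g : ι → B → ℝ, (expect (piWeight ι w) fun s =>
      expect (piWeight U (piWeight ι w)) fun h => ∏ e, g e (mixture sel s h e)) =
      expect (piWeight ι w) fun s => ∏ e, g e (s e) := by
    intro g
    simp only [prod_mixture, expect_const_mul]
    have h1 : ∀ u : U, expect (piWeight ι w)
        (fun s => ∏ e, if sel e = some u then g e (s e) else 1) =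
        ∏ e, if sel e = some u then expect w (g e) else 1 := by
      intro u
      rw [expect_pi_prod (wt := w) fun e b => if sel e = some u then g e b else 1]
      refine Finset.prod_congr rfl fun e _ => ?_
      split_ifs
      exacts [rfl, hw.expect_const 1]
    have h2 : expect (piWeight ι w)
        (fun s => ∏ e, if sel e = none then g e (s e) else 1) =
        ∏ e, if sel e = none then expect w (g e) else 1 := by
      rw [expect_pi_prod (wt := w) fun e b => if sel e = none then g e b else 1]
      refine Finset.prod_congr rfl fun e _ => ?_
      split_ifs
      exacts [rfl, hw.expect_const 1]
    have h3 := expect_pi_prod (wt := piWeight ι w) (ι := U)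
      fun u s => ∏ e, if sel e = some u then g e (s e) else 1
    rw [h3]
    simp only [h1]
    simp only [mul_comm _ (∏ u : U, ∏ e, _)]
    -- The factors, now constants, are collected by `prod_mixture` read backwards with trivial
    -- realizations.
    rw [expect_const_mul, h2, mul_comm,
      ← prod_mixture sel (fun _ => ()) (fun _ _ => ()) fun e _ => expect w (g e),
      expect_pi_prod]
  -- Every function is a combination of point indicators, and these are products.
  have hf : ∀ y, f y = ∑ r, f r * ∏ e, if y e = r e then 1 else 0 := by
    intro y
    rw [Finset.sum_eq_single y]
    · simp
    · intro r _ hr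
      obtain ⟨e, he⟩ := Function.ne_iff.1 hr
      rw [Finset.prod_eq_zero (Finset.mem_univ e) (if_neg (Ne.symm he)), mul_zero]
    · simp
  calc _ = expect (piWeight ι w) fun s => expect (piWeight U (piWeight ι w)) fun h =>
        ∑ r, f r * ∏ e, if mixture sel s h e = r e then 1 else 0 := by
        congr 1; funext s; congr 1; funext h; exact hf _
    _ = ∑ r, f r * expect (piWeight ι w) fun s => ∏ e, if s e = r e then 1 else 0 := by
        simp only [expect_sum, expect_const_mul]
        refine Finset.sum_congr rfl fun r _ => ?_
        rw [key fun e b => if b = r e then 1 else 0]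
    _ = _ := by
        simp only [← expect_const_mul, ← expect_sum]
        congr 1; funext s; exact (hf s).symm

/-! ### Realizations of bipartite graphs -/

/-- The weights of a `p`-biased bit. -/
noncomputable def bitWeight (p : ℝ) : Bool → ℝ := fun b => if b then p else 1 - p

theorem isProbWeight_bitWeight {p : ℝ} (h0 : 0 ≤ p) (h1 : p ≤ 1) : IsProbWeight (bitWeight p) := by
  refine ⟨fun b => ?_, by simp [bitWeight]⟩
  cases b
  · simpa [bitWeight] using h1
  · simpa [bitWeight] using h0

/-- A fractional matching of a bipartite graph, in which loads that exceed `1` count negatively, is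
not larger than the matching number. -/
theorem ColoredBy.sum_le_matchingNumber {n : ℕ} {H : Finset (Sym2 (Fin n))} {c : Fin n → Bool}
    (hc : ColoredBy c H) (w : Fin n → Fin n → ℝ) (hw : ∀ u v, 0 ≤ w u v)
    (hs : ∀ u v, w u v ≠ 0 → c u = false ∧ s(u, v) ∈ H) :
    ∑ u, ∑ v, w u v ≤ matchingNumber H + ∑ u, max (∑ v, w u v - 1) 0 +
      ∑ v, max (∑ u, w u v - 1) 0 := by
  classical
  obtain ⟨C, hC, hcard⟩ := hc.exists_cover
  have h1 : ∀ u v, w u v ≤ (if u ∈ C then w u v else 0) + if v ∈ C then w u v else 0 := by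
    intro u v
    by_cases h0 : w u v = 0
    · simp [h0]
    · have := hw u v
      rcases hC u v (hs u v h0).2 with h | h
      · rw [if_pos h]; split_ifs <;> linarith
      · rw [if_pos h]; split_ifs <;> linarith
  have h2 : ∑ u, ∑ v, w u v ≤ ∑ u ∈ C, (∑ v, w u v + ∑ v, w v u) := by
    refine (Finset.sum_le_sum fun u _ => Finset.sum_le_sum fun v _ => h1 u v).trans (le_of_eq ?_)
    simp only [Finset.sum_add_distrib]
    congr 1
    · rw [← Finset.sum_filter_add_sum_filter_not Finset.univ (fun u => u ∈ C)]
      rw [Finset.sum_congr rfl fun u hu => Finset.sum_congr rfl fun v _ =>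
        if_pos (Finset.mem_filter.1 hu).2]
      rw [Finset.sum_congr (s₁ := Finset.univ.filter fun u => u ∉ C) rfl fun u hu =>
        Finset.sum_eq_zero fun v _ => if_neg (Finset.mem_filter.1 hu).2]
      simp
    · rw [Finset.sum_comm, ← Finset.sum_filter_add_sum_filter_not Finset.univ (fun u => u ∈ C)]
      rw [Finset.sum_congr rfl fun u hu => Finset.sum_congr rfl fun v _ =>
        if_pos (Finset.mem_filter.1 hu).2]
      rw [Finset.sum_congr (s₁ := Finset.univ.filter fun u => u ∉ C) rfl fun u hu =>
        Finset.sum_eq_zero fun v _ => if_neg (Finset.mem_filter.1 hu).2]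
      simp
  -- A vertex of the first class has no incoming weight and one of the second no outgoing weight, so
  -- a vertex of the cover carries at most `1` plus a single excess.
  have h3 : ∀ u, ∑ v, w u v + ∑ v, w v u ≤
      1 + (max (∑ v, w u v - 1) 0 + max (∑ v, w v u - 1) 0) := by
    intro u
    have a1 := le_max_left (∑ v, w u v - 1) 0
    have a2 := le_max_left (∑ v, w v u - 1) 0
    have b1 := le_max_right (∑ v, w u v - 1) 0
    have b2 := le_max_right (∑ v, w v u - 1) 0
    cases hu : c u with
    | false =>
      have : ∑ v, w v u = 0 := Finset.sum_eq_zero fun v _ => by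
        by_contra hne
        have := hs v u hne
        exact hc v u this.2 (this.1.trans hu.symm)
      linarith
    | true =>
      have : ∑ v, w u v = 0 := Finset.sum_eq_zero fun v _ => by
        by_contra hne
        have := (hs u v hne).1
        simp [hu] at this
      linarith
  have h4 : ∑ u ∈ C, (max (∑ v, w u v - 1) 0 + max (∑ v, w v u - 1) 0) ≤
      ∑ u, (max (∑ v, w u v - 1) 0 + max (∑ v, w v u - 1) 0) :=
    Finset.sum_le_univ_sum_of_nonneg fun u =>
      add_nonneg (le_max_right _ _) (le_max_right _ _)
  have h5 := Finset.sum_le_sum fun u (_ : u ∈ C) => h3 u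
  rw [Finset.sum_add_distrib (f := fun _ => (1 : ℝ))] at h5
  rw [Finset.sum_add_distrib (s := Finset.univ)] at h4
  simp only [Finset.sum_const, nsmul_eq_mul, mul_one] at h5
  have h6 : (C.card : ℝ) ≤ matchingNumber H := by exact_mod_cast hcard
  linarith

/-! ### Coupling proposals with one realization of the graph -/

section Graph

variable {n : ℕ} {E : Finset (Sym2 (Fin n))} {c : Fin n → Bool} {p : ℝ}

theorem thinMatching_mem {r : Sym2 (Fin n) → Bool} {e : Sym2 (Fin n)}
    (h : e ∈ thinMatching n (realized E r)) : e ∈ E ∧ r e = true :=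
  Finset.mem_filter.1 ((isMaximumMatchingOf_thinMatching _).1.1 h)

/-- The random matching of the realizations of a bipartite graph. -/
noncomputable def graphModel (E : Finset (Sym2 (Fin n))) (c : Fin n → Bool)
    (hp : 0 < p) (hp1 : p ≤ 1) : MatchingModel (Sym2 (Fin n) → Bool) (Fin n) (Fin n) where
  wt := piWeight (Sym2 (Fin n)) (bitWeight p)
  m r u v := if c u = false ∧ s(u, v) ∈ thinMatching n (realized E r) then 1 else 0
  ξ r u v := if r s(u, v) = true then 1 else 0
  p := p
  prob := (isProbWeight_bitWeight hp.le hp1).pi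
  m_eq r u v := by split_ifs <;> simp
  row_le r u := by
    rw [Finset.sum_boole]
    refine Nat.cast_le_one.2 (Finset.card_le_one.2 fun v hv v' hv' => ?_)
    simp only [Finset.mem_filter, Finset.mem_univ, true_and] at hv hv'
    have := (isMaximumMatchingOf_thinMatching (realized E r)).1.2 _ hv.2 _ hv'.2 u (by simp)
      (by simp)
    exact Sym2.congr_right.1 this
  col_le r v := by
    rw [Finset.sum_boole]
    refine Nat.cast_le_one.2 (Finset.card_le_one.2 fun u hu u' hu' => ?_)
    simp only [Finset.mem_filter, Finset.mem_univ, true_and] at hu hu'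
    have := (isMaximumMatchingOf_thinMatching (realized E r)).1.2 _ hu.2 _ hu'.2 v (by simp)
      (by simp)
    exact Sym2.congr_left.1 this
  ξ_eq r u v := by split_ifs <;> simp
  p_pos := hp
  expect_ξ u v := by
    rw [(isProbWeight_bitWeight hp.le hp1).expect_pi_eval s(u, v)
      fun b => if b = true then 1 else 0]
    simp [expect, bitWeight]
  expect_ξ_row u v v' h := by
    rw [(isProbWeight_bitWeight hp.le hp1).expect_pi_eval_mul (i := s(u, v)) (j := s(u, v'))
      (fun h' => h (Sym2.congr_right.1 h')) (fun b => if b = true then 1 else 0)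
      fun b => if b = true then 1 else 0]
    simp [expect, bitWeight]
  expect_ξ_col u u' v h := by
    rw [(isProbWeight_bitWeight hp.le hp1).expect_pi_eval_mul (i := s(u, v)) (j := s(u', v))
      (fun h' => h (Sym2.congr_left.1 h')) (fun b => if b = true then 1 else 0)
      fun b => if b = true then 1 else 0]
    simp [expect, bitWeight]

variable (hp : 0 < p) (hp1 : p ≤ 1)

theorem graphModel_m_eq_one {r : Sym2 (Fin n) → Bool} {u v : Fin n}
    (h : (graphModel E c hp hp1).m r u v ≠ 0) :
    c u = false ∧ s(u, v) ∈ thinMatching n (realized E r) := by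
  by_contra hcon
  exact h (if_neg hcon)

theorem graphModel_count {R : ℕ} {t : Fin R → Sym2 (Fin n) → Bool} {u v : Fin n}
    (h : (graphModel E c hp hp1).count t u v ≠ 0) :
    c u = false ∧ s(u, v) ∈ unionOfMatchings thinMatching E t := by
  obtain ⟨i, -, hi⟩ := Finset.exists_ne_zero_of_sum_ne_zero h
  have := graphModel_m_eq_one hp hp1 hi
  exact ⟨this.1, Finset.mem_biUnion.2 ⟨i, Finset.mem_univ i, this.2⟩⟩

/-- As `κ` is positive, a crucial pair has positive probability, so it is an edge oriented from the
first color class. -/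
theorem graphModel_crucial {R : ℕ} {κ : ℝ} (hκ : 0 < κ) {u v : Fin n}
    (h : (graphModel E c hp hp1).Crucial R κ u v) : c u = false ∧ s(u, v) ∈ E := by
  by_contra hcon
  have h0 : ∀ r, (graphModel E c hp hp1).m r u v = 0 := fun r => by
    by_contra hne
    have := graphModel_m_eq_one hp hp1 hne
    exact hcon ⟨this.1, (thinMatching_mem this.2).1⟩
  unfold MatchingModel.Crucial MatchingModel.x at h
  simp only [h0, (graphModel E c hp hp1).prob.expect_const, mul_zero] at h
  linarith

theorem unionOfMatchings_subset {R : ℕ} (t : Fin R → Sym2 (Fin n) → Bool) :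
    unionOfMatchings thinMatching E t ⊆ E :=
  Finset.biUnion_subset.2 fun _ _ _ he => (thinMatching_mem he).1

/-- The indicator `m` counts each edge of the matching in only one orientation, so its total is the
size of a maximum matching of the realization. -/
theorem sum_graphModel_x (hc : ColoredBy c E) :
    ∑ u, ∑ v, (graphModel E c hp hp1).x u v =
      expect (piWeight (Sym2 (Fin n)) (bitWeight p))
        fun r => (matchingNumber (realized E r) : ℝ) := by
  unfold MatchingModel.x
  simp only [← expect_sum]
  change expect (piWeight (Sym2 (Fin n)) (bitWeight p)) _ = _
  congr 1
  funext r
  have hM := isMaximumMatchingOf_thinMatching (realized E r)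
  have hc' : ColoredBy c (thinMatching n (realized E r)) :=
    hc.mono fun e he => (thinMatching_mem he).1
  rw [← hM.2, ← hc'.card_oriented, ← Finset.sum_boole, Fintype.sum_prod_type]
  rfl

open Classical in
/-- The end in the first color class of a crucial edge. -/
noncomputable def proposer (E : Finset (Sym2 (Fin n))) (c : Fin n → Bool) (hp : 0 < p)
    (hp1 : p ≤ 1) (R : ℕ) (κ : ℝ) (e : Sym2 (Fin n)) : Option (Fin n) :=
  if h : ∃ u v, e = s(u, v) ∧ (graphModel E c hp hp1).Crucial R κ u v then some h.choose else none

/-- Crucial pairs start in the first color class, so an edge is crucial in at most one orientation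
and the chosen end must be `u`. -/
theorem proposer_eq (hc : ColoredBy c E) {R : ℕ} {κ : ℝ} (hκ : 0 < κ) {u v : Fin n}
    (h : (graphModel E c hp hp1).Crucial R κ u v) :
    proposer E c hp hp1 R κ s(u, v) = some u := by
  have hex : ∃ u' v', s(u, v) = s(u', v') ∧ (graphModel E c hp hp1).Crucial R κ u' v' :=
    ⟨u, v, rfl, h⟩
  rw [proposer, dif_pos hex]
  obtain ⟨v', he, h'⟩ := hex.choose_spec
  have h1 := graphModel_crucial hp hp1 hκ h
  have h2 := graphModel_crucial hp hp1 hκ h'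
  rcases Sym2.eq_iff.1 he with ⟨e1, -⟩ | ⟨-, e2⟩
  · rw [← e1]
  · exact absurd (h1.1.trans (show c v = false by rw [e2]; exact h2.1).symm) (hc u v h1.2)

theorem proposer_eq_none (hc : ColoredBy c E) {R : ℕ} {κ : ℝ} (hκ : 0 < κ) {u v : Fin n}
    (hcu : c u = false) (huv : s(u, v) ∈ E) (h : ¬ (graphModel E c hp hp1).Crucial R κ u v) :
    proposer E c hp hp1 R κ s(u, v) = none := by
  refine dif_neg ?_
  rintro ⟨u', v', he, h'⟩
  have h2 := graphModel_crucial hp hp1 hκ h'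
  rcases Sym2.eq_iff.1 he with ⟨rfl, rfl⟩ | ⟨rfl, rfl⟩
  · exact h h'
  · exact hc u v huv (hcu.trans h2.1.symm)

/-- The expected matching number of the realized queries. -/
noncomputable def expectedValue (E : Finset (Sym2 (Fin n))) (p : ℝ) (R : ℕ) : ℝ :=
  expect (piWeight (Fin R) (piWeight (Sym2 (Fin n)) (bitWeight p))) fun t =>
    expect (piWeight (Sym2 (Fin n)) (bitWeight p)) fun r =>
      (matchingNumber (realized (unionOfMatchings thinMatching E t) r) : ℝ)

/-- The mixture satisfies both support conditions of `Dominates`: a proposal of `u` is an edge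
realized in `h u`, which is where crucial edges of `u` are read; the other edges are read from the
realization behind `ξ`. -/
theorem graphModel_dominates (hc : ColoredBy c E) (R : ℕ) {κ : ℝ} (hκ : 0 < κ) :
    (graphModel E c hp hp1).Dominates R κ fun z =>
      (matchingNumber (realized (unionOfMatchings thinMatching E z.1)
        (mixture (proposer E c hp hp1 R κ) z.2.1 z.2.2)) : ℝ) := by
  intro z w hw hs
  refine ColoredBy.sum_le_matchingNumber (c := c) (hc.mono ((Finset.filter_subset _ _).trans
    (unionOfMatchings_subset _))) w hw fun u v hne => ?_
  obtain ⟨h1, h2, h3⟩ := hs u v hne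
  have h4 := graphModel_count hp hp1 h1
  refine ⟨h4.1, Finset.mem_filter.2 ⟨h4.2, ?_⟩⟩
  by_cases hcr : (graphModel E c hp hp1).Crucial R κ u v
  · simp only [mixture, proposer_eq hp hp1 hc hκ hcr, Option.elim]
    have := h2 hcr
    exact (thinMatching_mem (graphModel_m_eq_one hp hp1 (this ▸ one_ne_zero)).2).2
  · simp only [mixture, proposer_eq_none hp hp1 hc hκ h4.1 (unionOfMatchings_subset _ h4.2) hcr,
      Option.elim]
    have := h3 hcr
    by_contra hcon
    simp [graphModel, hcon] at this

/-- This transfers bounds for the artificial model to the algorithm: for fixed samples, the mixture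
is distributed like a single realization. -/
theorem expect_joint_eq (R : ℕ) (κ : ℝ) :
    expect ((graphModel E c hp hp1).joint R) (fun z =>
      (matchingNumber (realized (unionOfMatchings thinMatching E z.1)
        (mixture (proposer E c hp hp1 R κ) z.2.1 z.2.2)) : ℝ)) = expectedValue E p R := by
  unfold MatchingModel.joint
  rw [expect_triple _ _ _ fun t s h => (matchingNumber (realized (unionOfMatchings thinMatching E t)
        (mixture (proposer E c hp hp1 R κ) s h)) : ℝ)]
  unfold expectedValue
  congr 1
  funext t
  exact expect_mixture (isProbWeight_bitWeight hp.le hp1) (proposer E c hp hp1 R κ)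
    fun r => (matchingNumber (realized (unionOfMatchings thinMatching E t) r) : ℝ)

/-- The crucial edges alone. -/
theorem crucial_le_expectedValue (hc : ColoredBy c E) (R : ℕ) {κ ε : ℝ}
    (hκ : Real.exp (-κ) ≤ ε) :
    (1 - ε) * ∑ u, ∑ v, (graphModel E c hp hp1).xc R κ u v ≤ expectedValue E p R := by
  set X := graphModel E c hp hp1 with hX
  have hpt : ∀ (t : Fin R → Sym2 (Fin n) → Bool) (r : Sym2 (Fin n) → Bool),
      ∑ u, ∑ v, (1 - X.missed t u v) * X.offer R κ r u v ≤
        (matchingNumber (realized (unionOfMatchings thinMatching E t) r) : ℝ) := by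
    classical
    intro t r
    -- All proposals are taken from the true realization `r`. They then lie in one matching, so no
    -- two of them compete and no factor `1 - 1/e` is lost.
    let F : Finset (Fin n × Fin n) := Finset.univ.filter fun uv =>
      X.usable R κ (t, r, fun _ => r) uv.1 uv.2 ≠ 0
    have hF : ∀ uv ∈ F, X.count t uv.1 uv.2 ≠ 0 ∧
        s(uv.1, uv.2) ∈ thinMatching n (realized E r) := by
      intro uv huv
      obtain ⟨-, h1, h2⟩ := (X.usable_eq R κ (t, r, fun _ => r) uv.1 uv.2).resolve_left
        (Finset.mem_filter.1 huv).2
      have h3 := X.offer_le R κ r uv.1 uv.2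
      simp only at h1
      rw [h1] at h3
      exact ⟨h2, (graphModel_m_eq_one hp hp1 (by rw [← hX]; linarith)).2⟩
    have hcard : F.card ≤ matchingNumber (realized (unionOfMatchings thinMatching E t) r) := by
      have hM := (isMaximumMatchingOf_thinMatching (realized E r)).1.2
      refine ColoredBy.card_le_of_injOn (c := c) (hc.mono ((Finset.filter_subset _ _).trans
        (unionOfMatchings_subset _))) F (fun uv huv => ?_) ?_ ?_
      · have h1 := hF uv huv
        have h2 := graphModel_count hp hp1 h1.1
        exact ⟨h2.1, Finset.mem_filter.2 ⟨h2.2, (thinMatching_mem h1.2).2⟩⟩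
      · rintro ⟨u, v⟩ ha ⟨u', v'⟩ hb (rfl : u = u')
        have := hM _ (hF _ ha).2 _ (hF _ hb).2 u (by simp) (by simp)
        exact Prod.ext rfl (Sym2.congr_right.1 this)
      · rintro ⟨u, v⟩ ha ⟨u', v'⟩ hb (rfl : v = v')
        have := hM _ (hF _ ha).2 _ (hF _ hb).2 v (by simp) (by simp)
        exact Prod.ext (Sym2.congr_left.1 this) rfl
    refine le_trans (le_of_eq ?_) (Nat.cast_le.2 hcard)
    rw [← Fintype.sum_prod_type', Finset.card_filter, Nat.cast_sum]
    refine Finset.sum_congr rfl fun uv _ => ?_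
    have : (1 - X.missed t uv.1 uv.2) * X.offer R κ r uv.1 uv.2 =
        X.usable R κ (t, r, fun _ => r) uv.1 uv.2 := mul_comm _ _
    rw [this]
    rcases X.usable_eq R κ (t, r, fun _ => r) uv.1 uv.2 with h | ⟨h, -⟩ <;> simp [h]
  have hE := (X.prob.pi (ι := Fin R)).expect_mono fun t =>
    X.prob.expect_mono fun r => hpt t r
  refine le_trans ?_ hE
  simp only [expect_sum, expect_const_mul, X.expect_offer]
  rw [Finset.mul_sum]
  refine Finset.sum_le_sum fun u _ => ?_
  rw [Finset.mul_sum]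
  refine Finset.sum_le_sum fun v _ => ?_
  simp only [mul_comm _ (X.xc R κ u v)]
  rw [expect_const_mul, expect_sub, X.prob.pi.expect_const, X.expect_missed]
  linarith [X.xc_mul_pow_le (R := R) hκ u v]

/-- The approximation guarantee. -/
theorem le_expectedValue (hp : 0 < p) (hp1 : p ≤ 1) (hc : ColoredBy c E) {R : ℕ} {κ ε : ℝ}
    (hR : 0 < R) (hκ0 : 0 < κ) (hε : 0 < ε) (hε2 : ε ≤ 1 / 2) (hκ : Real.exp (-κ) ≤ ε)
    (hRp : (1 + κ) / (R * p) ≤ 2 * ε ^ 5) :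
    (1 - 6 * ε) * (expect (piWeight (Sym2 (Fin n)) (bitWeight p))
        fun r => (matchingNumber (realized E r) : ℝ)) ≤
      (1 + Real.exp (-1)) * expectedValue E p R := by
  have h1 := (graphModel_dominates hp hp1 hc R hκ0).le_expect hR hε hε2 hκ hRp
  rw [expect_joint_eq] at h1
  have h2 := crucial_le_expectedValue hp hp1 hc R hκ
  rw [← sum_graphModel_x hp hp1 hc]
  set X := graphModel E c hp hp1
  have hle : ∑ u, ∑ v, X.xc R κ u v ≤ ∑ u, ∑ v, X.x u v :=
    Finset.sum_le_sum fun u _ => Finset.sum_le_sum fun v _ => X.xc_le R κ u v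
  have h0 : 0 ≤ ∑ u, ∑ v, X.xc R κ u v :=
    Finset.sum_nonneg fun u _ => Finset.sum_nonneg fun v _ => X.xc_nonneg R κ u v
  have he0 : 0 < Real.exp (-1) := Real.exp_pos _
  have he1 : Real.exp (-1) ≤ 1 := Real.exp_le_one_iff.2 (by norm_num)
  -- With weight `exp (-1)` the crucial mass in this bound cancels the loss in `h1`, up to a term
  -- that is at most `ε` times the total mass.
  have h3 := mul_le_mul_of_nonneg_left h2 he0.le
  have h4 : ε * (Real.exp (-1) * ∑ u, ∑ v, X.xc R κ u v) ≤ ε * ∑ u, ∑ v, X.x u v := by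
    refine mul_le_mul_of_nonneg_left ?_ hε.le
    nlinarith
  nlinarith

end Graph

/-! ### The laws of the realizations and of the tape -/

section Laws

variable {n : ℕ}

instance (n : ℕ) (p : unitInterval) : IsProbabilityMeasure (realizationLaw n p) := by
  unfold realizationLaw; infer_instance

instance (p : unitInterval) : IsProbabilityMeasure (tapeLaw p) := by
  unfold tapeLaw; infer_instance

theorem bernoulliMeasure_real_singleton (p : unitInterval) (b : Bool) :
    (bernoulliMeasure true false p).real {b} = bitWeight p b := by
  cases b <;> simp [bitWeight]

theorem realizationLaw_real_singleton (p : unitInterval) (r : Sym2 (Fin n) → Bool) :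
    (realizationLaw n p).real {r} = piWeight (Sym2 (Fin n)) (bitWeight p) r := by
  simp only [realizationLaw, measureReal_def, Measure.pi_singleton, ENNReal.toReal_prod, piWeight]
  exact Finset.prod_congr rfl fun e _ => bernoulliMeasure_real_singleton p (r e)

theorem pi_realizationLaw_real_singleton (p : unitInterval) {R : ℕ}
    (x : Fin R → Sym2 (Fin n) → Bool) :
    (Measure.pi fun _ : Fin R => realizationLaw n p).real {x} =
      piWeight (Fin R) (piWeight (Sym2 (Fin n)) (bitWeight p)) x := by
  simp only [measureReal_def, Measure.pi_singleton, ENNReal.toReal_prod, piWeight]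
  exact Finset.prod_congr rfl fun i _ => realizationLaw_real_singleton p (x i)

theorem integral_realizationLaw (p : unitInterval) (f : (Sym2 (Fin n) → Bool) → ℝ) :
    ∫ r, f r ∂(realizationLaw n p) = expect (piWeight (Sym2 (Fin n)) (bitWeight p)) f := by
  rw [integral_fintype .of_finite]
  simp only [realizationLaw_real_singleton, expect, smul_eq_mul]

theorem integral_pi_realizationLaw (p : unitInterval) {R : ℕ}
    (f : (Fin R → Sym2 (Fin n) → Bool) → ℝ) :
    ∫ x, f x ∂(Measure.pi fun _ : Fin R => realizationLaw n p) =
      expect (piWeight (Fin R) (piWeight (Sym2 (Fin n)) (bitWeight p))) f := by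
  rw [integral_fintype .of_finite]
  simp only [pi_realizationLaw_real_singleton, expect, smul_eq_mul]

/-- Different bits of the samples are at different positions of the tape. -/
theorem tapePosition_injective (n R : ℕ) : Function.Injective fun q : Fin R × Sym2 (Fin n) =>
    (q.1 : ℕ) * (n * n) + ((q.2.inf : ℕ) * n + q.2.sup) := by
  rintro ⟨i, e⟩ ⟨j, f⟩ h
  simp only at h
  have hb : ∀ g : Sym2 (Fin n), (g.inf : ℕ) * n + g.sup < n * n := fun g => by
    have h1 := g.inf.isLt
    have h2 := g.sup.isLt
    nlinarith
  have key : ∀ {a b c d m : ℕ}, b < m → d < m → a * m + b = c * m + d → a = c ∧ b = d := by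
    intro a b c d m hb hd h
    have hm : 0 < m := by omega
    have h1 : (b + m * a) / m = (d + m * c) / m := by congr 1; linarith
    rw [Nat.add_mul_div_left _ _ hm, Nat.add_mul_div_left _ _ hm, Nat.div_eq_of_lt hb,
      Nat.div_eq_of_lt hd] at h1
    have h2 : a = c := by omega
    subst h2
    exact ⟨rfl, by omega⟩
  obtain ⟨h1, h2⟩ := key (hb e) (hb f) h
  obtain ⟨h3, h4⟩ := key e.sup.isLt f.sup.isLt h2
  refine Prod.ext (Fin.ext h1) ?_
  exact Sym2.inf_eq_inf_and_sup_eq_sup.1 ⟨Fin.ext h3, Fin.ext h4⟩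

theorem measurable_sampleBits (n R : ℕ) :
    Measurable fun (ω : ℕ → Bool) (i : Fin R) => sampleBits n ω i := by
  refine measurable_pi_iff.2 fun i => measurable_pi_iff.2 fun e => ?_
  exact measurable_pi_apply _

/-- The preimage of a point prescribes bits at pairwise different positions of the tape and nothing
elsewhere, so its measure is the product of the weights of these bits. -/
theorem map_sampleBits_tapeLaw (n R : ℕ) (p : unitInterval) :
    (tapeLaw p).map (fun ω (i : Fin R) => sampleBits n ω i) =
      Measure.pi fun _ : Fin R => realizationLaw n p := by
  refine Measure.ext_of_singleton fun x => ?_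
  have hinj := tapePosition_injective n R
  set pos := fun q : Fin R × Sym2 (Fin n) =>
    (q.1 : ℕ) * (n * n) + ((q.2.inf : ℕ) * n + q.2.sup) with hpos
  set box : ℕ → Set Bool := Function.extend pos (fun q => {x q.1 q.2}) fun _ => Set.univ with hbox
  have hset : (fun (ω : ℕ → Bool) (i : Fin R) => sampleBits n ω i) ⁻¹' {x} =
      Set.pi (Finset.univ.image pos : Finset ℕ) box := by
    ext ω
    have hmem : ∀ q, ω (pos q) ∈ box (pos q) ↔ sampleBits n ω q.1 q.2 = x q.1 q.2 := fun q => by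
      rw [hbox, hinj.extend_apply]; rfl
    simp only [Set.mem_preimage, Set.mem_singleton_iff, funext_iff, Finset.coe_image,
      Finset.coe_univ, Set.image_univ, Set.mem_pi, Set.forall_mem_range, hmem, Prod.forall]
  rw [Measure.map_apply (measurable_sampleBits n R) (measurableSet_singleton x), hset, tapeLaw,
    Measure.infinitePi_pi _ fun _ _ => MeasurableSet.of_discrete,
    Finset.prod_image fun _ _ _ _ h => hinj h, Fintype.prod_prod_type, Measure.pi_singleton]
  refine Finset.prod_congr rfl fun i _ => ?_
  rw [realizationLaw, Measure.pi_singleton]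
  exact Finset.prod_congr rfl fun e _ => by rw [hbox, hinj.extend_apply]

theorem tapeQueries_eq (E : Finset (Sym2 (Fin n))) (R : ℕ) (ω : ℕ → Bool) :
    tapeQueries E R ω = unionOfMatchings thinMatching E fun i : Fin R => sampleBits n ω i := by
  ext e
  simp only [tapeQueries, unionOfMatchings, Finset.mem_biUnion, Finset.mem_range, Finset.mem_univ,
    true_and]
  exact ⟨fun ⟨i, hi, h⟩ => ⟨⟨i, hi⟩, h⟩, fun ⟨i, h⟩ => ⟨i, i.isLt, h⟩⟩

theorem tapeLaw_tapeQueries (E : Finset (Sym2 (Fin n))) (R : ℕ) (p : unitInterval)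
    (F : Finset (Sym2 (Fin n))) :
    tapeLaw p {ω | tapeQueries E R ω = F} =
      (Measure.pi fun _ : Fin R => realizationLaw n p)
        {x | unionOfMatchings thinMatching E x = F} := by
  rw [← map_sampleBits_tapeLaw, Measure.map_apply (measurable_sampleBits n R)
    (Set.toFinite _).measurableSet]
  simp only [tapeQueries_eq, Set.preimage_ofPred_eq]

/-- The queries depend on the tape only through finitely many samples, so the integral is one over a
finite product space, where it becomes the iterated sum. -/
theorem integral_matchingNumber_tapeQueries (E : Finset (Sym2 (Fin n))) (R : ℕ)
    (p : unitInterval) :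
    ∫ z, (matchingNumber (realized (tapeQueries E R z.1) z.2) : ℝ)
      ∂((tapeLaw p).prod (realizationLaw n p)) = expectedValue E p R := by
  set ν := Measure.pi fun _ : Fin R => realizationLaw n p
  have h := (Measure.map_prod_map (tapeLaw p) (realizationLaw n p) (measurable_sampleBits n R)
    measurable_id)
  rw [map_sampleBits_tapeLaw, Measure.map_id] at h
  set f : (Fin R → Sym2 (Fin n) → Bool) × (Sym2 (Fin n) → Bool) → ℝ := fun z =>
    (matchingNumber (realized (unionOfMatchings thinMatching E z.1) z.2) : ℝ) with hf
  have h1 : ∫ z, f z ∂(ν.prod (realizationLaw n p)) =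
      ∫ z, (matchingNumber (realized (tapeQueries E R z.1) z.2) : ℝ)
        ∂((tapeLaw p).prod (realizationLaw n p)) := by
    rw [h, integral_map ((measurable_sampleBits n R).prodMap measurable_id).aemeasurable
      (Measurable.of_discrete).aestronglyMeasurable]
    simp only [hf, tapeQueries_eq, Prod.map, id]
  rw [← h1, integral_prod _ .of_finite, integral_pi_realizationLaw]
  simp only [integral_realizationLaw, hf, expectedValue]

theorem card_filter_mem_le_one {H M : Finset (Sym2 (Fin n))} (h : IsMatchingOf H M) (v : Fin n) :
    (M.filter fun e => v ∈ e).card ≤ 1 :=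
  Finset.card_le_one.2 fun e he f hf =>
    h.2 e (Finset.mem_filter.1 he).1 f (Finset.mem_filter.1 hf).1 v (Finset.mem_filter.1 he).2
      (Finset.mem_filter.1 hf).2

/-- Each of the `R` matchings has at most one edge at `v`. -/
theorem card_filter_mem_tapeQueries_le (E : Finset (Sym2 (Fin n))) (R : ℕ) (ω : ℕ → Bool)
    (v : Fin n) : ((tapeQueries E R ω).filter fun e => v ∈ e).card ≤ R := by
  rw [tapeQueries, Finset.filter_biUnion]
  refine (Finset.card_biUnion_le_card_mul _ _ 1 fun i _ => ?_).trans (by simp)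
  exact card_filter_mem_le_one (isMaximumMatchingOf_thinMatching _).1 v

end Laws

theorem exists_coloredBy {n : ℕ} {G : SimpleGraph (Fin n)} [DecidableRel G.Adj]
    (hG : G.IsBipartite) : ∃ c : Fin n → Bool, ColoredBy c G.edgeFinset := by
  obtain ⟨C⟩ := hG
  refine ⟨fun v => decide (C v = 0), fun u v huv h => ?_⟩
  have hne := C.valid ((SimpleGraph.mem_edgeSet G).1 (SimpleGraph.mem_edgeFinset.1 huv))
  simp only [decide_eq_decide] at h
  generalize C u = a at *
  generalize C v = b at *
  revert h hne
  revert a b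
  decide

/-! ### The main theorem -/

theorem exp_one_div_gt : (0.731 : ℝ) < Real.exp 1 / (Real.exp 1 + 1) := by
  have := Real.exp_one_gt_d9
  rw [lt_div_iff₀ (by positivity)]
  norm_num at this ⊢
  linarith

/-- The accuracy parameters that belong to an approximation factor below `e / (e + 1)`. -/
theorem exists_parameters {α : ℝ} (hα : α < Real.exp 1 / (Real.exp 1 + 1)) :
    ∃ ε κ : ℝ, ∃ K : ℕ, 0 < ε ∧ ε ≤ 1 / 2 ∧ 0 < κ ∧ Real.exp (-κ) ≤ ε ∧ 0 < K ∧
      (1 + κ) / K ≤ 2 * ε ^ 5 ∧ α * (1 + Real.exp (-1)) ≤ 1 - 6 * ε := by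
  have h1 : α * (1 + Real.exp (-1)) < 1 := by
    have he : (1 + Real.exp (-1)) * (Real.exp 1 / (Real.exp 1 + 1)) = 1 := by
      rw [Real.exp_neg]
      have := Real.exp_pos 1
      field_simp
    calc α * (1 + Real.exp (-1))
        < Real.exp 1 / (Real.exp 1 + 1) * (1 + Real.exp (-1)) := by gcongr
      _ = 1 := by rw [mul_comm, he]
  -- The second entry of the minimum is what `α * (1 + exp (-1)) ≤ 1 - 6 * ε` needs. It is positive
  -- because `e / (e + 1)` is the reciprocal of `1 + exp (-1)`. With `κ = -log ε`, crucial pairs are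
  -- missed with probability at most `ε`.
  set ε := min (1 / 2) ((1 - α * (1 + Real.exp (-1))) / 6) with hε
  have hε0 : 0 < ε := lt_min (by norm_num) (by linarith)
  have hε1 : ε ≤ 1 / 2 := min_le_left _ _
  have hε2 : ε ≤ (1 - α * (1 + Real.exp (-1))) / 6 := min_le_right _ _
  have hlog : Real.log ε < 0 := Real.log_neg hε0 (by linarith)
  obtain ⟨K, hK⟩ := exists_nat_gt ((1 + -Real.log ε) / (2 * ε ^ 5))
  have hK0 : (0 : ℝ) < K := lt_of_le_of_lt (div_nonneg (by linarith) (by positivity)) hK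
  refine ⟨ε, -Real.log ε, K, hε0, hε1, by linarith, ?_, by exact_mod_cast hK0, ?_, by linarith⟩
  · rw [neg_neg, Real.exp_log hε0]
  · rw [div_lt_iff₀ (by positivity)] at hK
    rw [div_le_iff₀ hK0]
    linarith

/-- The ceiling is below `1 / p + 1 ≤ 2 / p`; the logarithm on the right is nonnegative and only
adds slack. -/
theorem natCeil_inv_le {p : ℝ} (hp : 0 < p) (hp1 : p ≤ 1) :
    (⌈1 / p⌉₊ : ℝ) ≤ 2 * ((1 + Real.log (1 / p)) / p) := by
  have h1 : 1 ≤ 1 / p := by rw [le_div_iff₀ hp]; linarith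
  have h2 := (Nat.ceil_lt_add_one (zero_le_one.trans h1)).le
  have h3 := Real.log_nonneg h1
  have h4 : 1 / p ≤ (1 + Real.log (1 / p)) / p := by gcongr; linarith
  linarith

theorem corollary1p1 :
    (0.731 : ℝ) < Real.exp 1 / (Real.exp 1 + 1) ∧
    ∀ α : ℝ, α < Real.exp 1 / (Real.exp 1 + 1) →
      ∃ (K : ℝ) (R : unitInterval → ℕ)
        (MM : ∀ n : ℕ, Finset (Sym2 (Fin n)) → Finset (Sym2 (Fin n)))
        (A : QueryAlgorithm) (T : Polynomial ℕ),
        -- the number of samples is `O(log (1 / p) / p)`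
        (∀ p : unitInterval, 0 < p → (R p : ℝ) ≤ K * ((1 + Real.log (1 / (p : ℝ))) / (p : ℝ))) ∧
        IsMaximumMatchingRule MM ∧
        ∀ (n : ℕ) (G : SimpleGraph (Fin n)) [DecidableRel G.Adj], G.IsBipartite →
        ∀ p : unitInterval, 0 < p →
          ∃ (Q : (ℕ → Bool) → Finset (Sym2 (Fin n)))
            (M : (ℕ → Bool) → (Sym2 (Fin n) → Bool) → Finset (Sym2 (Fin n))),
            -- polynomial running time
            (∀ ω r, ∃ t ≤ T.eval (n + ⌈1 / (p : ℝ)⌉₊),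
              A.Runs (p : ℝ) ω G.edgeFinset r t (Q ω) (M ω r)) ∧
            -- the queries are edges, at most `R p` of them at each vertex
            (∀ ω, Q ω ⊆ G.edgeFinset) ∧
            (∀ ω, ∀ v : Fin n, ((Q ω).filter fun e => v ∈ e).card ≤ R p) ∧
            -- they are distributed as the union of maximum matchings of `R p` realizations
            (∀ F : Finset (Sym2 (Fin n)),
              tapeLaw p {ω | Q ω = F} =
                (MeasureTheory.Measure.pi fun _ : Fin (R p) => realizationLaw n p)
                  {x | unionOfMatchings MM G.edgeFinset x = F}) ∧
            -- the output is a maximum matching of the realized queried edges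
            (∀ ω r, IsMaximumMatchingOf (realized (Q ω) r) (M ω r)) ∧
            (∀ ω r, IsMatchingOf (realized G.edgeFinset r) (M ω r)) ∧
            -- the approximation guarantee
            α * ∫ r, (matchingNumber (realized G.edgeFinset r) : ℝ) ∂(realizationLaw n p) ≤
              ∫ z, ((M z.1 z.2).card : ℝ) ∂((tapeLaw p).prod (realizationLaw n p)) := by
  refine ⟨exp_one_div_gt, fun α hα => ?_⟩
  obtain ⟨ε, κ, K, hε0, hε1, hκ0, hκ, hK0, hK, hαε⟩ := exists_parameters hα
  -- The factor `2` pays for rounding `1 / p` up.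
  refine ⟨K * 2, fun p => K * ⌈1 / (p : ℝ)⌉₊, fun _ => thinMatching _, matchingAlgorithm K,
    queryTime K, fun p hp => ?_, fun n G _ _ => isMaximumMatchingOf_thinMatching _,
    fun n G _ hG p hp => ?_⟩
  · push_cast
    rw [mul_assoc]
    exact mul_le_mul_of_nonneg_left (natCeil_inv_le hp p.2.2) (Nat.cast_nonneg K)
  have hp0 : (0 : ℝ) < p := hp
  obtain ⟨c, hc⟩ := exists_coloredBy hG
  set E := G.edgeFinset
  set R := K * ⌈1 / (p : ℝ)⌉₊ with hR
  have hsub : ∀ ω, tapeQueries E R ω ⊆ E := fun ω => by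
    rw [tapeQueries_eq]; exact unionOfMatchings_subset _
  have hmax : ∀ ω r, IsMaximumMatchingOf (realized (tapeQueries E R ω) r)
      (thinMatching n (realized (tapeQueries E R ω) r)) := fun ω r =>
    isMaximumMatchingOf_thinMatching _
  refine ⟨fun ω => tapeQueries E R ω, fun ω r => thinMatching n (realized (tapeQueries E R ω) r),
    fun ω r => matchingAlgorithm_runs hc hp0 K ω r, hsub,
    card_filter_mem_tapeQueries_le E R, tapeLaw_tapeQueries E R p, hmax,
    fun ω r => (hmax ω r).1.mono (Finset.filter_subset_filter _ (hsub ω)), ?_⟩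
  have hceil : 0 < ⌈1 / (p : ℝ)⌉₊ := Nat.ceil_pos.2 (by positivity)
  -- The number of samples scales with `1 / p`, hence the variance condition `(1 + κ) / (R * p) ≤ 2
  -- * ε ^ 5` follows from the one on `K`, uniformly in `p`.
  have hRp : (K : ℝ) ≤ R * p := by
    have := Nat.le_ceil (1 / (p : ℝ))
    rw [div_le_iff₀ hp0] at this
    rw [hR]
    push_cast
    nlinarith [(Nat.cast_pos (α := ℝ)).2 hK0]
  have hmain := le_expectedValue hp0 p.2.2 hc (Nat.mul_pos hK0 hceil) hκ0 hε0 hε1 hκ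
    ((div_le_div_of_nonneg_left (by linarith) (Nat.cast_pos.2 hK0) hRp).trans hK)
  simp only [fun ω r => (hmax ω r).2]
  rw [integral_matchingNumber_tapeQueries, integral_realizationLaw]
  rw [← integral_realizationLaw] at hmain ⊢
  have hX : 0 ≤ ∫ r, (matchingNumber (realized E r) : ℝ) ∂(realizationLaw n p) :=
    integral_nonneg fun r => Nat.cast_nonneg _
  have hpos : 0 < 1 + Real.exp (-1) := by positivity
  refine le_of_mul_le_mul_left ?_ hpos
  calc (1 + Real.exp (-1)) * (α * ∫ r, (matchingNumber (realized E r) : ℝ) ∂(realizationLaw n p))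
      = α * (1 + Real.exp (-1)) *
          ∫ r, (matchingNumber (realized E r) : ℝ) ∂(realizationLaw n p) := by ring
    _ ≤ (1 - 6 * ε) * ∫ r, (matchingNumber (realized E r) : ℝ) ∂(realizationLaw n p) :=
        mul_le_mul_of_nonneg_right hαε hX
    _ ≤ _ := hmain
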